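/- Let $n\ge 3$, $C_1>0$ and $1<\delta\le 3$, and let $V\in L^\infty(\mathbb{R}^n)$ be a real-valued potential such that $$|V(x)|\le C_1(|x|+1)^{-\delta}\quad\text{for almost every } x\in\mathbb{R}^n .$$ For $h>0$ consider the Schrödinger operator $P(h)=-h^2\Delta+V$ on $L^2=L^2(\mathbb{R}^n)$ with domain the Sobolev space $H^2(\mathbb{R}^n)$, where $\Delta=\sum_{j=1}^n\partial_{x_j}^2$. Let $E>0$ and $s>1/2$. Then there exist constants $C>0$ and $h_0>0$, independent of $h$ and $\theta$, such that for all $0<h\le h_0$, all $0<\theta<1$ and both choices of the sign $\pm$, the bounded inverse $(P(h)-E\pm i\theta)^{-1}:L^2\to L^2$ exists and $$\log\left\|(|x|+1)^{-s}\,(P(h)-E\pm i\theta)^{-1}\,(|x|+1)^{-s}\right\|_{L^2\to L^2}\le C\,h^{-\frac{2\delta+5}{3(\delta-1)}} .$$ -/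

import Mathlib

open MeasureTheory TemperedDistribution
open scoped ENNReal Laplacian

noncomputable section

namespace Semiclassical

/-- The space `ℝⁿ` with its Euclidean norm. -/
abbrev Rn (n : ℕ) : Type := EuclideanSpace ℝ (Fin n)

/-- The complex Hilbert space `L²(ℝⁿ)` with respect to Lebesgue measure. -/
abbrev L2 (n : ℕ) : Type := Lp ℂ 2 (volume : Measure (Rn n))

/-- The Sobolev space `H²(ℝⁿ)`, as a subspace of `L²(ℝⁿ)`. -/
def H2 (n : ℕ) : Submodule ℂ (L2 n) where
  carrier := {f | MemSobolev 2 2 (Lp.toTemperedDistribution f)}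
  zero_mem' := by
    have h := memSobolev_fun_zero (Rn n) ℂ 2 2
    rw [← map_zero (Lp.toTemperedDistributionCLM ℂ (volume : Measure (Rn n)) 2)] at h
    exact h
  add_mem' {f g} hf hg := by
    have h := MemSobolev.add hf hg
    simp only [← Lp.toTemperedDistributionCLM_apply, ← map_add] at h
    exact h
  smul_mem' c f hf := by
    have h := MemSobolev.smul c hf
    simp only [← Lp.toTemperedDistributionCLM_apply, ← map_smul] at h
    exact h

theorem mem_H2_iff {n : ℕ} {f : L2 n} :
    f ∈ H2 n ↔ MemSobolev 2 2 (Lp.toTemperedDistribution f) := Iff.rfl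

theorem exists_laplacian {n : ℕ} (f : H2 n) :
    ∃ g : L2 n, Lp.toTemperedDistribution g = Δ (Lp.toTemperedDistribution (f : L2 n)) := by
  have h := MemSobolev.laplacian (mem_H2_iff.mp f.2)
  rw [sub_self, memSobolev_zero_iff] at h
  obtain ⟨g, hg⟩ := h
  exact ⟨g, hg.symm⟩

theorem toTemperedDistribution_inj {n : ℕ} {f g : L2 n}
    (h : Lp.toTemperedDistribution f = Lp.toTemperedDistribution g) : f = g :=
  LinearMap.ker_eq_bot.mp
    (Lp.ker_toTemperedDistributionCLM_eq_bot (F := ℂ) (μ := (volume : Measure (Rn n))) (p := 2)) h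

/-- The Laplacian `Δ = ∂₁² + ⋯ + ∂ₙ²` (in the sense of distributions) as an unbounded operator on
`L²(ℝⁿ)` with domain `H²(ℝⁿ)`. -/
def laplacian (n : ℕ) : L2 n →ₗ.[ℂ] L2 n where
  domain := H2 n
  toFun :=
    { toFun := fun f => (exists_laplacian f).choose
      map_add' := fun f g => by
        apply toTemperedDistribution_inj
        rw [(exists_laplacian (f + g)).choose_spec]
        simp only [← Lp.toTemperedDistributionCLM_apply, map_add, Submodule.coe_add]
        simp only [Lp.toTemperedDistributionCLM_apply, (exists_laplacian f).choose_spec,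
          (exists_laplacian g).choose_spec]
        simp only [← laplacianCLM_apply, map_add]
      map_smul' := fun c f => by
        apply toTemperedDistribution_inj
        rw [(exists_laplacian (c • f)).choose_spec]
        simp only [← Lp.toTemperedDistributionCLM_apply, map_smul, Submodule.coe_smul,
          RingHom.id_apply]
        simp only [Lp.toTemperedDistributionCLM_apply, (exists_laplacian f).choose_spec]
        simp only [← laplacianCLM_apply, map_smul] }

theorem laplacian_spec {n : ℕ} (f : (laplacian n).domain) :
    Lp.toTemperedDistribution (laplacian n f) = Δ (Lp.toTemperedDistribution (f : L2 n)) :=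
  (exists_laplacian f).choose_spec

/-- Multiplication by an essentially bounded real function, as a bounded operator on `L²(ℝⁿ)`. -/
def mulOp {n : ℕ} {w : Rn n → ℝ} (hw : MemLp w ∞ volume) : L2 n →L[ℂ] L2 n :=
  (ContinuousLinearMap.mul ℂ ℂ).holderL volume ∞ 2 2 (hw.ofReal (K := ℂ)).toLp

theorem mulOp_ae {n : ℕ} {w : Rn n → ℝ} (hw : MemLp w ∞ volume) (f : L2 n) :
    mulOp hw f =ᵐ[volume] fun x => (w x : ℂ) * f x := by
  have h := (ContinuousLinearMap.mul ℂ ℂ).coeFn_holder (r := 2) (hw.ofReal (K := ℂ)).toLp f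
  filter_upwards [h, (hw.ofReal (K := ℂ)).coeFn_toLp] with x h1 h2
  rw [mulOp, ContinuousLinearMap.holderL_apply_apply, h1, h2]
  rfl

/-- The Schrödinger operator `P(h) = -h² Δ + V` on `L²(ℝⁿ)` with domain `H²(ℝⁿ)`, for a real-valued
potential `V ∈ L^∞(ℝⁿ)`. -/
def schrodinger {n : ℕ} (h : ℝ) {V : Rn n → ℝ} (hV : MemLp V ∞ volume) : L2 n →ₗ.[ℂ] L2 n where
  domain := (laplacian n).domain
  toFun := -((h : ℂ) ^ 2 • (laplacian n).toFun) +
    (mulOp hV : L2 n →ₗ[ℂ] L2 n).domRestrict (laplacian n).domain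

theorem schrodinger_apply {n : ℕ} (h : ℝ) {V : Rn n → ℝ} (hV : MemLp V ∞ volume)
    (f : (laplacian n).domain) :
    schrodinger h hV f = -((h : ℂ) ^ 2 • laplacian n f) + mulOp hV (f : L2 n) := rfl

/-- The weight `x ↦ (|x| + 1)^(-s)`. -/
def weight (n : ℕ) (s : ℝ) : Rn n → ℝ := fun x => (‖x‖ + 1) ^ (-s)

theorem weight_memLp (n : ℕ) {s : ℝ} (hs : 0 ≤ s) : MemLp (weight n s) ∞ volume := by
  refine memLp_top_of_bound (C := 1) ?_ (Filter.Eventually.of_forall fun x => ?_)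
  · refine Continuous.aestronglyMeasurable ?_
    refine Continuous.rpow_const (by fun_prop) fun x => Or.inl ?_
    positivity
  · rw [weight, Real.norm_of_nonneg (by positivity)]
    exact Real.rpow_le_one_of_one_le_of_nonpos (by linarith [norm_nonneg x]) (by linarith)

/-- `R` is the resolvent `(P - z)⁻¹` of the unbounded operator `P` at `z`: a bounded operator,
defined on the whole space, which is a two-sided inverse of `P - z : dom P → H`. -/
def IsResolvent {H : Type*} [NormedAddCommGroup H] [NormedSpace ℂ H]
    (P : H →ₗ.[ℂ] H) (z : ℂ) (R : H →L[ℂ] H) : Prop :=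
  (∀ g : H, ∃ hg : R g ∈ P.domain, P ⟨R g, hg⟩ - z • R g = g) ∧
    ∀ f : P.domain, R (P f - z • (f : H)) = f

theorem IsResolvent.unique {H : Type*} [NormedAddCommGroup H] [NormedSpace ℂ H]
    {P : H →ₗ.[ℂ] H} {z : ℂ} {R R' : H →L[ℂ] H}
    (hR : IsResolvent P z R) (hR' : IsResolvent P z R') : R = R' := by
  ext g
  obtain ⟨hg, h⟩ := hR.1 g
  have h' := hR'.2 ⟨R g, hg⟩
  simp only [h] at h'
  exact h'.symm

/-- `(|x| + 1)^(-s) ∘ R ∘ (|x| + 1)^(-s)`, where the two weights act by multiplication. -/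
def weighted {n : ℕ} {s : ℝ} (hs : 0 ≤ s) (R : L2 n →L[ℂ] L2 n) : L2 n →L[ℂ] L2 n :=
  mulOp (weight_memLp n hs) ∘L R ∘L mulOp (weight_memLp n hs)

end Semiclassical

end

/-! The resolvent bound comes from a global Carleman estimate with a radial phase `φ` and a radial
multiplier `m`. Put `r = |x|`, `∇φ = ψ x` and `v = exp(φ/h) u`. The conjugated operator is paired
with `2 m gen v`, where `gen = x·∇ + (n-1)/2`. In dimension `n ≥ 3` the Laplacian contributes a
nonnegative multiple of `(gen v)²` (`morawetz`): after the substitution `r^((n-1)/2) v` the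
inverse-square term has coefficient `(n-1)(n-3)/4`. The conjugation contributes `4hψm (gen v)²`, and
the energy contributes `M v²`, with `M` the `r`-derivative of `r m (E + |∇φ|²)`
(`energy_inequality`). The potential is only bounded, so it is never differentiated. Together with
the conjugation remainder `W` it is absorbed by Cauchy–Schwarz as soon as `(m(V+W))² ≤ (9/16) D M`,
where `D` is the total coefficient of `(gen v)²` (`RadialWeights.carleman`).

This pointwise inequality is arranged at three squared length scales `e ≤ b ≤ a`. The phase
satisfies `hψ ~ C (1+r²/e)^(ν-1)` and saturates near `r² = a`, so it is bounded; the increasing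
function `r m` is bounded as well. For `r² ≤ e/100` the large constant `C` beats `V`. Up to `b` the
decisive term is `(r²/h²)(hψ)³`, which is of size `r^(6ν-4)` when `e^(3(1-ν)) = h²` and so beats
`V²` without a smallness assumption on `V`. Beyond `b` the potential and the phase are small and the
term `E (rm)'` suffices (`Scales.pointwise`). The supremum of `φ/h` is of order `e^(1-ν) a^ν / h²`.
With `ν = (13-δ)/36` and `a = h^(-18/(5(δ-1)))` it is at most a constant times `h^(-q)`, `q =
(2δ+5)/(3(δ-1))`, exactly because `δ ≤ 3`. All other losses are powers of `1/h` and are absorbed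
into the exponential.

The estimate concerns real compactly supported `C²` functions and allows a right-hand side `weight ·
g + r`. The residual `r` costs `κ⁻¹∫r²` and brings in `κ∫u²`, for any `κ` in `(0,1]`. Taking real
and imaginary parts of the resolvent equation puts the `±iθ` term into `r`; the choice `κ = θ` turns
it into a multiple of `θ‖u‖²`, and `θ‖u‖²` is bounded by `‖weight·u‖ ‖g‖` because `P(h)` is
symmetric. This makes the bound uniform in `θ` (`CarlemanBound.norm_le`). Existence of the resolvent
follows from self-adjointness, obtained from the surjective symmetric operator `1 - (2π)⁻²Δ` and a
bounded perturbation. Compactly supported `C²` functions are dense in `H²` for the graph norm, which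
carries the estimate to the whole domain. -/

noncomputable section
namespace Semiclassical

/-! ### Partial derivatives and integration by parts -/

/-- The partial derivative `∂ᵢ a`. -/
def pd {n : ℕ} (i : Fin n) (a : Rn n → ℝ) : Rn n → ℝ :=
  fun x => fderiv ℝ a x (EuclideanSpace.single i 1)

/-- The Laplacian `∑ᵢ ∂ᵢ ∂ᵢ a`. -/
def lap {n : ℕ} (a : Rn n → ℝ) : Rn n → ℝ := fun x => ∑ i, pd i (pd i a) x

/-- The Euler field `x · ∇ a`. -/
def euler {n : ℕ} (a : Rn n → ℝ) : Rn n → ℝ := fun x => ∑ i, x i * pd i a x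

/-- The squared length of the gradient. -/
def gradSq {n : ℕ} (a : Rn n → ℝ) : Rn n → ℝ := fun x => ∑ i, pd i a x ^ 2

/-- `q` is the radial derivative coefficient of `m`, i.e. `∇ m (x) = q(x) x`. -/
def HasRadialDeriv {n : ℕ} (m q : Rn n → ℝ) : Prop :=
  ∀ x, HasFDerivAt m (q x • innerSL ℝ x) x

variable {n : ℕ}

theorem normSq_eq_sum (x : Rn n) : ‖x‖ ^ 2 = ∑ i, x i ^ 2 := by
  rw [EuclideanSpace.norm_sq_eq]; simp

theorem inner_single (x : Rn n) (i : Fin n) :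
    inner ℝ x (EuclideanSpace.single i (1 : ℝ)) = x i := by
  simp [EuclideanSpace.inner_single_right]

theorem HasRadialDeriv.pd_eq {m q : Rn n → ℝ} (h : HasRadialDeriv m q) (i : Fin n) (x : Rn n) :
    pd i m x = q x * x i := by
  simp [pd, (h x).fderiv, inner_single]

theorem pd_mul {f g : Rn n → ℝ} {x : Rn n} (i : Fin n) (hf : DifferentiableAt ℝ f x)
    (hg : DifferentiableAt ℝ g x) :
    pd i (fun y => f y * g y) x = pd i f x * g x + f x * pd i g x := by
  simp only [pd]
  rw [fderiv_fun_mul hf hg]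
  simp
  ring

theorem pd_add {f g : Rn n → ℝ} {x : Rn n} (i : Fin n) (hf : DifferentiableAt ℝ f x)
    (hg : DifferentiableAt ℝ g x) :
    pd i (fun y => f y + g y) x = pd i f x + pd i g x := by
  simp only [pd]
  rw [fderiv_fun_add hf hg]
  simp

theorem pd_const_mul {f : Rn n → ℝ} {x : Rn n} (i : Fin n) (c : ℝ)
    (hf : DifferentiableAt ℝ f x) :
    pd i (fun y => c * f y) x = c * pd i f x := by
  simp only [pd]
  rw [fderiv_const_mul hf]
  simp

theorem pd_sum {ι : Type*} {s : Finset ι} {f : ι → Rn n → ℝ} {x : Rn n} (i : Fin n)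
    (hf : ∀ j ∈ s, DifferentiableAt ℝ (f j) x) :
    pd i (fun y => ∑ j ∈ s, f j y) x = ∑ j ∈ s, pd i (f j) x := by
  simp only [pd]
  rw [fderiv_fun_sum hf]
  simp

theorem pd_coord (i j : Fin n) (x : Rn n) :
    pd i (fun y : Rn n => y j) x = if i = j then 1 else 0 := by
  have : HasFDerivAt (fun y : Rn n => y j) (EuclideanSpace.proj j : Rn n →L[ℝ] ℝ) x :=
    (EuclideanSpace.proj j : Rn n →L[ℝ] ℝ).hasFDerivAt
  simp only [pd, this.fderiv]
  simp [eq_comm]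

theorem contDiff_coord (j : Fin n) {k : WithTop ℕ∞} : ContDiff ℝ k (fun y : Rn n => y j) :=
  (EuclideanSpace.proj j : Rn n →L[ℝ] ℝ).contDiff

theorem contDiff_pd {a : Rn n → ℝ} (ha : ContDiff ℝ 2 a) (i : Fin n) : ContDiff ℝ 1 (pd i a) :=
  (ha.fderiv_right (m := 1) (by norm_num)).clm_apply contDiff_const

theorem continuous_pd {a : Rn n → ℝ} (ha : ContDiff ℝ 1 a) (i : Fin n) : Continuous (pd i a) :=
  (ha.continuous_fderiv (by norm_num)).clm_apply continuous_const

theorem pd_comm {a : Rn n → ℝ} (ha : ContDiff ℝ 2 a) (i j : Fin n) (x : Rn n) :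
    pd i (pd j a) x = pd j (pd i a) x := by
  have hd : DifferentiableAt ℝ (fderiv ℝ a) x :=
    ((ha.fderiv_right (m := 1) (by norm_num)).differentiable (by norm_num)) x
  have key : ∀ i j : Fin n, pd i (pd j a) x =
      fderiv ℝ (fderiv ℝ a) x (EuclideanSpace.single i 1) (EuclideanSpace.single j 1) := by
    intro i j
    change fderiv ℝ (fun y => fderiv ℝ a y (EuclideanSpace.single j 1)) x _ = _
    rw [fderiv_clm_apply hd (differentiableAt_const _)]
    simp
  rw [key, key]
  exact (ha.contDiffAt.isSymmSndFDerivAt (by simp)).eq _ _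

theorem pd_eq_zero {a : Rn n → ℝ} {x : Rn n} (hx : x ∉ tsupport a) (i : Fin n) : pd i a x = 0 := by
  have : fderiv ℝ a x = 0 := by
    by_contra h
    exact hx (support_fderiv_subset ℝ (Function.mem_support.mpr h))
  simp [pd, this]

theorem tsupport_pd_subset (a : Rn n → ℝ) (i : Fin n) : tsupport (pd i a) ⊆ tsupport a := by
  refine closure_minimal (fun x hx => ?_) (isClosed_tsupport a)
  by_contra h
  exact hx (pd_eq_zero h i)

theorem hasCompactSupport_pd {a : Rn n → ℝ} (ha : HasCompactSupport a) (i : Fin n) :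
    HasCompactSupport (pd i a) :=
  ha.of_isClosed_subset (isClosed_tsupport _) (tsupport_pd_subset a i)

theorem lap_eq_zero {a : Rn n → ℝ} {x : Rn n} (hx : x ∉ tsupport a) : lap a x = 0 :=
  Finset.sum_eq_zero fun i _ => pd_eq_zero (fun h => hx (tsupport_pd_subset a i h)) i

theorem euler_eq_zero {a : Rn n → ℝ} {x : Rn n} (hx : x ∉ tsupport a) : euler a x = 0 :=
  Finset.sum_eq_zero fun i _ => by rw [pd_eq_zero hx, mul_zero]

theorem gradSq_eq_zero {a : Rn n → ℝ} {x : Rn n} (hx : x ∉ tsupport a) : gradSq a x = 0 :=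
  Finset.sum_eq_zero fun i _ => by rw [pd_eq_zero hx]; simp

theorem continuous_euler {a : Rn n → ℝ} (ha : ContDiff ℝ 1 a) : Continuous (euler a) :=
  continuous_finsetSum _ fun i _ =>
    ((contDiff_coord i (k := 0)).continuous).mul (continuous_pd ha i)

theorem continuous_gradSq {a : Rn n → ℝ} (ha : ContDiff ℝ 1 a) : Continuous (gradSq a) :=
  continuous_finsetSum _ fun i _ => (continuous_pd ha i).pow 2

theorem continuous_lap {a : Rn n → ℝ} (ha : ContDiff ℝ 2 a) : Continuous (lap a) :=
  continuous_finsetSum _ fun i _ => continuous_pd (contDiff_pd ha i) i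

theorem gradSq_nonneg (a : Rn n → ℝ) (x : Rn n) : 0 ≤ gradSq a x :=
  Finset.sum_nonneg fun _ _ => sq_nonneg _

theorem euler_sq_le (a : Rn n → ℝ) (x : Rn n) : euler a x ^ 2 ≤ ‖x‖ ^ 2 * gradSq a x := by
  rw [normSq_eq_sum]
  exact Finset.sum_mul_sq_le_sq_mul_sq _ _ _

/-- A continuous function vanishing off a compact set is integrable. -/
theorem integrable_of_supported {a f : Rn n → ℝ} (ha : HasCompactSupport a) (hf : Continuous f)
    (h : ∀ x, x ∉ tsupport a → f x = 0) : Integrable f :=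
  hf.integrable_of_hasCompactSupport (HasCompactSupport.intro ha.isCompact h)

theorem integral_pd_eq_zero {f : Rn n → ℝ} (hf : ContDiff ℝ 1 f) (hs : HasCompactSupport f)
    (i : Fin n) : ∫ x, pd i f x = 0 := by
  have hi : Integrable (pd i f) :=
    (continuous_pd hf i).integrable_of_hasCompactSupport (hasCompactSupport_pd hs i)
  have h := integral_mul_fderiv_eq_neg_fderiv_mul_of_integrable (μ := (volume : Measure (Rn n)))
    (f := fun _ : Rn n => (1 : ℝ)) (g := f) (v := EuclideanSpace.single i 1)
    (by simp) (by simp only [one_mul]; exact hi)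
    (by simpa using hf.continuous.integrable_of_hasCompactSupport hs)
    (by fun_prop) (fun x _ => hf.differentiable (by norm_num) x)
  simp only [one_mul, fderiv_fun_const, Pi.zero_apply, _root_.zero_apply, zero_mul,
    integral_zero, neg_zero] at h
  exact h

theorem integral_div_eq_zero {a : Rn n → ℝ} (ha : HasCompactSupport a) {J : Fin n → Rn n → ℝ}
    (hJ : ∀ i, ContDiff ℝ 1 (J i)) (hs : ∀ i x, x ∉ tsupport a → J i x = 0) :
    ∫ x, ∑ i, pd i (J i) x = 0 := by
  have hc : ∀ i, HasCompactSupport (J i) := fun i => HasCompactSupport.intro ha.isCompact (hs i)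
  rw [integral_finsetSum _ fun i _ =>
    (continuous_pd (hJ i) i).integrable_of_hasCompactSupport (hasCompactSupport_pd (hc i) i)]
  exact Finset.sum_eq_zero fun i _ => integral_pd_eq_zero (hJ i) (hc i) i

theorem HasRadialDeriv.contDiff {m q : Rn n → ℝ} (h : HasRadialDeriv m q) (hq : Continuous q) :
    ContDiff ℝ 1 m := by
  rw [contDiff_one_iff_fderiv]
  refine ⟨fun x => (h x).differentiableAt, ?_⟩
  have : fderiv ℝ m = fun x => q x • innerSL ℝ x := funext fun x => (h x).fderiv
  rw [this]
  exact hq.smul (innerSL ℝ).continuous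

theorem HasRadialDeriv.mul {m q m' q' : Rn n → ℝ} (h : HasRadialDeriv m q)
    (h' : HasRadialDeriv m' q') :
    HasRadialDeriv (fun x => m x * m' x) (fun x => q x * m' x + m x * q' x) := fun x => by
  convert! (h x).mul (h' x) using 1
  ext y
  simp
  ring

theorem HasRadialDeriv.const_add {m q : Rn n → ℝ} (h : HasRadialDeriv m q) (c : ℝ) :
    HasRadialDeriv (fun x => c + m x) q := fun x => (h x).const_add c

/-- Radial functions are written through `|x|²` rather than `|x|`, so that nothing is singular at
the origin; the 2 comes from `∇|x|² = 2x`. -/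
theorem hasRadialDeriv_comp {g : ℝ → ℝ} {g' : ℝ → ℝ} (h : ∀ t, 0 ≤ t → HasDerivAt g (g' t) t) :
    HasRadialDeriv (fun x : Rn n => g (‖x‖ ^ 2)) (fun x => 2 * g' (‖x‖ ^ 2)) := fun x => by
  convert! (h (‖x‖ ^ 2) (by positivity)).comp_hasFDerivAt x
    (hasStrictFDerivAt_norm_sq x).hasFDerivAt using 1
  ext y
  simp
  ring

theorem hasRadialDeriv_normSq : HasRadialDeriv (fun x : Rn n => ‖x‖ ^ 2) (fun _ => 2) := by
  simpa using hasRadialDeriv_comp (n := n) (g := fun t => t) (g' := fun _ => 1)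
    fun t _ => hasDerivAt_id t

end Semiclassical
end

/-! ### The Pohozaev–Morawetz identity and its positivity for `n ≥ 3`. -/

noncomputable section
namespace Semiclassical
variable {n : ℕ}

/-- The generator `x · ∇ a + (n-1)/2 a`. -/
def gen (a : Rn n → ℝ) : Rn n → ℝ := fun x => euler a x + ((n : ℝ) - 1) / 2 * a x

theorem continuous_gen {a : Rn n → ℝ} (ha : ContDiff ℝ 1 a) : Continuous (gen a) :=
  (continuous_euler ha).add (continuous_const.mul ha.continuous)

theorem gen_eq_zero {a : Rn n → ℝ} {x : Rn n} (hx : x ∉ tsupport a) : gen a x = 0 := by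
  simp [gen, euler_eq_zero hx, image_eq_zero_of_notMem_tsupport hx]

theorem pd_euler {a : Rn n → ℝ} (ha : ContDiff ℝ 2 a) (i : Fin n) (x : Rn n) :
    pd i (euler a) x = pd i a x + ∑ j, x j * pd i (pd j a) x := by
  have hc : ∀ j : Fin n, DifferentiableAt ℝ (fun y : Rn n => y j) x := fun j =>
    (contDiff_coord j (k := 1)).differentiable (by norm_num) x
  have hd : ∀ j, DifferentiableAt ℝ (pd j a) x := fun j =>
    (contDiff_pd ha j).differentiable (by norm_num) x
  change pd i (fun y => ∑ j, y j * pd j a y) x = _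
  rw [pd_sum i fun j _ => (hc j).fun_mul (hd j)]
  simp only [pd_mul i (hc _) (hd _), pd_coord, Finset.sum_add_distrib]
  simp

theorem pd_gradSq {a : Rn n → ℝ} (ha : ContDiff ℝ 2 a) (i : Fin n) (x : Rn n) :
    pd i (gradSq a) x = 2 * ∑ j, pd j a x * pd i (pd j a) x := by
  have hd : ∀ j, DifferentiableAt ℝ (pd j a) x := fun j =>
    (contDiff_pd ha j).differentiable (by norm_num) x
  have : gradSq a = fun y => ∑ j, pd j a y * pd j a y := by
    ext y; simp [gradSq, pow_two]
  rw [this, pd_sum i fun j _ => (hd j).fun_mul (hd j), Finset.mul_sum]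
  refine Finset.sum_congr rfl fun j _ => ?_
  rw [pd_mul i (hd j) (hd j)]
  ring

theorem contDiff_euler {a : Rn n → ℝ} (ha : ContDiff ℝ 2 a) : ContDiff ℝ 1 (euler a) :=
  ContDiff.sum fun i _ => (contDiff_coord i).mul (contDiff_pd ha i)

theorem contDiff_gradSq {a : Rn n → ℝ} (ha : ContDiff ℝ 2 a) : ContDiff ℝ 1 (gradSq a) :=
  ContDiff.sum fun i _ => (contDiff_pd ha i).pow 2

/-- The divergence of the radial field `k(x) x a²` integrates to zero. -/
theorem integral_radial {a k k₁ : Rn n → ℝ} (ha : ContDiff ℝ 1 a) (hs : HasCompactSupport a)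
    (hk : HasRadialDeriv k k₁) (hc : Continuous k₁) :
    ∫ x, (((n : ℝ) * k x + ‖x‖ ^ 2 * k₁ x) * a x ^ 2 + 2 * k x * a x * euler a x) = 0 := by
  have hk1 : ContDiff ℝ 1 k := hk.contDiff hc
  rw [← integral_div_eq_zero hs (J := fun i x => x i * (k x * (a x * a x)))
    (fun i => (contDiff_coord i).mul (hk1.mul (ha.mul ha)))
    (fun i x hx => by simp [image_eq_zero_of_notMem_tsupport hx])]
  refine integral_congr_ae (Filter.Eventually.of_forall fun x => ?_)
  have hda : DifferentiableAt ℝ a x := ha.differentiable (by norm_num) x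
  have hdk : DifferentiableAt ℝ k x := hk1.differentiable (by norm_num) x
  have hcd : ∀ j : Fin n, DifferentiableAt ℝ (fun y : Rn n => y j) x := fun j =>
    (contDiff_coord j (k := 1)).differentiable (by norm_num) x
  have hterm : ∀ i : Fin n, pd i (fun x => x i * (k x * (a x * a x))) x =
      k x * a x ^ 2 + k₁ x * a x ^ 2 * x i ^ 2 + 2 * k x * a x * (x i * pd i a x) := by
    intro i
    rw [pd_mul i (hcd i) (hdk.fun_mul (hda.fun_mul hda)),
      pd_mul i hdk (hda.fun_mul hda), pd_mul i hda hda,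
      pd_coord, hk.pd_eq]
    simp only [if_true]
    ring
  simp only [hterm, Finset.sum_add_distrib, ← Finset.mul_sum, euler, normSq_eq_sum]
  simp
  ring

theorem integral_neg_lap_mul {a : Rn n → ℝ} (ha : ContDiff ℝ 2 a) (hs : HasCompactSupport a) :
    ∫ x, -(lap a x) * a x = ∫ x, gradSq a x := by
  have ha1 : ContDiff ℝ 1 a := ha.of_le (by norm_num)
  have h := integral_div_eq_zero hs (J := fun i x => pd i a x * a x)
    (fun i => (contDiff_pd ha i).mul ha1)
    (fun i x hx => by simp [image_eq_zero_of_notMem_tsupport hx])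
  have h1 : Integrable fun x => -(lap a x) * a x :=
    integrable_of_supported hs ((continuous_lap ha).neg.mul ha.continuous)
      fun x hx => by simp [image_eq_zero_of_notMem_tsupport hx]
  have h2 : Integrable (gradSq a) :=
    integrable_of_supported hs (continuous_gradSq ha1) fun x hx => gradSq_eq_zero hx
  rw [← sub_eq_zero, ← integral_sub h1 h2, ← neg_eq_zero, ← integral_neg, ← h]
  refine integral_congr_ae (Filter.Eventually.of_forall fun x => ?_)
  have hd : ∀ i, pd i (fun x => pd i a x * a x) x = pd i (pd i a) x * a x + pd i a x ^ 2 := by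
    intro i
    rw [pd_mul i ((contDiff_pd ha i).differentiable (by norm_num) x)
      (ha1.differentiable (by norm_num) x)]
    ring
  simp only [hd, Finset.sum_add_distrib, ← Finset.sum_mul, lap, gradSq]
  ring

/-- The Pohozaev–Morawetz identity for the multiplier `m (x · ∇ + (n-1)/2)`. -/
theorem integral_pohozaev {a m m₁ : Rn n → ℝ} (ha : ContDiff ℝ 2 a) (hs : HasCompactSupport a)
    (hm : HasRadialDeriv m m₁) (hc : Continuous m₁) :
    ∫ x, -(lap a x) * (2 * m x * gen a x) =
      ∫ x, (2 * m₁ x * euler a x ^ 2 + (m x - ‖x‖ ^ 2 * m₁ x) * gradSq a x +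
        ((n : ℝ) - 1) * m₁ x * a x * euler a x) := by
  have ha1 : ContDiff ℝ 1 a := ha.of_le (by norm_num)
  have hm1 : ContDiff ℝ 1 m := hm.contDiff hc
  have hzero := fun (x : Rn n) (hx : x ∉ tsupport a) => image_eq_zero_of_notMem_tsupport hx
  -- The flux is `-2m (x·∇a)∇a + m|∇a|² x - (n-1) m a ∇a`; its divergence is the difference of the
  -- two integrands.
  have h := integral_div_eq_zero hs (J := fun i x =>
      ((-2) * (pd i a x * (m x * euler a x)) + x i * (m x * gradSq a x)) +
        (-((n : ℝ) - 1)) * (m x * (a x * pd i a x)))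
    (fun i => ((contDiff_const.mul ((contDiff_pd ha i).mul (hm1.mul (contDiff_euler ha)))).add
      ((contDiff_coord i).mul (hm1.mul (contDiff_gradSq ha)))).add
        (contDiff_const.mul (hm1.mul (ha1.mul (contDiff_pd ha i)))))
    (fun i x hx => by simp [hzero x hx, euler_eq_zero hx, gradSq_eq_zero hx])
  have h1 : Integrable fun x => -(lap a x) * (2 * m x * gen a x) :=
    integrable_of_supported hs ((continuous_lap ha).neg.mul
      ((continuous_const.mul hm1.continuous).mul (continuous_gen ha1)))
      fun x hx => by simp [gen_eq_zero hx]
  have h2 : Integrable fun x => (2 * m₁ x * euler a x ^ 2 + (m x - ‖x‖ ^ 2 * m₁ x) * gradSq a x +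
        ((n : ℝ) - 1) * m₁ x * a x * euler a x) := by
    refine integrable_of_supported hs ?_
      fun x hx => by simp [euler_eq_zero hx, gradSq_eq_zero hx]
    have := continuous_euler ha1
    have := continuous_gradSq ha1
    have := hm1.continuous
    have := ha1.continuous
    fun_prop
  rw [← sub_eq_zero, ← integral_sub h1 h2, ← h]
  refine integral_congr_ae (Filter.Eventually.of_forall fun x => ?_)
  have dp : ∀ i, DifferentiableAt ℝ (pd i a) x := fun i =>
    (contDiff_pd ha i).differentiable (by norm_num) x
  have da : DifferentiableAt ℝ a x := ha1.differentiable (by norm_num) x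
  have dm : DifferentiableAt ℝ m x := hm1.differentiable (by norm_num) x
  have de : DifferentiableAt ℝ (euler a) x := (contDiff_euler ha).differentiable (by norm_num) x
  have dg : DifferentiableAt ℝ (gradSq a) x := (contDiff_gradSq ha).differentiable (by norm_num) x
  have dc : ∀ j : Fin n, DifferentiableAt ℝ (fun y : Rn n => y j) x := fun j =>
    (contDiff_coord j (k := 1)).differentiable (by norm_num) x
  have hd : ∀ i, pd i (fun x => ((-2) * (pd i a x * (m x * euler a x)) +
      x i * (m x * gradSq a x)) + (-((n : ℝ) - 1)) * (m x * (a x * pd i a x))) x =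
      (-(2 * m x * euler a x) - ((n : ℝ) - 1) * m x * a x) * pd i (pd i a) x
      + (-(2 * m₁ x * euler a x) - ((n : ℝ) - 1) * m₁ x * a x) * (x i * pd i a x)
      + (-(2 * m x) - ((n : ℝ) - 1) * m x) * pd i a x ^ 2
      + (m x * gradSq a x) + m₁ x * gradSq a x * x i ^ 2
      + (-(2 * m x)) * (∑ j, x j * (pd i a x * pd i (pd j a) x))
      + (2 * m x) * (∑ j, x i * (pd j a x * pd i (pd j a) x)) := by
    intro i
    rw [pd_add i ((((dp i).fun_mul (dm.fun_mul de)).const_mul _).fun_add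
      ((dc i).fun_mul (dm.fun_mul dg)))
        ((dm.fun_mul (da.fun_mul (dp i))).const_mul _),
      pd_add i (((dp i).fun_mul (dm.fun_mul de)).const_mul _) ((dc i).fun_mul (dm.fun_mul dg)),
      pd_const_mul i _ ((dp i).fun_mul (dm.fun_mul de)),
      pd_const_mul i _ (dm.fun_mul (da.fun_mul (dp i))),
      pd_mul i (dp i) (dm.fun_mul de), pd_mul i dm de,
      pd_mul i (dc i) (dm.fun_mul dg), pd_mul i dm dg,
      pd_mul i dm (da.fun_mul (dp i)), pd_mul i da (dp i), pd_euler ha, pd_gradSq ha, pd_coord,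
      hm.pd_eq]
    have e1 : ∑ j, x j * (pd i a x * pd i (pd j a) x) =
        pd i a x * ∑ j, x j * pd i (pd j a) x := by
      rw [Finset.mul_sum]; exact Finset.sum_congr rfl fun j _ => by ring
    have e2 : ∑ j, x i * (pd j a x * pd i (pd j a) x) =
        x i * ∑ j, pd j a x * pd i (pd j a) x := by
      rw [Finset.mul_sum]
    rw [e1, e2, if_pos rfl]
    ring
  -- The two contractions with the Hessian agree by its symmetry, so all mixed second derivatives
  -- cancel.
  have hsym : ∑ i, x i * ∑ j, pd j a x * pd i (pd j a) x =
      ∑ i, ∑ j, x j * (pd i a x * pd i (pd j a) x) := by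
    simp only [Finset.mul_sum]
    rw [Finset.sum_comm]
    refine Finset.sum_congr rfl fun i _ => Finset.sum_congr rfl fun j _ => ?_
    rw [pd_comm ha]
  simp only [hd, Finset.sum_add_distrib, ← Finset.mul_sum, hsym]
  have e1 : ∑ i, pd i (pd i a) x = lap a x := rfl
  have e2 : ∑ i, x i * pd i a x = euler a x := rfl
  have e3 : ∑ i, pd i a x ^ 2 = gradSq a x := rfl
  rw [e1, e2, e3, ← normSq_eq_sum]
  simp [gen]
  ring

end Semiclassical
end

noncomputable section
namespace Semiclassical
variable {n : ℕ}

/-- Here `t = |x|²`, `X = x·∇a`, `g = |∇a|²`. The subtracted bracket is the divergence of `k x a²`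
with `k = -(N-1)/2 · m/(t+e²)`. It completes the square in `X + (N-1)a/2`, and the remainder splits
into four nonnegative pieces: an angular-gradient term, two terms paid for by the error of size `e`,
and an inverse-square term. -/
theorem morawetz_pointwise {N t m m₁ X g a e : ℝ} (hN : 3 ≤ N) (ht : 0 ≤ t) (hm : 0 ≤ m)
    (hm₁ : m₁ ≤ 0) (he : 0 < e) (he1 : e ≤ 1) (hX : X ^ 2 ≤ t * g) (hg : 0 ≤ g) :
    (m + t * m₁) / (t + e ^ 2) * (X + (N - 1) / 2 * a) ^ 2 ≤
      2 * m₁ * X ^ 2 + (m - t * m₁) * g + (N - 1) * m₁ * a * X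
      - ((N * (-((N - 1) / 2) * (m / (t + e ^ 2))) +
          t * (-((N - 1) / 2) * (m₁ / (t + e ^ 2) - 2 * m / (t + e ^ 2) ^ 2))) * a ^ 2
          + 2 * (-((N - 1) / 2) * (m / (t + e ^ 2))) * a * X)
      + e * (-m₁ * ((N - 1) * (a ^ 2 + g) + 2 * g)) := by
  set s := t + e ^ 2 with hs
  have hs0 : 0 < s := by positivity
  have hmt : 0 ≤ m - t * m₁ := by nlinarith
  have hXs : X ^ 2 / s ≤ g := by
    rw [div_le_iff₀ hs0]; nlinarith
  have h1 : 0 ≤ (m - t * m₁) * (g - X ^ 2 / s) := mul_nonneg hmt (by linarith)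
  have h2 : 0 ≤ -m₁ * (2 * (e * g - e ^ 2 * (X ^ 2 / s))) := by
    have : e ^ 2 * (X ^ 2 / s) ≤ e * g := by
      have : e ^ 2 ≤ e := by nlinarith
      exact mul_le_mul this hXs (by positivity) he.le
    exact mul_nonneg (by linarith) (by linarith)
  have h3 : 0 ≤ (N - 1) * -m₁ * (e * (a ^ 2 + g) - e ^ 2 / s * a * X) := by
    have hq : (e * (X / s)) ^ 2 ≤ g := by
      have e1 : (e * (X / s)) ^ 2 = (e ^ 2 / s) * (X ^ 2 / s) := by field_simp
      have e2 : e ^ 2 / s ≤ 1 := by rw [div_le_one hs0]; linarith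
      rw [e1]
      have : 0 ≤ X ^ 2 / s := by positivity
      nlinarith
    have hr : e ^ 2 / s * a * X = e * (a * (e * (X / s))) := by field_simp
    rw [hr, ← mul_sub]
    refine mul_nonneg (mul_nonneg (by linarith) (by linarith)) (mul_nonneg he.le ?_)
    nlinarith [sq_nonneg (a - e * (X / s)), sq_nonneg a]
  -- The inverse-square potential; its sign is where dimension at least three matters.
  have h4 : 0 ≤ a ^ 2 * ((N - 1) * (N - 3) / 4 * ((m - t * m₁) / s)
      + (N - 1) * m * e ^ 2 / s ^ 2) := by
    have : 0 ≤ (N - 1) * (N - 3) / 4 := by nlinarith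
    have h5 : 0 ≤ (N - 1) * m := mul_nonneg (by linarith) hm
    positivity
  have key : 2 * m₁ * X ^ 2 + (m - t * m₁) * g + (N - 1) * m₁ * a * X
      - ((N * (-((N - 1) / 2) * (m / s)) +
          t * (-((N - 1) / 2) * (m₁ / s - 2 * m / s ^ 2))) * a ^ 2
          + 2 * (-((N - 1) / 2) * (m / s)) * a * X)
      + e * (-m₁ * ((N - 1) * (a ^ 2 + g) + 2 * g))
      - (m + t * m₁) / s * (X + (N - 1) / 2 * a) ^ 2 =
      (m - t * m₁) * (g - X ^ 2 / s) + -m₁ * (2 * (e * g - e ^ 2 * (X ^ 2 / s))) +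
      (N - 1) * -m₁ * (e * (a ^ 2 + g) - e ^ 2 / s * a * X) +
      a ^ 2 * ((N - 1) * (N - 3) / 4 * ((m - t * m₁) / s) + (N - 1) * m * e ^ 2 / s ^ 2) := by
    have he2 : e ^ 2 = s - t := by rw [hs]; ring
    rw [he2]
    field_simp
    ring
  linarith

theorem morawetz_regularized {a m m₁ : Rn n → ℝ} (hn : 3 ≤ n) (ha : ContDiff ℝ 2 a)
    (hs : HasCompactSupport a) (hm : HasRadialDeriv m m₁) (hc : Continuous m₁)
    (hm0 : ∀ x, 0 ≤ m x) (hm1 : ∀ x, m₁ x ≤ 0) {e : ℝ} (he : 0 < e) (he1 : e ≤ 1) :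
    Integrable (fun x => (m x + ‖x‖ ^ 2 * m₁ x) / (‖x‖ ^ 2 + e ^ 2) * gen a x ^ 2) ∧
    ∫ x, (m x + ‖x‖ ^ 2 * m₁ x) / (‖x‖ ^ 2 + e ^ 2) * gen a x ^ 2 ≤
      (∫ x, -(lap a x) * (2 * m x * gen a x)) +
        e * ∫ x, -m₁ x * (((n : ℝ) - 1) * (a x ^ 2 + gradSq a x) + 2 * gradSq a x) := by
  have ha1 : ContDiff ℝ 1 a := ha.of_le (by norm_num)
  have hmc : Continuous m := (hm.contDiff hc).continuous
  have hpos : ∀ x : Rn n, ‖x‖ ^ 2 + e ^ 2 ≠ 0 := fun x => by positivity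
  have hk : HasRadialDeriv (fun x : Rn n => -(((n : ℝ) - 1) / 2) * (m x / (‖x‖ ^ 2 + e ^ 2)))
      (fun x => -(((n : ℝ) - 1) / 2) *
        (m₁ x / (‖x‖ ^ 2 + e ^ 2) - 2 * m x / (‖x‖ ^ 2 + e ^ 2) ^ 2)) := by
    have h1 : HasRadialDeriv (fun x : Rn n => -(((n : ℝ) - 1) / 2) * (‖x‖ ^ 2 + e ^ 2)⁻¹)
        (fun x => 2 * (-(((n : ℝ) - 1) / 2) * (-1 / (‖x‖ ^ 2 + e ^ 2) ^ 2))) := by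
      refine hasRadialDeriv_comp (g := fun t => -(((n : ℝ) - 1) / 2) * (t + e ^ 2)⁻¹)
        (g' := fun t => -(((n : ℝ) - 1) / 2) * (-1 / (t + e ^ 2) ^ 2)) fun t ht => ?_
      exact (((hasDerivAt_id t).add_const (e ^ 2)).fun_inv (by simp; positivity)).const_mul _
    have h2 := h1.mul hm
    intro x
    convert! h2 x using 1
    · ext y
      field_simp
    · congr 1
      have := hpos x
      field_simp
      ring
  have hkc : Continuous (fun x : Rn n => -(((n : ℝ) - 1) / 2) *
        (m₁ x / (‖x‖ ^ 2 + e ^ 2) - 2 * m x / (‖x‖ ^ 2 + e ^ 2) ^ 2)) := by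
    fun_prop (disch := intro x; positivity)
  have hdiv := integral_radial ha1 hs hk hkc
  have cg := continuous_gen ha1
  have ce := continuous_euler ha1
  have cq := continuous_gradSq ha1
  have cl := continuous_lap ha
  have ca := ha.continuous
  have hz := fun (x : Rn n) (hx : x ∉ tsupport a) => image_eq_zero_of_notMem_tsupport hx
  have i0 : Integrable (fun x => (m x + ‖x‖ ^ 2 * m₁ x) / (‖x‖ ^ 2 + e ^ 2) * gen a x ^ 2) := by
    refine integrable_of_supported hs ?_ fun x hx => by simp [gen_eq_zero hx]
    fun_prop (disch := intro x; positivity)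
  refine ⟨i0, ?_⟩
  have i1 : Integrable fun x => (2 * m₁ x * euler a x ^ 2 + (m x - ‖x‖ ^ 2 * m₁ x) * gradSq a x +
        ((n : ℝ) - 1) * m₁ x * a x * euler a x) := by
    refine integrable_of_supported hs ?_ fun x hx => by
      simp [euler_eq_zero hx, gradSq_eq_zero hx]
    fun_prop
  have i2 : Integrable fun x : Rn n => (((n : ℝ) * (-(((n : ℝ) - 1) / 2) *
        (m x / (‖x‖ ^ 2 + e ^ 2))) + ‖x‖ ^ 2 * (-(((n : ℝ) - 1) / 2) *
        (m₁ x / (‖x‖ ^ 2 + e ^ 2) - 2 * m x / (‖x‖ ^ 2 + e ^ 2) ^ 2))) * a x ^ 2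
        + 2 * (-(((n : ℝ) - 1) / 2) * (m x / (‖x‖ ^ 2 + e ^ 2))) * a x * euler a x) := by
    refine integrable_of_supported hs ?_ fun x hx => by simp [hz x hx, euler_eq_zero hx]
    fun_prop (disch := intro x; positivity)
  have i3 : Integrable fun x =>
      e * (-m₁ x * (((n : ℝ) - 1) * (a x ^ 2 + gradSq a x) + 2 * gradSq a x)) := by
    refine integrable_of_supported hs ?_ fun x hx => by simp [hz x hx, gradSq_eq_zero hx]
    fun_prop
  have h := integral_mono (i0.add i2) (i1.add i3) fun x => by
    have := morawetz_pointwise (N := n) (a := a x) (by exact_mod_cast hn) (sq_nonneg ‖x‖) (hm0 x)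
      (hm1 x) he he1 (euler_sq_le a x) (gradSq_nonneg a x)
    simp only [gen, Pi.add_apply]
    linarith
  rw [integral_add' i0 i2, integral_add' i1 i3, hdiv, add_zero, integral_const_mul] at h
  rw [integral_pohozaev ha hs hm hc]
  exact h

/-- The factor `|x|⁻²` is singular at the origin, so `e → 0` is taken in the regularized inequality
along `e = 1/(j+1)`. Fatou's lemma gives integrability of the limit together with the bound, and the
error term vanishes. -/
theorem morawetz {a m m₁ : Rn n → ℝ} (hn : 3 ≤ n) (ha : ContDiff ℝ 2 a)
    (hs : HasCompactSupport a) (hm : HasRadialDeriv m m₁) (hc : Continuous m₁)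
    (hm0 : ∀ x, 0 ≤ m x) (hm1 : ∀ x, m₁ x ≤ 0) (hmm : ∀ x, 0 ≤ m x + ‖x‖ ^ 2 * m₁ x) :
    Integrable (fun x => (m x + ‖x‖ ^ 2 * m₁ x) / ‖x‖ ^ 2 * gen a x ^ 2) ∧
    ∫ x, (m x + ‖x‖ ^ 2 * m₁ x) / ‖x‖ ^ 2 * gen a x ^ 2 ≤
      ∫ x, -(lap a x) * (2 * m x * gen a x) := by
  set B := ∫ x, -(lap a x) * (2 * m x * gen a x)
  set K := ∫ x, -m₁ x * (((n : ℝ) - 1) * (a x ^ 2 + gradSq a x) + 2 * gradSq a x)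
  set F : ℕ → Rn n → ℝ := fun j x =>
    (m x + ‖x‖ ^ 2 * m₁ x) / (‖x‖ ^ 2 + (1 / ((j : ℝ) + 1)) ^ 2) * gen a x ^ 2
  set G : Rn n → ℝ := fun x => (m x + ‖x‖ ^ 2 * m₁ x) / ‖x‖ ^ 2 * gen a x ^ 2
  have he : ∀ j : ℕ, 0 < 1 / ((j : ℝ) + 1) := fun j => by positivity
  have he1 : ∀ j : ℕ, 1 / ((j : ℝ) + 1) ≤ 1 := fun j => by
    rw [div_le_one (by positivity)]; linarith [(Nat.cast_nonneg j : (0 : ℝ) ≤ j)]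
  have hF := fun j => morawetz_regularized hn ha hs hm hc hm0 hm1 (he j) (he1 j)
  have hF0 : ∀ j x, 0 ≤ F j x := fun j x =>
    mul_nonneg (div_nonneg (hmm x) (by positivity)) (sq_nonneg _)
  have hG0 : ∀ x, 0 ≤ G x := fun x =>
    mul_nonneg (div_nonneg (hmm x) (by positivity)) (sq_nonneg _)
  have hlim0 := tendsto_one_div_add_atTop_nhds_zero_nat (𝕜 := ℝ)
  have hlimB : Filter.Tendsto (fun j : ℕ => B + 1 / ((j : ℝ) + 1) * K) Filter.atTop (nhds B) := by
    simpa using (hlim0.mul_const K).const_add B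
  have hB0 : 0 ≤ B := ge_of_tendsto' hlimB fun j =>
    (integral_nonneg (hF0 j)).trans (hF j).2
  have hptw : ∀ x, ENNReal.ofReal (G x) ≤
      Filter.liminf (fun j => ENNReal.ofReal (F j x)) Filter.atTop := by
    intro x
    -- At the origin division by zero makes the limiting integrand 0, so no convergence is needed
    -- there.
    by_cases hx : ‖x‖ ^ 2 = 0
    · simp [G, hx]
    · have hl : Filter.Tendsto (fun j => F j x) Filter.atTop (nhds (G x)) := by
        refine Filter.Tendsto.mul_const _ (Filter.Tendsto.div tendsto_const_nhds ?_ hx)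
        simpa using (hlim0.pow 2).const_add (‖x‖ ^ 2)
      exact (((ENNReal.continuous_ofReal.tendsto _).comp hl).liminf_eq).ge
  have hmeasF : ∀ j, Measurable fun x => ENNReal.ofReal (F j x) := fun j => by
    have cg := continuous_gen (ha.of_le (by norm_num : (1 : WithTop ℕ∞) ≤ 2))
    have hmc : Continuous m := (hm.contDiff hc).continuous
    refine (Continuous.measurable ?_).ennreal_ofReal
    fun_prop (disch := intro x; positivity)
  have hmeasG : Measurable G := by
    have cg := continuous_gen (ha.of_le (by norm_num : (1 : WithTop ℕ∞) ≤ 2))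
    have hmc : Continuous m := (hm.contDiff hc).continuous
    refine Measurable.mul (Measurable.div (Continuous.measurable ?_) (Continuous.measurable ?_))
      (Continuous.measurable ?_) <;> fun_prop
  have hfin : ∫⁻ x, ENNReal.ofReal (G x) ≤ ENNReal.ofReal B := by
    calc ∫⁻ x, ENNReal.ofReal (G x) ≤
        ∫⁻ x, Filter.liminf (fun j => ENNReal.ofReal (F j x)) Filter.atTop := lintegral_mono hptw
      _ ≤ Filter.liminf (fun j => ∫⁻ x, ENNReal.ofReal (F j x)) Filter.atTop :=
        lintegral_liminf_le hmeasF
      _ ≤ Filter.liminf (fun j : ℕ => ENNReal.ofReal (B + 1 / ((j : ℝ) + 1) * K)) Filter.atTop := by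
        refine Filter.liminf_le_liminf (Filter.Eventually.of_forall fun j => ?_)
        rw [← ofReal_integral_eq_lintegral_ofReal (hF j).1
          (Filter.Eventually.of_forall (hF0 j))]
        exact ENNReal.ofReal_le_ofReal (hF j).2
      _ = ENNReal.ofReal B := ((ENNReal.continuous_ofReal.tendsto _).comp hlimB).liminf_eq
  have hint : Integrable G := by
    refine ⟨hmeasG.aestronglyMeasurable, ?_⟩
    rw [hasFiniteIntegral_iff_ofReal (Filter.Eventually.of_forall hG0)]
    exact hfin.trans_lt ENNReal.ofReal_lt_top
  refine ⟨hint, ?_⟩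
  rw [← ofReal_integral_eq_lintegral_ofReal hint (Filter.Eventually.of_forall hG0)] at hfin
  exact (ENNReal.ofReal_le_ofReal_iff hB0).mp hfin

end Semiclassical
end

noncomputable section
namespace Semiclassical
variable {n : ℕ}

/-! ### Radial factors -/

theorem lap_radial_mul {u w w₁ w₂ : Rn n → ℝ} (hu : ContDiff ℝ 2 u) (hw : HasRadialDeriv w w₁)
    (hw₁ : HasRadialDeriv w₁ w₂) (x : Rn n) :
    lap (fun y => w y * u y) x =
      w x * lap u x + 2 * w₁ x * euler u x + (n * w₁ x + ‖x‖ ^ 2 * w₂ x) * u x := by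
  have dw := fun y => (hw y).differentiableAt
  have dw₁ := fun y => (hw₁ y).differentiableAt
  have du : Differentiable ℝ u := hu.differentiable (by norm_num)
  have dp : ∀ i, DifferentiableAt ℝ (pd i u) x := fun i =>
    (contDiff_pd hu i).differentiable (by norm_num) x
  have dc : ∀ j : Fin n, DifferentiableAt ℝ (fun y : Rn n => y j) x := fun j =>
    (contDiff_coord j (k := 1)).differentiable (by norm_num) x
  have h1 : ∀ i, pd i (fun y => w y * u y) =
      fun y => w₁ y * (y i * u y) + w y * pd i u y := by
    intro i
    ext y
    rw [pd_mul i (dw y) (du y), hw.pd_eq]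
    ring
  have h2 : ∀ i, pd i (pd i (fun y => w y * u y)) x =
      w x * pd i (pd i u) x + 2 * w₁ x * (x i * pd i u x) + w₁ x * u x +
        w₂ x * u x * x i ^ 2 := by
    intro i
    rw [h1, pd_add i ((dw₁ x).fun_mul ((dc i).fun_mul (du x))) ((dw x).fun_mul (dp i)),
      pd_mul i (dw₁ x) ((dc i).fun_mul (du x)), pd_mul i (dc i) (du x), pd_mul i (dw x) (dp i),
      hw.pd_eq, hw₁.pd_eq, pd_coord, if_pos rfl]
    ring
  simp only [lap, h2, Finset.sum_add_distrib, ← Finset.mul_sum, euler, normSq_eq_sum]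
  simp
  ring

theorem euler_radial_mul {u w w₁ : Rn n → ℝ} (hu : ContDiff ℝ 1 u) (hw : HasRadialDeriv w w₁)
    (x : Rn n) : euler (fun y => w y * u y) x = w x * euler u x + ‖x‖ ^ 2 * w₁ x * u x := by
  have h : ∀ i, x i * pd i (fun y => w y * u y) x =
      w x * (x i * pd i u x) + w₁ x * u x * x i ^ 2 := by
    intro i
    rw [pd_mul i (hw x).differentiableAt (hu.differentiable (by norm_num) x), hw.pd_eq]
    ring
  simp only [euler, h, Finset.sum_add_distrib, ← Finset.mul_sum, normSq_eq_sum]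
  ring

theorem HasRadialDeriv.contDiff_two {m q q' : Rn n → ℝ} (h : HasRadialDeriv m q)
    (h' : HasRadialDeriv q q') (hq : Continuous q') : ContDiff ℝ 2 m := by
  have : (2 : WithTop ℕ∞) = 1 + 1 := by norm_num
  rw [this, contDiff_succ_iff_fderiv]
  refine ⟨fun x => (h x).differentiableAt, by simp, ?_⟩
  have he : fderiv ℝ m = fun x => q x • innerSL ℝ x := funext fun x => (h x).fderiv
  rw [he]
  exact (h'.contDiff hq).smul (innerSL ℝ).contDiff

theorem HasRadialDeriv.exp_div {φ ψ : Rn n → ℝ} (h : HasRadialDeriv φ ψ) (c : ℝ) :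
    HasRadialDeriv (fun x => Real.exp (φ x / c)) (fun x => ψ x / c * Real.exp (φ x / c)) :=
  fun x => by
    convert! ((h x).mul_const c⁻¹).exp using 1
    ext y
    simp only [smul_apply, smul_eq_mul, div_eq_mul_inv]
    ring

/-! ### The Carleman inequality for abstract radial weights -/

/-- A multiplier `m` and a phase `φ`, both radial, with their radial derivatives. -/
structure RadialWeights (n : ℕ) where
  m : Rn n → ℝ
  m₁ : Rn n → ℝ
  φ : Rn n → ℝ
  ψ : Rn n → ℝ
  ψ₁ : Rn n → ℝ
  hm : HasRadialDeriv m m₁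
  hφ : HasRadialDeriv φ ψ
  hψ : HasRadialDeriv ψ ψ₁
  continuous_m₁ : Continuous m₁
  continuous_ψ₁ : Continuous ψ₁
  m_nonneg : ∀ x, 0 ≤ m x
  m₁_nonpos : ∀ x, m₁ x ≤ 0
  radial_nonneg : ∀ x, 0 ≤ m x + ‖x‖ ^ 2 * m₁ x
  φ_nonneg : ∀ x, 0 ≤ φ x
  ψ_nonneg : ∀ x, 0 ≤ ψ x

namespace RadialWeights

variable (w : RadialWeights n)

/-- The coefficient of `(gen v)²` in the Carleman estimate. -/
def D (h : ℝ) (x : Rn n) : ℝ :=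
  h ^ 2 * ((w.m x + ‖x‖ ^ 2 * w.m₁ x) / ‖x‖ ^ 2) + 4 * h * w.ψ x * w.m x

/-- The coefficient of `v²` in the Carleman estimate. -/
def M (E : ℝ) (x : Rn n) : ℝ :=
  (E + ‖x‖ ^ 2 * w.ψ x ^ 2) * (w.m x + ‖x‖ ^ 2 * w.m₁ x) +
    w.m x * ‖x‖ ^ 2 * (2 * w.ψ x ^ 2 + 2 * ‖x‖ ^ 2 * w.ψ x * w.ψ₁ x)

/-- The zeroth order term produced by conjugation with the phase. -/
def W (h : ℝ) (x : Rn n) : ℝ := h * (w.ψ x + ‖x‖ ^ 2 * w.ψ₁ x)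

/-- The exponential weight. -/
def expw (h : ℝ) (x : Rn n) : ℝ := Real.exp (w.φ x / h)

theorem continuous_m : Continuous w.m := (w.hm.contDiff w.continuous_m₁).continuous

theorem continuous_ψ : Continuous w.ψ := (w.hψ.contDiff w.continuous_ψ₁).continuous

theorem hasRadialDeriv_expw (h : ℝ) :
    HasRadialDeriv (w.expw h) (fun x => w.ψ x / h * w.expw h x) := w.hφ.exp_div h

theorem hasRadialDeriv_expw_two (h : ℝ) :
    HasRadialDeriv (fun x => w.ψ x / h * w.expw h x)
      (fun x => (w.ψ₁ x / h + w.ψ x ^ 2 / h ^ 2) * w.expw h x) := by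
  have h1 : HasRadialDeriv (fun x => w.ψ x / h) (fun x => w.ψ₁ x / h) := fun x => by
    convert! (w.hψ x).mul_const h⁻¹ using 1
    ext y
    simp only [smul_apply, smul_eq_mul, div_eq_mul_inv]
    ring
  intro x
  convert! (h1.mul (w.hasRadialDeriv_expw h)) x using 2
  ring

theorem continuous_expw (h : ℝ) : Continuous (w.expw h) :=
  Real.continuous_exp.comp ((w.hφ.contDiff w.continuous_ψ).continuous.div_const h)

theorem contDiff_expw (h : ℝ) : ContDiff ℝ 2 (w.expw h) := by
  refine (w.hasRadialDeriv_expw h).contDiff_two (w.hasRadialDeriv_expw_two h) ?_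
  have := w.continuous_ψ₁
  have := w.continuous_ψ
  have := w.continuous_expw h
  fun_prop

/-- The conjugated operator is `-h²Δ + 2h∇φ·∇ + hΔφ - |∇φ|²` with `Δφ = nψ + |x|²ψ₁`. The part
`(n-1)ψ` of `Δφ` joins the gradient to form `gen`, and the rest is `W`. -/
theorem conjugation {h : ℝ} (hh : h ≠ 0) {u : Rn n → ℝ} (hu : ContDiff ℝ 2 u) (x : Rn n) :
    -h ^ 2 * lap (fun y => w.expw h y * u y) x +
        2 * h * w.ψ x * gen (fun y => w.expw h y * u y) x +
        (w.W h x - ‖x‖ ^ 2 * w.ψ x ^ 2) * (w.expw h x * u x) =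
      w.expw h x * (-h ^ 2 * lap u x) := by
  rw [gen, lap_radial_mul hu (w.hasRadialDeriv_expw h) (w.hasRadialDeriv_expw_two h),
    euler_radial_mul (hu.of_le (by norm_num)) (w.hasRadialDeriv_expw h), W]
  field_simp
  ring

/-- Of the three terms paired with `2 m gen v`, the Laplacian is bounded below by `morawetz`, the
first-order term is already a multiple of `(gen v)²`, and the zeroth-order term becomes `M v²` after
removing the divergence of `(E + |∇φ|²) m v² x`. The potential and `W` are left out, to be treated
as perturbations. -/
theorem energy_inequality (hn : 3 ≤ n) {v : Rn n → ℝ} (hv : ContDiff ℝ 2 v)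
    (hs : HasCompactSupport v) (h E : ℝ) :
    Integrable (fun x => w.D h x * gen v x ^ 2) ∧ Integrable (fun x => w.M E x * v x ^ 2) ∧
    Integrable (fun x => 2 * w.m x * gen v x * (-h ^ 2 * lap v x + 2 * h * w.ψ x * gen v x -
        (E + ‖x‖ ^ 2 * w.ψ x ^ 2) * v x)) ∧
    (∫ x, w.D h x * gen v x ^ 2) + ∫ x, w.M E x * v x ^ 2 ≤
      ∫ x, 2 * w.m x * gen v x * (-h ^ 2 * lap v x + 2 * h * w.ψ x * gen v x -
        (E + ‖x‖ ^ 2 * w.ψ x ^ 2) * v x) := by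
  have hv1 : ContDiff ℝ 1 v := hv.of_le (by norm_num)
  have cg := continuous_gen hv1
  have ce := continuous_euler hv1
  have cl := continuous_lap hv
  have cv := hv.continuous
  have cm := w.continuous_m
  have cm1 := w.continuous_m₁
  have cψ := w.continuous_ψ
  have cψ1 := w.continuous_ψ₁
  have hz := fun (x : Rn n) (hx : x ∉ tsupport v) => image_eq_zero_of_notMem_tsupport hx
  obtain ⟨i1, hmor⟩ := morawetz hn hv hs w.hm cm1 w.m_nonneg w.m₁_nonpos w.radial_nonneg
  have i2 : Integrable fun x => 4 * h * w.ψ x * w.m x * gen v x ^ 2 := by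
    refine integrable_of_supported hs (by fun_prop) fun x hx => by simp [gen_eq_zero hx]
  have i3 : Integrable (fun x => w.M E x * v x ^ 2) := by
    refine integrable_of_supported hs (by unfold M; fun_prop) fun x hx => by simp [hz x hx]
  have i4 : Integrable (fun x => -lap v x * (2 * w.m x * gen v x)) := by
    refine integrable_of_supported hs (by fun_prop) fun x hx => by simp [gen_eq_zero hx]
  have hk : HasRadialDeriv (fun x => (E + ‖x‖ ^ 2 * w.ψ x ^ 2) * w.m x)
      (fun x => (2 * w.ψ x ^ 2 + 2 * ‖x‖ ^ 2 * w.ψ x * w.ψ₁ x) * w.m x +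
        (E + ‖x‖ ^ 2 * w.ψ x ^ 2) * w.m₁ x) := by
    have h1 := ((hasRadialDeriv_normSq.mul (w.hψ.mul w.hψ)).const_add E).mul w.hm
    intro x
    convert! h1 x using 2
    · ring
    · ring
  have hrad := integral_radial hv1 hs hk (by fun_prop)
  have i5 : Integrable (fun x => (((n : ℝ) * ((E + ‖x‖ ^ 2 * w.ψ x ^ 2) * w.m x) + ‖x‖ ^ 2 *
      ((2 * w.ψ x ^ 2 + 2 * ‖x‖ ^ 2 * w.ψ x * w.ψ₁ x) * w.m x +
        (E + ‖x‖ ^ 2 * w.ψ x ^ 2) * w.m₁ x)) * v x ^ 2 +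
      2 * ((E + ‖x‖ ^ 2 * w.ψ x ^ 2) * w.m x) * v x * euler v x)) := by
    refine integrable_of_supported hs (by fun_prop) fun x hx => by simp [hz x hx]
  have hD : (fun x => w.D h x * gen v x ^ 2) = (fun x => h ^ 2 *
      ((w.m x + ‖x‖ ^ 2 * w.m₁ x) / ‖x‖ ^ 2 * gen v x ^ 2)) +
      fun x => 4 * h * w.ψ x * w.m x * gen v x ^ 2 := by
    ext x
    simp only [D, Pi.add_apply]
    ring
  have hR : (fun x => 2 * w.m x * gen v x * (-h ^ 2 * lap v x + 2 * h * w.ψ x * gen v x -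
        (E + ‖x‖ ^ 2 * w.ψ x ^ 2) * v x)) =
      (((fun x => h ^ 2 * (-lap v x * (2 * w.m x * gen v x))) +
      fun x => 4 * h * w.ψ x * w.m x * gen v x ^ 2) + (fun x => w.M E x * v x ^ 2)) -
      (fun x => (((n : ℝ) * ((E + ‖x‖ ^ 2 * w.ψ x ^ 2) * w.m x) + ‖x‖ ^ 2 *
      ((2 * w.ψ x ^ 2 + 2 * ‖x‖ ^ 2 * w.ψ x * w.ψ₁ x) * w.m x +
        (E + ‖x‖ ^ 2 * w.ψ x ^ 2) * w.m₁ x)) * v x ^ 2 +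
      2 * ((E + ‖x‖ ^ 2 * w.ψ x ^ 2) * w.m x) * v x * euler v x)) := by
    ext x
    simp only [Pi.add_apply, Pi.sub_apply, M, gen]
    ring
  have iD : Integrable (fun x => w.D h x * gen v x ^ 2) := by
    rw [hD]
    exact (i1.const_mul _).add i2
  refine ⟨iD, i3, ?_, ?_⟩
  · rw [hR]
    exact (((i4.const_mul _).add i2).add i3).sub i5
  · rw [hR, integral_sub' (((i4.const_mul _).add i2).add i3) i5, hrad,
      integral_add' ((i4.const_mul _).add i2) i3, integral_add' (i4.const_mul _) i2, hD,
      integral_add' (i1.const_mul _) i2, integral_const_mul, integral_const_mul]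
    have := mul_le_mul_of_nonneg_left hmor (sq_nonneg h)
    linarith

end RadialWeights

end Semiclassical
end

/-! ### Absorbing the potential, the source and the residual. -/

noncomputable section
namespace Semiclassical
variable {n : ℕ}

/-- An elementary bound for the gradient in terms of the Schrödinger equation. -/
theorem integral_gradSq_le {u V r : Rn n → ℝ} {h E V₀ : ℝ}
    (hu : ContDiff ℝ 2 u) (hs : HasCompactSupport u) (hr : MemLp r 2 volume)
    (hV : ∀ᵐ x, |V x| ≤ V₀) (heq : ∀ᵐ x, -h ^ 2 * lap u x + (V x - E) * u x = r x) :
    h ^ 2 * ∫ x, gradSq u x ≤ (V₀ + E + 1) * (∫ x, u x ^ 2) + ∫ x, r x ^ 2 := by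
  have hz := fun (x : Rn n) (hx : x ∉ tsupport u) => image_eq_zero_of_notMem_tsupport hx
  have cl := continuous_lap hu
  have cu := hu.continuous
  have i1 : Integrable (fun x => h ^ 2 * (-lap u x * u x)) :=
    integrable_of_supported hs (by fun_prop) fun x hx => by simp [hz x hx]
  have i2 : Integrable (fun x => (V₀ + E + 1) * u x ^ 2) :=
    integrable_of_supported hs (by fun_prop) fun x hx => by simp [hz x hx]
  have i3 : Integrable (fun x => r x ^ 2) := hr.integrable_sq
  rw [← integral_neg_lap_mul hu hs, ← integral_const_mul, ← integral_const_mul,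
    ← integral_add i2 i3]
  refine integral_mono_ae i1 (i2.add i3) ?_
  filter_upwards [hV, heq] with x h1 h2
  have e1 : h ^ 2 * (-lap u x * u x) = r x * u x - (V x - E) * u x ^ 2 := by
    rw [← h2]; ring
  have e2 : -(V x) * u x ^ 2 ≤ V₀ * u x ^ 2 :=
    mul_le_mul_of_nonneg_right ((neg_le_abs _).trans h1) (sq_nonneg _)
  simp only [e1]
  nlinarith [sq_nonneg (r x - u x), sq_nonneg (r x), sq_nonneg (u x)]

/-- Weighted AM–GM for the source term. It spends 1/8 of the `(gen v)²` budget, of which the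
potential takes 3/4 in `two_mul_le_of_sq_le'`; the total stays below 1. -/
theorem two_mul_le_of_sq_le {X Y Z K : ℝ} {g : ℝ} (hY : 0 ≤ Y) (hK : 0 ≤ K)
    (h : X ^ 2 ≤ K * Y) : 2 * X * Z * g ≤ Y * Z ^ 2 / 8 + 8 * K * g ^ 2 := by
  have h1 : (2 * X * Z * g) ^ 2 ≤ (Y * Z ^ 2 / 8 + 8 * K * g ^ 2) ^ 2 := by
    have h2 : (2 * X * Z * g) ^ 2 ≤ 4 * (K * Y) * (Z * g) ^ 2 := by
      have := mul_le_mul_of_nonneg_right h (sq_nonneg (Z * g))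
      nlinarith
    nlinarith [sq_nonneg (Y * Z ^ 2 / 8 - 8 * K * g ^ 2)]
  exact (abs_le_of_sq_le_sq' h1 (by positivity)).2

theorem two_mul_le_of_sq_le' {X D M G v : ℝ} (hD : 0 ≤ D) (hM : 0 ≤ M)
    (h : X ^ 2 ≤ 9 / 16 * (D * M)) : -(2 * X * G * v) ≤ 3 / 4 * (D * G ^ 2 + M * v ^ 2) := by
  have h1 : (-(2 * X * G * v)) ^ 2 ≤ (3 / 4 * (D * G ^ 2 + M * v ^ 2)) ^ 2 := by
    have h2 : (-(2 * X * G * v)) ^ 2 ≤ 4 * (9 / 16 * (D * M)) * (G * v) ^ 2 := by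
      have := mul_le_mul_of_nonneg_right h (sq_nonneg (G * v))
      nlinarith
    nlinarith [sq_nonneg (D * G ^ 2 - M * v ^ 2)]
  exact (abs_le_of_sq_le_sq' h1 (by positivity)).2

namespace RadialWeights

variable (w : RadialWeights n)

theorem D_nonneg {h : ℝ} (hh : 0 ≤ h) (x : Rn n) : 0 ≤ w.D h x := by
  have h1 := w.radial_nonneg x
  have h2 := w.ψ_nonneg x
  have h3 := w.m_nonneg x
  unfold D
  positivity

/-- The Carleman estimate, for abstract weights subject to pointwise conditions. -/
theorem carleman (hn : 3 ≤ n) {u V s g r : Rn n → ℝ} {h E V₀ c K L κ : ℝ} (hh : 0 < h)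
    (hE : 0 ≤ E) (hV₀ : 0 ≤ V₀) (hc : 0 < c) (hK : 0 ≤ K) (hκ : 0 < κ) (hκ1 : κ ≤ 1)
    (hL : 0 ≤ L)
    (hV : ∀ᵐ x, |V x| ≤ V₀)
    (hpot : ∀ᵐ x, (w.m x * (V x + w.W h x)) ^ 2 ≤ 9 / 16 * (w.D h x * w.M E x))
    (hs : ∀ x, 0 ≤ s x) (hs1 : ∀ x, s x ≤ 1) (hsc : Continuous s)
    (hM : ∀ x, c * s x ^ 2 ≤ w.M E x)
    (hD : ∀ᵐ x, (w.m x * w.expw h x * s x) ^ 2 ≤ K * w.D h x)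
    (hgen : ∀ x, (w.m x * w.expw h x * gen (fun y => w.expw h y * u y) x) ^ 2 ≤
      L * (gradSq u x + u x ^ 2))
    (hu : ContDiff ℝ 2 u) (hsupp : HasCompactSupport u) (hg : MemLp g 2 volume)
    (hr : MemLp r 2 volume)
    (heq : ∀ᵐ x, -h ^ 2 * lap u x + (V x - E) * u x = s x * g x + r x) :
    c * ∫ x, (s x * u x) ^ 2 ≤ 4 * (8 * K + 1 + L * (1 + (V₀ + E + 3) / h ^ 2)) *
      ((∫ x, g x ^ 2) + κ * (∫ x, u x ^ 2) + κ⁻¹ * ∫ x, r x ^ 2) := by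
  set v : Rn n → ℝ := fun y => w.expw h y * u y with hvdef
  have hv : ContDiff ℝ 2 v := (w.contDiff_expw h).mul hu
  have hvs : HasCompactSupport v := hsupp.mul_left
  have hu1 : ContDiff ℝ 1 u := hu.of_le (by norm_num)
  have hz := fun (x : Rn n) (hx : x ∉ tsupport u) => image_eq_zero_of_notMem_tsupport hx
  have hzv := fun (x : Rn n) (hx : x ∉ tsupport v) => image_eq_zero_of_notMem_tsupport hx
  have cg := continuous_gen (hv.of_le (by norm_num : (1 : WithTop ℕ∞) ≤ 2))
  have cu := hu.continuous
  have cm := w.continuous_m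
  have cex := w.continuous_expw h
  obtain ⟨iD, iM, iR, hmain⟩ := w.energy_inequality hn hv hvs h E
  have ig : Integrable (fun x => g x ^ 2) := hg.integrable_sq
  have ir : Integrable (fun x => r x ^ 2) := hr.integrable_sq
  have iu : Integrable (fun x => u x ^ 2) :=
    integrable_of_supported hsupp (by fun_prop) fun x hx => by simp [hz x hx]
  have iX : Integrable (fun x => (w.m x * w.expw h x * gen v x) ^ 2) :=
    integrable_of_supported hvs (by fun_prop) fun x hx => by simp [gen_eq_zero hx]
  have iq : Integrable (gradSq u) :=
    integrable_of_supported hsupp (continuous_gradSq hu1) fun x hx => gradSq_eq_zero hx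
  have isu : Integrable (fun x => (s x * u x) ^ 2) :=
    integrable_of_supported hsupp (by fun_prop) fun x hx => by simp [hz x hx]
  have hsg : MemLp (fun x => s x * g x) 2 volume := by
    refine hg.of_le (hsc.aestronglyMeasurable.mul hg.1) (Filter.Eventually.of_forall fun x => ?_)
    rw [norm_mul, Real.norm_of_nonneg (hs x)]
    exact mul_le_of_le_one_left (norm_nonneg _) (hs1 x)
  have hgrad := integral_gradSq_le hu hsupp (hsg.add hr) hV heq
  have hsr : ∫ x, ((fun x => s x * g x) + r) x ^ 2 ≤
      2 * (∫ x, g x ^ 2) + 2 * ∫ x, r x ^ 2 := by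
    rw [← integral_const_mul, ← integral_const_mul,
      ← integral_add (ig.const_mul 2) (ir.const_mul 2)]
    refine integral_mono (hsg.add hr).integrable_sq ((ig.const_mul 2).add (ir.const_mul 2))
      fun x => ?_
    simp only [Pi.add_apply]
    have h1 : (s x * g x) ^ 2 ≤ g x ^ 2 := by
      rw [mul_pow]
      exact mul_le_of_le_one_left (sq_nonneg _) (pow_le_one₀ (hs x) (hs1 x))
    nlinarith [sq_nonneg (s x * g x - r x)]
  have hX : ∫ x, (w.m x * w.expw h x * gen v x) ^ 2 ≤
      L * ((∫ x, gradSq u x) + ∫ x, u x ^ 2) := by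
    rw [← integral_add iq iu, ← integral_const_mul]
    exact integral_mono iX ((iq.add iu).const_mul L) hgen
  -- The shares are 3/4 + 1/8 of the `D` term and 3/4 of the `M` term. The surviving quarter of `∫ M
  -- v²` produces the factor 4 in the conclusion.
  have hyoung : ∫ x, 2 * w.m x * gen v x * (-h ^ 2 * lap v x + 2 * h * w.ψ x * gen v x -
        (E + ‖x‖ ^ 2 * w.ψ x ^ 2) * v x) ≤
      7 / 8 * (∫ x, w.D h x * gen v x ^ 2) + 3 / 4 * (∫ x, w.M E x * v x ^ 2) +
        8 * K * (∫ x, g x ^ 2) + κ * (∫ x, (w.m x * w.expw h x * gen v x) ^ 2) +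
        κ⁻¹ * ∫ x, r x ^ 2 := by
    have iT := ((((iD.const_mul (7 / 8)).add (iM.const_mul (3 / 4))).add
      (ig.const_mul (8 * K))).add (iX.const_mul κ)).add (ir.const_mul κ⁻¹)
    refine (integral_mono_ae iR iT ?_).trans_eq ?_
    swap
    · rw [integral_add' ((((iD.const_mul _).add (iM.const_mul _)).add
        (ig.const_mul _)).add (iX.const_mul _)) (ir.const_mul _),
        integral_add' (((iD.const_mul _).add (iM.const_mul _)).add (ig.const_mul _))
        (iX.const_mul _),
        integral_add' ((iD.const_mul _).add (iM.const_mul _)) (ig.const_mul _),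
        integral_add' (iD.const_mul _) (iM.const_mul _)]
      simp only [integral_const_mul]
    filter_upwards [hpot, hD, heq] with x h1 h2 h3
    have hconj := w.conjugation hh.ne' hu x
    have hMx : 0 ≤ w.M E x := le_trans (by positivity) (hM x)
    have hDx := w.D_nonneg hh.le x
    have y1 := two_mul_le_of_sq_le' (G := gen v x) (v := v x) hDx hMx h1
    have y2 := two_mul_le_of_sq_le (Z := gen v x) (g := g x) hDx hK h2
    have y3 : 2 * (w.m x * w.expw h x * gen v x) * r x ≤
        κ * (w.m x * w.expw h x * gen v x) ^ 2 + κ⁻¹ * r x ^ 2 := by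
      have := mul_nonneg hκ.le (sq_nonneg ((w.m x * w.expw h x * gen v x) - κ⁻¹ * r x))
      have e : κ * ((w.m x * w.expw h x * gen v x) - κ⁻¹ * r x) ^ 2 =
        κ * (w.m x * w.expw h x * gen v x) ^ 2 + κ⁻¹ * r x ^ 2 -
          2 * (w.m x * w.expw h x * gen v x) * r x := by
        field_simp
        ring
      linarith
    have e1 : 2 * w.m x * gen v x * (-h ^ 2 * lap v x + 2 * h * w.ψ x * gen v x -
        (E + ‖x‖ ^ 2 * w.ψ x ^ 2) * v x) =
        -(2 * (w.m x * (V x + w.W h x)) * gen v x * v x) +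
        2 * (w.m x * w.expw h x * s x) * gen v x * g x +
        2 * (w.m x * w.expw h x * gen v x) * r x := by
      have e2 : w.expw h x * (-h ^ 2 * lap u x) =
          w.expw h x * (s x * g x + r x) - (V x - E) * v x := by
        rw [← h3, hvdef]; ring
      rw [e2] at hconj
      have e3 : -h ^ 2 * lap v x + 2 * h * w.ψ x * gen v x -
        (E + ‖x‖ ^ 2 * w.ψ x ^ 2) * v x = w.expw h x * (s x * g x + r x) -
          (V x + w.W h x) * v x := by
        linear_combination hconj
      rw [e3]
      ring
    simp only [Pi.add_apply]
    rw [e1]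
    linarith
  have hlow : c * ∫ x, (s x * u x) ^ 2 ≤ ∫ x, w.M E x * v x ^ 2 := by
    rw [← integral_const_mul]
    refine integral_mono (isu.const_mul c) iM fun x => ?_
    -- Since `φ ≥ 0`, removing the exponential on the left costs nothing.
    have h1 : (1 : ℝ) ≤ w.expw h x := Real.one_le_exp (div_nonneg (w.φ_nonneg x) hh.le)
    have h2 : u x ^ 2 ≤ v x ^ 2 := by
      rw [hvdef]
      simp only [mul_pow]
      exact le_mul_of_one_le_left (sq_nonneg _) (one_le_pow₀ h1)
    calc c * (s x * u x) ^ 2 = c * s x ^ 2 * u x ^ 2 := by ring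
      _ ≤ w.M E x * v x ^ 2 :=
        mul_le_mul (hM x) h2 (sq_nonneg _) (le_trans (by positivity) (hM x))
  have hDn : 0 ≤ ∫ x, w.D h x * gen v x ^ 2 :=
    integral_nonneg fun x => mul_nonneg (w.D_nonneg hh.le x) (sq_nonneg _)
  set Iu := ∫ x, u x ^ 2
  set Ig := ∫ x, g x ^ 2
  set Ir := ∫ x, r x ^ 2
  set Iq := ∫ x, gradSq u x
  set IX := ∫ x, (w.m x * w.expw h x * gen v x) ^ 2
  have hIu : 0 ≤ Iu := integral_nonneg fun x => sq_nonneg _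
  have hIg : 0 ≤ Ig := integral_nonneg fun x => sq_nonneg _
  have hIr : 0 ≤ Ir := integral_nonneg fun x => sq_nonneg _
  have hq : Iq ≤ ((V₀ + E + 1) * Iu + 2 * Ig + 2 * Ir) / h ^ 2 := by
    rw [le_div_iff₀ (by positivity)]
    linarith
  have h1 : c * ∫ x, (s x * u x) ^ 2 ≤ 4 * (8 * K * Ig + κ * IX + κ⁻¹ * Ir) := by linarith
  refine h1.trans ?_
  have hi : 0 < (h ^ 2)⁻¹ := by positivity
  have hκi : 1 ≤ κ⁻¹ := (one_le_inv₀ hκ).mpr hκ1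
  set S := Ig + κ * Iu + κ⁻¹ * Ir
  have hu0 : 0 ≤ κ * Iu := mul_nonneg hκ.le hIu
  have hr0 : 0 ≤ κ⁻¹ * Ir := mul_nonneg (by linarith) hIr
  have hgS : Ig ≤ S := by linarith
  have hrS : κ⁻¹ * Ir ≤ S := by linarith
  have huS : κ * Iu ≤ S := by linarith
  -- The price of the residual: `gen v` is controlled crudely by `u` and `∇u`, and `∇u` by the
  -- equation; the factor `κ` makes this harmless.
  have h2 : κ * IX ≤ L * (1 + (V₀ + E + 3) / h ^ 2) * S := by
    have h3 : κ * (Iq + Iu) ≤ (1 + (V₀ + E + 3) / h ^ 2) * S := by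
      have h4 : κ * ((V₀ + E + 1) * Iu + 2 * Ig + 2 * Ir) ≤ (V₀ + E + 3) * S := by
        have a1 : κ * Ig ≤ Ig := mul_le_of_le_one_left hIg hκ1
        have a2 : κ * Ir ≤ κ⁻¹ * Ir := mul_le_mul_of_nonneg_right (by linarith) hIr
        have a3 : (V₀ + E + 1) * (κ * Iu) ≤ (V₀ + E + 1) * S :=
          mul_le_mul_of_nonneg_left huS (by linarith)
        have a4 : Ig + κ⁻¹ * Ir ≤ S := by linarith
        linarith
      have h5 : κ * Iq ≤ (V₀ + E + 3) / h ^ 2 * S := by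
        calc κ * Iq ≤ κ * (((V₀ + E + 1) * Iu + 2 * Ig + 2 * Ir) / h ^ 2) :=
              mul_le_mul_of_nonneg_left hq hκ.le
          _ = (κ * ((V₀ + E + 1) * Iu + 2 * Ig + 2 * Ir)) / h ^ 2 := by ring
          _ ≤ ((V₀ + E + 3) * S) / h ^ 2 := by gcongr
          _ = _ := by ring
      linarith
    calc κ * IX ≤ κ * (L * (Iq + Iu)) := mul_le_mul_of_nonneg_left hX hκ.le
      _ = L * (κ * (Iq + Iu)) := by ring
      _ ≤ L * ((1 + (V₀ + E + 3) / h ^ 2) * S) := mul_le_mul_of_nonneg_left h3 hL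
      _ = _ := by ring
  have h3 : 8 * K * Ig ≤ 8 * K * S := mul_le_mul_of_nonneg_left hgS (by linarith)
  nlinarith

end RadialWeights

end Semiclassical
end

noncomputable section
namespace Semiclassical

/-! ### The weights as functions of `t = |x|²` -/

/-- The multiplier as a function of `t = |x|²`. -/
def mul₀ (a η t : ℝ) : ℝ := (1 + t / a) ^ (-(1 / 2) : ℝ) - 1 / 2 * (1 + t / a) ^ (-((1 + η) / 2))

/-- The derivative of `mul₀`. -/
def mul₁ (a η t : ℝ) : ℝ :=
  a⁻¹ * (-(1 / 2) * (1 + t / a) ^ (-(3 / 2) : ℝ) + (1 + η) / 4 * (1 + t / a) ^ (-((3 + η) / 2)))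

/-- The saturated power `(p^(-ν) + (a/e)^(-ν))⁻¹`, `p = 1 + t/e`. -/
def sat (e a ν t : ℝ) : ℝ := ((1 + t / e) ^ (-ν) + (a / e) ^ (-ν))⁻¹

/-- The phase as a function of `t = |x|²`. -/
def phase₀ (B e a ν t : ℝ) : ℝ := B * e / (2 * ν) * sat e a ν t

/-- Twice the derivative of `phase₀`. -/
def phase₁ (B e a ν t : ℝ) : ℝ := B * sat e a ν t ^ 2 * (1 + t / e) ^ (-ν - 1)

/-- The derivative of `phase₁`. -/
def phase₂ (B e a ν t : ℝ) : ℝ :=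
  B / e * sat e a ν t ^ 2 * (1 + t / e) ^ (-ν - 2) *
    (2 * ν * sat e a ν t * (1 + t / e) ^ (-ν) - (ν + 1))

section derivatives

theorem hasDerivAt_one_add_div_rpow {a t : ℝ} (ha : 0 < a) (ht : 0 ≤ t) (b : ℝ) :
    HasDerivAt (fun t : ℝ => (1 + t / a) ^ b) (a⁻¹ * (b * (1 + t / a) ^ (b - 1))) t := by
  have h1 : HasDerivAt (fun t : ℝ => 1 + t / a) a⁻¹ t := by
    simpa using ((hasDerivAt_id t).div_const a).const_add 1
  have h2 := h1.rpow_const (p := b) (Or.inl (by positivity))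
  convert! h2 using 1
  ring

theorem hasDerivAt_mul₀ {a η t : ℝ} (ha : 0 < a) (ht : 0 ≤ t) :
    HasDerivAt (mul₀ a η) (mul₁ a η t) t := by
  have h := (hasDerivAt_one_add_div_rpow ha ht (-(1 / 2))).sub
    ((hasDerivAt_one_add_div_rpow ha ht (-((1 + η) / 2))).const_mul (1 / 2))
  convert! h using 1
  rw [mul₁, show (-(3 / 2) : ℝ) = -(1 / 2) - 1 by norm_num,
    show -((3 + η) / 2) = -((1 + η) / 2) - 1 by ring]
  ring

theorem sat_den_pos {e a ν t : ℝ} (he : 0 < e) (ht : 0 ≤ t) (ha : 0 < a) :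
    0 < (1 + t / e) ^ (-ν) + (a / e) ^ (-ν) := by positivity

theorem sat_pos {e a ν t : ℝ} (he : 0 < e) (ht : 0 ≤ t) (ha : 0 < a) : 0 < sat e a ν t :=
  inv_pos.mpr (sat_den_pos he ht ha)

theorem hasDerivAt_sat {e a ν t : ℝ} (he : 0 < e) (ht : 0 ≤ t) (ha : 0 < a) :
    HasDerivAt (sat e a ν) (ν / e * sat e a ν t ^ 2 * (1 + t / e) ^ (-ν - 1)) t := by
  have h := ((hasDerivAt_one_add_div_rpow he ht (-ν)).add_const ((a / e) ^ (-ν))).fun_inv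
    (sat_den_pos he ht ha).ne'
  convert! h using 1
  rw [sat]
  generalize (1 + t / e) ^ (-ν) + (a / e) ^ (-ν) = d
  ring

theorem hasDerivAt_phase₀ {B e a ν t : ℝ} (he : 0 < e) (ht : 0 ≤ t) (ha : 0 < a) (hν : 0 < ν) :
    HasDerivAt (phase₀ B e a ν) (phase₁ B e a ν t / 2) t := by
  convert! (hasDerivAt_sat he ht ha).const_mul (B * e / (2 * ν)) using 1
  rw [phase₁]
  field_simp

theorem hasDerivAt_phase₁ {B e a ν t : ℝ} (he : 0 < e) (ht : 0 ≤ t) (ha : 0 < a) :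
    HasDerivAt (phase₁ B e a ν) (phase₂ B e a ν t) t := by
  convert! (((hasDerivAt_sat he ht ha).fun_pow 2).const_mul B).mul
    (hasDerivAt_one_add_div_rpow he ht (-ν - 1)) using 1
  have hp : 0 < 1 + t / e := by positivity
  rw [phase₂, show -ν - 1 - 1 = -ν - 2 by ring]
  have e1 : (1 + t / e) ^ (-ν - 1) * (1 + t / e) ^ (-ν - 1) =
      (1 + t / e) ^ (-ν - 2) * (1 + t / e) ^ (-ν) := by
    rw [← Real.rpow_add hp, ← Real.rpow_add hp]
    ring_nf
  push_cast
  have e2 : B * (2 * sat e a ν t ^ (2 - 1) * (ν / e * sat e a ν t ^ 2 *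
      (1 + t / e) ^ (-ν - 1))) * (1 + t / e) ^ (-ν - 1) =
      B / e * sat e a ν t ^ 2 * (2 * ν * sat e a ν t) *
        ((1 + t / e) ^ (-ν - 1) * (1 + t / e) ^ (-ν - 1)) := by ring
  rw [e2, e1]
  ring

end derivatives

section multiplier

variable {a η t : ℝ}

/-- With `P = 1 + r²/a`, the function `r P^(-1/2)` is bounded and increasing, but its derivative
`P^(-3/2)` decays too fast for the weight `(|x|+1)^(-s)` with `s` near 1/2. Subtracting the second
power slows the decay of the derivative to `P^(-(1+η)/2)`; the factor 1/2 keeps `m` comparable to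
`P^(-1/2)`. -/
theorem mul₀_bounds (ha : 0 < a) (hη : 0 < η) (ht : 0 ≤ t) :
    1 / 2 * (1 + t / a) ^ (-(1 / 2) : ℝ) ≤ mul₀ a η t ∧
      mul₀ a η t ≤ (1 + t / a) ^ (-(1 / 2) : ℝ) := by
  have hP : 1 ≤ 1 + t / a := by have : 0 ≤ t / a := by positivity
                                linarith
  have h1 : (1 + t / a) ^ (-((1 + η) / 2)) ≤ (1 + t / a) ^ (-(1 / 2) : ℝ) :=
    Real.rpow_le_rpow_of_exponent_le hP (by linarith)
  have h2 : 0 ≤ (1 + t / a) ^ (-((1 + η) / 2)) := by positivity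
  constructor <;> rw [mul₀] <;> linarith

theorem mul₁_nonpos (ha : 0 < a) (hη : 0 < η) (hη1 : η ≤ 1) (ht : 0 ≤ t) : mul₁ a η t ≤ 0 := by
  have hP : 1 ≤ 1 + t / a := by have : 0 ≤ t / a := by positivity
                                linarith
  have h1 : (1 + t / a) ^ (-((3 + η) / 2)) ≤ (1 + t / a) ^ (-(3 / 2) : ℝ) :=
    Real.rpow_le_rpow_of_exponent_le hP (by linarith)
  have h2 : 0 ≤ (1 + t / a) ^ (-((3 + η) / 2)) := by positivity
  have h3 : 0 < a⁻¹ := by positivity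
  rw [mul₁]
  exact mul_nonpos_of_nonneg_of_nonpos h3.le (by nlinarith)

theorem rpow_facts (hP : 0 < 1 + t / a) :
    (1 + t / a) ^ (-(1 / 2) : ℝ) = (1 + t / a) * (1 + t / a) ^ (-(3 / 2) : ℝ) ∧
    (1 + t / a) ^ (-((1 + η) / 2)) = (1 + t / a) * (1 + t / a) ^ (-((3 + η) / 2)) := by
  constructor
  · nth_rewrite 2 [← Real.rpow_one (1 + t / a)]
    rw [← Real.rpow_add hP]; norm_num
  · nth_rewrite 2 [← Real.rpow_one (1 + t / a)]
    rw [← Real.rpow_add hP]; ring_nf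

/-- The radial derivative of `|x| m` exceeds `m / (1 + t/a)`. -/
theorem radial_ge_div (ha : 0 < a) (hη : 0 < η) (ht : 0 ≤ t) :
    mul₀ a η t ≤ (1 + t / a) * (mul₀ a η t + t * (2 * mul₁ a η t)) := by
  have h0 : 0 ≤ t / a := by positivity
  have hP : 0 < 1 + t / a := by linarith
  obtain ⟨f1, f2⟩ := rpow_facts (η := η) hP
  have h2 : 0 ≤ (1 + t / a) ^ (-((3 + η) / 2)) := by positivity
  rw [mul₀, mul₁, f1, f2]
  set y := (1 + t / a) ^ (-(3 / 2) : ℝ)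
  set z := (1 + t / a) ^ (-((3 + η) / 2))
  have : t = t / a * a := by field_simp
  set s := t / a
  rw [this]
  have : (1 + s) * ((1 + s) * y - 1 / 2 * ((1 + s) * z) +
      s * a * (2 * (a⁻¹ * (-(1 / 2) * y + (1 + η) / 4 * z)))) -
      ((1 + s) * y - 1 / 2 * ((1 + s) * z)) = (1 + s) * s * (η / 2) * z := by
    field_simp
    ring
  have : 0 ≤ (1 + s) * s * (η / 2) * z := by positivity
  linarith

theorem radial_ge (ha : 0 < a) (hη : 0 < η) (hη1 : η ≤ 1) (ht : 0 ≤ t) :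
    η / 2 * (1 + t / a) ^ (-((1 + η) / 2)) ≤ mul₀ a η t + t * (2 * mul₁ a η t) := by
  have h0 : 0 ≤ t / a := by positivity
  have hP : 0 < 1 + t / a := by linarith
  obtain ⟨f1, f2⟩ := rpow_facts (η := η) hP
  have h1 : (1 + t / a) ^ (-((3 + η) / 2)) ≤ (1 + t / a) ^ (-(3 / 2) : ℝ) :=
    Real.rpow_le_rpow_of_exponent_le (by linarith) (by linarith)
  have h2 : 0 ≤ (1 + t / a) ^ (-((3 + η) / 2)) := by positivity
  rw [mul₀, mul₁, f1, f2]
  set y := (1 + t / a) ^ (-(3 / 2) : ℝ)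
  set z := (1 + t / a) ^ (-((3 + η) / 2))
  have : t = t / a * a := by field_simp
  set s := t / a
  rw [this]
  have : (1 + s) * y - 1 / 2 * ((1 + s) * z) +
      s * a * (2 * (a⁻¹ * (-(1 / 2) * y + (1 + η) / 4 * z))) - η / 2 * ((1 + s) * z) =
      y - (1 + η) / 2 * z := by
    field_simp
    ring
  nlinarith

/-- A lower bound for the ratio of `(rm)'` to `m` that decays only like `P^(-η/2)`, as needed far
out. -/
theorem radial_ge_mul (ha : 0 < a) (hη : 0 < η) (hη1 : η ≤ 1) (ht : 0 ≤ t) :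
    η / 2 * (1 + t / a) ^ (-(η / 2)) * mul₀ a η t ≤ mul₀ a η t + t * (2 * mul₁ a η t) := by
  have h0 : 0 ≤ t / a := by positivity
  have hP : 0 < 1 + t / a := by linarith
  refine le_trans ?_ (radial_ge ha hη hη1 ht)
  have e : (1 + t / a) ^ (-((1 + η) / 2)) =
      (1 + t / a) ^ (-(η / 2)) * (1 + t / a) ^ (-(1 / 2) : ℝ) := by
    rw [← Real.rpow_add hP]; ring_nf
  rw [e, ← mul_assoc]
  exact mul_le_mul_of_nonneg_left (mul₀_bounds ha hη ht).2 (by positivity)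

/-- The multiplier `|x| m` is bounded. -/
theorem sq_mul_mul₀_le (ha : 0 < a) (hη : 0 < η) (ht : 0 ≤ t) : t * mul₀ a η t ^ 2 ≤ a := by
  have h0 : 0 ≤ t / a := by positivity
  have hP : 0 < 1 + t / a := by linarith
  obtain ⟨h1, h2⟩ := mul₀_bounds ha hη ht
  have h3 : 0 ≤ mul₀ a η t := le_trans (by positivity) h1
  have h4 : mul₀ a η t ^ 2 ≤ (1 + t / a)⁻¹ := by
    calc mul₀ a η t ^ 2 ≤ ((1 + t / a) ^ (-(1 / 2) : ℝ)) ^ 2 := by gcongr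
      _ = (1 + t / a)⁻¹ := by
        rw [← Real.rpow_natCast, ← Real.rpow_mul hP.le]; norm_num [Real.rpow_neg_one]
  calc t * mul₀ a η t ^ 2 ≤ t * (1 + t / a)⁻¹ := by gcongr
    _ ≤ a := by
      rw [← div_eq_mul_inv, div_le_iff₀ hP]
      have : a * (1 + t / a) = a + t := by field_simp
      linarith

end multiplier

end Semiclassical
end

/-! ### Numerical absorption inequalities in the three regions; logarithmic derivatives of the
phase. -/

noncomputable section
namespace Semiclassical

section numeric

variable {v g T E β ρ : ℝ}

/-- In the three numerical lemmas `T = r²/h²`, `g = hψ`, `β = (rm)'/m` and `ρ = rψ'/ψ`, so that `W =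
g(1+ρ)` and, up to the factor `m`, the two brackets are `D` and `M`. Near the origin the useful
product is `β/T` times `T g²`, in which `T` cancels; it is at least `2.86 g²`, against `(1.2 g)²` on
the left. -/
theorem numeric_near (hg : 0 < g) (hT : 0 < T) (hE : 0 < E) (hβ : 0.99 ≤ β) (hρ : -0.05 ≤ ρ)
    (hρ0 : ρ ≤ 0) (hv : |v| ≤ g / 5) :
    (v + g * (1 + ρ)) ^ 2 ≤ 9 / 16 * ((β / T + 4 * g) * (E * β + T * g ^ 2 * (β + 2 + 2 * ρ))) ∧
      1 / 2 * (E * β) ≤ E * β + T * g ^ 2 * (β + 2 + 2 * ρ) := by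
  have hc : 2.89 ≤ β + 2 + 2 * ρ := by linarith
  have hEβ : 0 < E * β := by nlinarith
  have hpos : 0 ≤ T * g ^ 2 * (β + 2 + 2 * ρ) := by
    have : 0 ≤ β + 2 + 2 * ρ := by linarith
    positivity
  refine ⟨?_, by linarith⟩
  have h1 : 2.86 * g ^ 2 ≤ (β / T + 4 * g) * (E * β + T * g ^ 2 * (β + 2 + 2 * ρ)) := by
    have e1 : β / T * (T * g ^ 2 * (β + 2 + 2 * ρ)) = g ^ 2 * (β * (β + 2 + 2 * ρ)) := by
      field_simp
    have e2 : 2.86 ≤ β * (β + 2 + 2 * ρ) := by nlinarith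
    have e3 : 0 ≤ β / T := div_nonneg (by linarith) hT.le
    have e4 : g ^ 2 * 2.86 ≤ g ^ 2 * (β * (β + 2 + 2 * ρ)) := by gcongr
    have e5 : 0 ≤ 4 * g * (E * β + T * g ^ 2 * (β + 2 + 2 * ρ)) := by positivity
    have e6 : 0 ≤ β / T * (E * β) := by positivity
    nlinarith
  have h2 : (v + g * (1 + ρ)) ^ 2 ≤ (1.2 * g) ^ 2 := by
    have := abs_le.mp hv
    refine sq_le_sq' ?_ ?_ <;> nlinarith
  nlinarith

/-- The product kept is `4g` times `T g²`: both factors come from the phase, so neither `E` nor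
decay of `v` is needed. -/
theorem numeric_middle (hg : 0 < g) (hT : 0 < T) (hE : 0 < E) (hβ : 0 < β) (hρ : -3 ≤ ρ)
    (hρ0 : ρ ≤ 0) (hc : 0.07 ≤ β + 2 + 2 * ρ) (hTg : 8 ≤ 0.07 * (T * g))
    (hv : 2 * v ^ 2 ≤ 0.07 * (T * g ^ 3)) :
    (v + g * (1 + ρ)) ^ 2 ≤ 9 / 16 * ((β / T + 4 * g) * (E * β + T * g ^ 2 * (β + 2 + 2 * ρ))) ∧
      1 / 2 * (E * β) ≤ E * β + T * g ^ 2 * (β + 2 + 2 * ρ) := by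
  have hEβ : 0 < E * β := by positivity
  have hlow : T * g ^ 2 * 0.07 ≤ T * g ^ 2 * (β + 2 + 2 * ρ) := by gcongr
  have hpos : 0 ≤ T * g ^ 2 * (β + 2 + 2 * ρ) := le_trans (by positivity) hlow
  refine ⟨?_, by linarith⟩
  have h1 : 4 * g * (T * g ^ 2 * 0.07) ≤
      (β / T + 4 * g) * (E * β + T * g ^ 2 * (β + 2 + 2 * ρ)) := by
    refine mul_le_mul ?_ (by linarith) (by positivity) (by positivity)
    have : 0 ≤ β / T := by positivity
    linarith
  have h2 : 8 * g ^ 2 ≤ 0.07 * (T * g ^ 3) := by nlinarith [sq_nonneg g]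
  have h3 : (v + g * (1 + ρ)) ^ 2 ≤ 2 * v ^ 2 + 8 * g ^ 2 := by
    have h4 : (1 + ρ) ^ 2 ≤ 4 := by nlinarith
    have h5 : g ^ 2 * (1 + ρ) ^ 2 ≤ g ^ 2 * 4 := by gcongr
    nlinarith [sq_nonneg (v - g * (1 + ρ))]
  have h6 : 0 ≤ T * g ^ 3 := by positivity
  nlinarith

/-- The product kept is `β/T` times `Eβ/2`; the phase may now have the wrong sign in `M` and is
treated as a perturbation. -/
theorem numeric_far (hg : 0 < g) (hT : 0 < T) (hE : 0 < E) (hβ : 0 < β) (hβ1 : β ≤ 1)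
    (hρ : -3 ≤ ρ) (hρ0 : ρ ≤ 0) (hTg : T * g ^ 2 ≤ E * β ^ 2 / 100)
    (hv : T * v ^ 2 ≤ E * β ^ 2 / 100) :
    (v + g * (1 + ρ)) ^ 2 ≤ 9 / 16 * ((β / T + 4 * g) * (E * β + T * g ^ 2 * (β + 2 + 2 * ρ))) ∧
      1 / 2 * (E * β) ≤ E * β + T * g ^ 2 * (β + 2 + 2 * ρ) := by
  have hββ : E * β ^ 2 ≤ E * β := by
    have : β ^ 2 ≤ β := by nlinarith
    gcongr
  have hEβ : 0 < E * β := by positivity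
  have hlow : T * g ^ 2 * (-4) ≤ T * g ^ 2 * (β + 2 + 2 * ρ) := by
    have : -4 ≤ β + 2 + 2 * ρ := by linarith
    gcongr
  have hM : 1 / 2 * (E * β) ≤ E * β + T * g ^ 2 * (β + 2 + 2 * ρ) := by linarith
  refine ⟨?_, hM⟩
  have h1 : β / T * (1 / 2 * (E * β)) ≤
      (β / T + 4 * g) * (E * β + T * g ^ 2 * (β + 2 + 2 * ρ)) :=
    mul_le_mul (by linarith) hM (by positivity) (by positivity)
  have h3 : (v + g * (1 + ρ)) ^ 2 ≤ 2 * v ^ 2 + 8 * g ^ 2 := by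
    have h4 : (1 + ρ) ^ 2 ≤ 4 := by nlinarith
    have h5 : g ^ 2 * (1 + ρ) ^ 2 ≤ g ^ 2 * 4 := by gcongr
    nlinarith [sq_nonneg (v - g * (1 + ρ))]
  have h6 : 2 * v ^ 2 + 8 * g ^ 2 ≤ E * β ^ 2 / 10 / T := by
    rw [le_div_iff₀ hT]
    linarith
  have h7 : β / T * (1 / 2 * (E * β)) = 1 / 2 * (E * β ^ 2) / T := by ring
  have h8 : E * β ^ 2 / 10 / T ≤ 9 / 16 * (1 / 2 * (E * β ^ 2) / T) := by
    have : 0 ≤ E * β ^ 2 / T := by positivity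
    have e1 : E * β ^ 2 / 10 / T = 1 / 10 * (E * β ^ 2 / T) := by ring
    have e2 : 9 / 16 * (1 / 2 * (E * β ^ 2) / T) = 9 / 32 * (E * β ^ 2 / T) := by ring
    rw [e1, e2]
    linarith
  rw [h7] at h1
  linarith

end numeric

/-- Rewriting the coefficients in terms of the logarithmic derivatives of the weights. -/
theorem coefficients_of_log_derivatives {m μ t h ψ ψ₁ E v β ρ : ℝ} (hm : 0 < m) (ht : 0 < t)
    (hh : 0 < h) (hμ : μ = β * m) (hψ : t * ψ₁ = ρ * ψ)
    (H : (v + h * ψ * (1 + ρ)) ^ 2 ≤ 9 / 16 * ((β / (t / h ^ 2) + 4 * (h * ψ)) *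
        (E * β + t / h ^ 2 * (h * ψ) ^ 2 * (β + 2 + 2 * ρ))) ∧
      1 / 2 * (E * β) ≤ E * β + t / h ^ 2 * (h * ψ) ^ 2 * (β + 2 + 2 * ρ)) :
    (m * (v + h * (ψ + t * ψ₁))) ^ 2 ≤ 9 / 16 * ((h ^ 2 * (μ / t) + 4 * h * ψ * m) *
      ((E + t * ψ ^ 2) * μ + m * t * (2 * ψ ^ 2 + 2 * t * ψ * ψ₁))) ∧
    1 / 2 * E * μ ≤ (E + t * ψ ^ 2) * μ + m * t * (2 * ψ ^ 2 + 2 * t * ψ * ψ₁) := by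
  have e1 : (E + t * ψ ^ 2) * μ + m * t * (2 * ψ ^ 2 + 2 * t * ψ * ψ₁) =
      m * (E * β + t / h ^ 2 * (h * ψ) ^ 2 * (β + 2 + 2 * ρ)) := by
    have : m * t * (2 * ψ ^ 2 + 2 * t * ψ * ψ₁) = m * t * (2 * ψ ^ 2 + 2 * ψ * (t * ψ₁)) := by ring
    rw [this, hψ, hμ]
    field_simp
    ring
  have e2 : h ^ 2 * (μ / t) + 4 * h * ψ * m = m * (β / (t / h ^ 2) + 4 * (h * ψ)) := by
    rw [hμ]; field_simp
  have e3 : m * (v + h * (ψ + t * ψ₁)) = m * (v + h * ψ * (1 + ρ)) := by rw [hψ]; ring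
  rw [e1, e2, e3]
  constructor
  · have := mul_le_mul_of_nonneg_left H.1 (sq_nonneg m)
    linarith
  · have := mul_le_mul_of_nonneg_left H.2 hm.le
    rw [hμ]
    linarith

/-! ### The phase -/

section phase

variable {e a ν t : ℝ}

/-- The saturation factor `σ = (1 + (p e / a)^ν)⁻¹`. -/
def satFactor (e a ν t : ℝ) : ℝ := (1 + (1 + t / e) ^ ν * (a / e) ^ (-ν))⁻¹

theorem sat_mul (he : 0 < e) (ht : 0 ≤ t) :
    sat e a ν t * (1 + t / e) ^ (-ν) = satFactor e a ν t := by
  have hp : 0 < 1 + t / e := by positivity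
  have h1 : (1 + t / e) ^ ν * (1 + t / e) ^ (-ν) = 1 := by
    rw [← Real.rpow_add hp]; simp
  have hp' : 0 < (1 + t / e) ^ (-ν) := by positivity
  rw [sat, satFactor]
  have : (1 + t / e) ^ (-ν) + (a / e) ^ (-ν) =
      (1 + t / e) ^ (-ν) * (1 + (1 + t / e) ^ ν * (a / e) ^ (-ν)) := by
    linear_combination -(a / e) ^ (-ν) * h1
  rw [this, mul_inv]
  field_simp

theorem satFactor_pos (he : 0 < e) (ha : 0 < a) (ht : 0 ≤ t) : 0 < satFactor e a ν t := by
  rw [satFactor]; positivity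

theorem satFactor_le_one (he : 0 < e) (ha : 0 < a) (ht : 0 ≤ t) : satFactor e a ν t ≤ 1 := by
  rw [satFactor]
  refine inv_le_one_of_one_le₀ ?_
  have : 0 ≤ (1 + t / e) ^ ν * (a / e) ^ (-ν) := by positivity
  linarith

/-- The unsaturated phase grows like `(1+t/e)^ν`; saturation multiplies its gradient by the square
of the factor `σ`, which is close to 1 for `t ≪ a`. -/
theorem phase₁_eq {B : ℝ} (he : 0 < e) (ht : 0 ≤ t) :
    phase₁ B e a ν t = B * satFactor e a ν t ^ 2 * (1 + t / e) ^ (ν - 1) := by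
  have hp : 0 < 1 + t / e := by positivity
  rw [phase₁, ← sat_mul he ht, mul_pow, ← Real.rpow_natCast ((1 + t / e) ^ (-ν)),
    ← Real.rpow_mul hp.le]
  have : (1 + t / e) ^ (-ν - 1) = (1 + t / e) ^ (-ν * ((2 : ℕ) : ℝ)) * (1 + t / e) ^ (ν - 1) := by
    rw [← Real.rpow_add hp]; congr 1; push_cast; ring
  rw [this]
  ring

/-- This reads off `ρ`. For `e ≪ t ≪ a` it is close to `2(ν-1)`, so the coefficient `β+2+2ρ` of
`|∇φ|²` in `M` is close to `4ν-1`. -/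
theorem phase₂_eq {B : ℝ} (he : 0 < e) (ht : 0 ≤ t) :
    t * (2 * phase₂ B e a ν t) =
      2 * (t / e / (1 + t / e)) * (2 * ν * satFactor e a ν t - (ν + 1)) * phase₁ B e a ν t := by
  have hp : 0 < 1 + t / e := by positivity
  have : (1 + t / e) ^ (-ν - 1) = (1 + t / e) ^ (-ν - 2) * (1 + t / e) := by
    nth_rewrite 3 [← Real.rpow_one (1 + t / e)]
    rw [← Real.rpow_add hp]; congr 1; ring
  rw [phase₂, phase₁, this, ← sat_mul he ht]
  field_simp

end phase

end Semiclassical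
end

/-! ### Compatible length scales and the pointwise Carleman condition. -/

noncomputable section
namespace Semiclassical

/-- Compatibility of the squared length scales `e ≤ b ≤ a` of the weights with `h`. -/
structure Scales (C₁ δ E h e a b ν η C : ℝ) : Prop where
  h_pos : 0 < h
  e_pos : 0 < e
  e_le_b : e ≤ b
  b_le_a : b ≤ a
  one_le_a : 1 ≤ a
  C₁_pos : 0 < C₁
  E_pos : 0 < E
  -- Keeps `4ν - 1` at least 1/9, the margin for positivity of `M` in the middle region.
  ν_ge : 5 / 18 ≤ ν
  ν_le : ν ≤ 1 / 3
  -- The square of the potential must decay at least like `r^(6ν-4)`.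
  ν_δ : 4 - 6 * ν ≤ 2 * δ
  η_pos : 0 < η
  η_le : η ≤ 1
  η_δ : η ≤ δ - 1
  C_ge : 1000 * (1 + C₁) ≤ C
  -- Up to `b` neither the saturation of the phase nor the bending of `r m` at scale `a` is felt.
  separated : 2 * (b / a) ^ ν ≤ 1 / 100
  e_ge : 2000 * h ^ 2 ≤ e
  -- Removes `h` from `(r²/h²)(hψ)³` in the middle region.
  e_eq : e ^ (3 * (1 - ν)) = h ^ 2
  -- Beyond `b`, both `r²V²/h²` and `r²ψ²` must lie below `Eβ²/100`; the bound `β ≥ (η/2)P^(-η/2)`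
  -- turns 100 into 400.
  far_potential : 2 * C₁ ^ 2 * b ^ (1 - δ) / h ^ 2 ≤ E * η ^ 2 / 400
  far_phase : C ^ 2 * e ^ (2 - 2 * ν) * b ^ (2 * ν - 1) / h ^ 2 ≤ E * η ^ 2 / 400

namespace Scales

variable {C₁ δ E h e a b ν η C : ℝ}

theorem b_pos (S : Scales C₁ δ E h e a b ν η C) : 0 < b := S.e_pos.trans_le S.e_le_b

theorem a_pos (S : Scales C₁ δ E h e a b ν η C) : 0 < a := S.b_pos.trans_le S.b_le_a

theorem C_pos (S : Scales C₁ δ E h e a b ν η C) : 0 < C := by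
  linarith [S.C_ge, S.C₁_pos]

theorem div_le (S : Scales C₁ δ E h e a b ν η C) : b / a ≤ 1 / 200 := by
  have h0 : 0 < b / a := div_pos S.b_pos S.a_pos
  have h1 : b / a ≤ 1 := (div_le_one S.a_pos).mpr S.b_le_a
  have h2 : (b / a) ^ (1 : ℝ) ≤ (b / a) ^ ν :=
    Real.rpow_le_rpow_of_exponent_ge h0 h1 (by linarith [S.ν_le])
  rw [Real.rpow_one] at h2
  linarith [S.separated]

theorem satFactor_ge (S : Scales C₁ δ E h e a b ν η C) {t : ℝ} (ht : 0 ≤ t) (htb : t ≤ b) :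
    0.99 ≤ satFactor e a ν t := by
  have he := S.e_pos
  have ha := S.a_pos
  have hb := S.b_pos
  have hν : 0 < ν := by linarith [S.ν_ge]
  have h1 : (1 + t / e) ^ ν ≤ 2 * (b / e) ^ ν := by
    have h2 : 1 + t / e ≤ 2 * (b / e) := by
      have h3 : 1 ≤ b / e := (one_le_div he).mpr S.e_le_b
      have h4 : t / e ≤ b / e := by gcongr
      linarith
    calc (1 + t / e) ^ ν ≤ (2 * (b / e)) ^ ν := by gcongr
      _ = 2 ^ ν * (b / e) ^ ν := Real.mul_rpow (by norm_num) (by positivity)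
      _ ≤ 2 ^ (1 : ℝ) * (b / e) ^ ν := by
        gcongr
        · norm_num
        · linarith [S.ν_le]
      _ = _ := by norm_num
  have h2 : (b / e) ^ ν * (a / e) ^ (-ν) = (b / a) ^ ν := by
    rw [Real.rpow_neg (by positivity), ← div_eq_mul_inv, ← Real.div_rpow (by positivity)
      (by positivity)]
    congr 1
    field_simp
  have h3 : (1 + t / e) ^ ν * (a / e) ^ (-ν) ≤ 1 / 100 := by
    calc (1 + t / e) ^ ν * (a / e) ^ (-ν) ≤ 2 * (b / e) ^ ν * (a / e) ^ (-ν) := by gcongr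
      _ = 2 * (b / a) ^ ν := by rw [mul_assoc, h2]
      _ ≤ 1 / 100 := S.separated
  rw [satFactor, le_inv_comm₀ (by norm_num) (by positivity)]
  norm_num at h3 ⊢
  linarith

/-- Subadditivity of the power `ν ≤ 1` gives `σ ≤ P^(-ν)` with `P = 1 + t/a`, and `4ν ≥ 1 ≥ η`. Thus
beyond `a` the square of the phase gradient decays at least as fast as the lower bound for `β²`. -/
theorem satFactor_pow_le (S : Scales C₁ δ E h e a b ν η C) {t : ℝ} (ht : 0 ≤ t) :
    satFactor e a ν t ^ 4 ≤ (1 + t / a) ^ (-η) := by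
  have he := S.e_pos
  have ha := S.a_pos
  have hν : 0 < ν := by linarith [S.ν_ge]
  have hP : 1 ≤ 1 + t / a := by
    have : 0 ≤ t / a := by positivity
    linarith
  have h1 : (t / a) ^ ν ≤ (1 + t / e) ^ ν * (a / e) ^ (-ν) := by
    rw [Real.rpow_neg (by positivity), ← div_eq_mul_inv, ← Real.div_rpow (by positivity)
      (by positivity)]
    have : t / a ≤ (1 + t / e) / (a / e) := by
      rw [div_le_div_iff₀ ha (by positivity)]
      have : t * (a / e) = t / e * a := by ring
      nlinarith
    gcongr
  have h2 : (1 + t / a) ^ ν ≤ 1 + (t / a) ^ ν := by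
    have := Real.rpow_add_le_add_rpow (p := ν) (zero_le_one' ℝ)
      (show 0 ≤ t / a by positivity) hν.le (by linarith [S.ν_le])
    simpa using this
  have h3 : satFactor e a ν t ≤ (1 + t / a) ^ (-ν) := by
    rw [satFactor, Real.rpow_neg (show 0 ≤ 1 + t / a by linarith)]
    exact inv_anti₀ (by positivity) (by linarith)
  calc satFactor e a ν t ^ 4 ≤ ((1 + t / a) ^ (-ν)) ^ 4 := by
        have := (satFactor_pos (ν := ν) he ha ht).le
        gcongr
    _ = (1 + t / a) ^ (-ν * 4) := by
      rw [← Real.rpow_natCast, ← Real.rpow_mul (by linarith)]; norm_num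
    _ ≤ (1 + t / a) ^ (-η) :=
      Real.rpow_le_rpow_of_exponent_le hP (by linarith [S.ν_ge, S.η_le])

/-- Here the phase is nearly quadratic: `hψ` is nearly `C`, which exceeds the potential by a factor
of several hundred, and `ρ` is nearly 0. -/
theorem potential_near (S : Scales C₁ δ E h e a b ν η C) {r v β : ℝ} (hr : 0 < r)
    (hre : r ^ 2 ≤ e / 100) (hv : |v| ≤ C₁ * (r + 1) ^ (-δ)) (hβ : 0.99 ≤ β) {σ ρ g : ℝ}
    (hσ : 0.99 ≤ σ) (hσ1 : σ ≤ 1)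
    (hρ : ρ = 2 * (r ^ 2 / e / (1 + r ^ 2 / e)) * (2 * ν * σ - (ν + 1)))
    (hg : g = C * σ ^ 2 * (1 + r ^ 2 / e) ^ (ν - 1)) :
    (v + g * (1 + ρ)) ^ 2 ≤ 9 / 16 * ((β / (r ^ 2 / h ^ 2) + 4 * g) *
        (E * β + r ^ 2 / h ^ 2 * g ^ 2 * (β + 2 + 2 * ρ))) ∧
      1 / 2 * (E * β) ≤ E * β + r ^ 2 / h ^ 2 * g ^ 2 * (β + 2 + 2 * ρ) := by
  have he := S.e_pos
  have hh := S.h_pos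
  have hC := S.C_pos
  have hν := S.ν_ge
  have hν' := S.ν_le
  have hx0 : 0 ≤ r ^ 2 / e := by positivity
  have hx1 : r ^ 2 / e ≤ 1 / 100 := by rw [div_le_iff₀ he]; linarith
  have hξ0 : 0 ≤ r ^ 2 / e / (1 + r ^ 2 / e) := by positivity
  have hξ1 : r ^ 2 / e / (1 + r ^ 2 / e) ≤ 1 / 100 :=
    (div_le_self hx0 (by linarith)).trans hx1
  have hb1 : 2 * ν * σ - (ν + 1) ≤ 0 := by nlinarith
  have hb2 : -2 ≤ 2 * ν * σ - (ν + 1) := by nlinarith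
  have hp : 0.99 ≤ (1 + r ^ 2 / e) ^ (ν - 1) := by
    have h1 : (1 + r ^ 2 / e) ^ (-1 : ℝ) ≤ (1 + r ^ 2 / e) ^ (ν - 1) :=
      Real.rpow_le_rpow_of_exponent_le (by linarith) (by linarith)
    rw [Real.rpow_neg_one] at h1
    refine le_trans ?_ h1
    rw [le_inv_comm₀ (by norm_num) (by positivity)]
    norm_num at hx1 ⊢
    linarith
  have hσ2 : 0.98 ≤ σ ^ 2 := by nlinarith
  have hgC : 0.97 * C ≤ g := by
    rw [hg, mul_assoc, mul_comm 0.97]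
    have : 0.97 ≤ σ ^ 2 * (1 + r ^ 2 / e) ^ (ν - 1) := by nlinarith
    gcongr
  have hv1 : |v| ≤ C₁ := by
    have h1 : (r + 1) ^ (-δ) ≤ 1 := by
      refine Real.rpow_le_one_of_one_le_of_nonpos (by linarith) ?_
      linarith [S.η_δ, S.η_pos]
    have := S.C₁_pos
    nlinarith
  refine numeric_near (by linarith [mul_pos (show (0 : ℝ) < 0.97 by norm_num) hC])
    (by positivity) S.E_pos hβ ?_ ?_ ?_
  · rw [hρ]; nlinarith
  · rw [hρ]; exact mul_nonpos_of_nonneg_of_nonpos (by positivity) hb1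
  · have := S.C_ge
    have := S.C₁_pos
    linarith

/-- The cube of `g ≥ (C/110)(r²/e)^(ν-1)` times `r²/h²` is at least `(C/110)³ r^(6ν-4)` by the
choice of `e`, and this dominates the squared potential. -/
theorem potential_middle (S : Scales C₁ δ E h e a b ν η C) {r v β : ℝ} (hr : 0 < r)
    (hre : e / 100 ≤ r ^ 2) (hv : |v| ≤ C₁ * (r + 1) ^ (-δ)) (hβ : 0.99 ≤ β) {σ ρ g : ℝ}
    (hσ : 0.99 ≤ σ) (hσ1 : σ ≤ 1)
    (hρ : ρ = 2 * (r ^ 2 / e / (1 + r ^ 2 / e)) * (2 * ν * σ - (ν + 1)))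
    (hg : g = C * σ ^ 2 * (1 + r ^ 2 / e) ^ (ν - 1)) :
    (v + g * (1 + ρ)) ^ 2 ≤ 9 / 16 * ((β / (r ^ 2 / h ^ 2) + 4 * g) *
        (E * β + r ^ 2 / h ^ 2 * g ^ 2 * (β + 2 + 2 * ρ))) ∧
      1 / 2 * (E * β) ≤ E * β + r ^ 2 / h ^ 2 * g ^ 2 * (β + 2 + 2 * ρ) := by
  have he := S.e_pos
  have hh := S.h_pos
  have hC := S.C_pos
  have hν := S.ν_ge
  have hν' := S.ν_le
  have hC₁ := S.C₁_pos
  have hx0 : 0 < r ^ 2 / e := by positivity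
  have hx1 : 1 / 100 ≤ r ^ 2 / e := by rw [le_div_iff₀ he]; linarith
  have hξ0 : 0 ≤ r ^ 2 / e / (1 + r ^ 2 / e) := by positivity
  have hξ1 : r ^ 2 / e / (1 + r ^ 2 / e) ≤ 1 := by
    rw [div_le_one (by positivity)]; linarith
  have hb1 : 2 * ν * σ - (ν + 1) ≤ 0 := by nlinarith
  have hρ2 : 2 * (2 * ν * σ - (ν + 1)) ≤ ρ := by rw [hρ]; nlinarith
  have hb2 : 0.98 * ν - 1 ≤ 2 * ν * σ - (ν + 1) := by nlinarith
  have hσ2 : 0.98 ≤ σ ^ 2 := by nlinarith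
  set y := (r ^ 2 / e) ^ (ν - 1) with hy
  have hy0 : 0 < y := by positivity
  -- Since `r²/e ≥ 1/100`, one has `1 + r²/e ≤ 101 r²/e`; with `σ² ≥ 0.98` this leads to the
  -- constant 110.
  have hp : 1 / 101 * y ≤ (1 + r ^ 2 / e) ^ (ν - 1) := by
    calc 1 / 101 * y = 101 ^ (-1 : ℝ) * y := by rw [Real.rpow_neg_one]; norm_num
      _ ≤ 101 ^ (ν - 1) * y := by
        gcongr
        · norm_num
        · linarith
      _ = (101 * (r ^ 2 / e)) ^ (ν - 1) := (Real.mul_rpow (by norm_num) hx0.le).symm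
      _ ≤ (1 + r ^ 2 / e) ^ (ν - 1) :=
        Real.rpow_le_rpow_of_nonpos (by positivity) (by linarith) (by linarith)
  have hG : C / 110 * y ≤ g := by
    rw [hg]
    have h1 : 0.98 * (1 / 101 * y) ≤ σ ^ 2 * (1 + r ^ 2 / e) ^ (ν - 1) :=
      mul_le_mul hσ2 hp (by positivity) (by positivity)
    have h2 : C * (1 / 110 * y) ≤ C * (σ ^ 2 * (1 + r ^ 2 / e) ^ (ν - 1)) :=
      mul_le_mul_of_nonneg_left (by linarith) hC.le
    linarith
  have hC' : 9 * (1 + C₁) ≤ C / 110 := by linarith [S.C_ge]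
  have hg0 : 0 < g := lt_of_lt_of_le (by positivity) hG
  refine numeric_middle hg0 (by positivity) S.E_pos (by linarith) (by linarith) ?_
    (by linarith) ?_ ?_
  · rw [hρ]; exact mul_nonpos_of_nonneg_of_nonpos (by positivity) hb1
  · have h1 : r ^ 2 / h ^ 2 * y = e / h ^ 2 * (r ^ 2 / e) ^ ν := by
      have : (r ^ 2 / e) ^ ν = r ^ 2 / e * y := by
        rw [hy]
        nth_rewrite 2 [← Real.rpow_one (r ^ 2 / e)]
        rw [← Real.rpow_add hx0]
        congr 1
        ring
      rw [this]
      field_simp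
    have h2 : 1 / 100 ≤ (r ^ 2 / e) ^ ν := by
      calc (1 / 100 : ℝ) = (1 / 100) ^ (1 : ℝ) := (Real.rpow_one _).symm
        _ ≤ (1 / 100) ^ ν := Real.rpow_le_rpow_of_exponent_ge (by norm_num) (by norm_num)
          (by linarith)
        _ ≤ (r ^ 2 / e) ^ ν := by gcongr
    have h3 : 2000 ≤ e / h ^ 2 := by
      rw [le_div_iff₀ (by positivity)]
      exact S.e_ge
    have h4 : 20 ≤ r ^ 2 / h ^ 2 * y := by rw [h1]; nlinarith
    have h5 : 180 ≤ C / 110 * (r ^ 2 / h ^ 2 * y) := by nlinarith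
    have h6 : C / 110 * (r ^ 2 / h ^ 2 * y) ≤ r ^ 2 / h ^ 2 * g := by
      have := mul_le_mul_of_nonneg_left hG (show 0 ≤ r ^ 2 / h ^ 2 by positivity)
      linarith
    linarith
  · have h1 : r ^ 2 / h ^ 2 * y ^ 3 = r ^ (6 * ν - 4) := by
      have e1 : y ^ 3 = (r ^ 2) ^ (3 * ν - 3) / e ^ (3 * ν - 3) := by
        rw [hy, ← Real.rpow_natCast, ← Real.rpow_mul hx0.le, ← Real.div_rpow (by positivity)
          he.le]
        congr 1
        push_cast
        ring
      have e2 : e ^ (3 * ν - 3) = (h ^ 2)⁻¹ := by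
        rw [← S.e_eq, ← Real.rpow_neg he.le]
        congr 1
        ring
      have e3 : r ^ (6 * ν - 4) = r ^ 2 * (r ^ 2) ^ (3 * ν - 3) := by
        rw [← Real.rpow_natCast, ← Real.rpow_mul hr.le, ← Real.rpow_add hr]
        congr 1
        push_cast
        ring
      rw [e1, e2, e3]
      field_simp
    have h2 : (r + 1) ^ (-δ) ^ 1 * (r + 1) ^ (-δ) ≤ r ^ (6 * ν - 4) := by
      rw [pow_one, ← Real.rpow_add (by linarith)]
      calc (r + 1) ^ (-δ + -δ) ≤ (r + 1) ^ (6 * ν - 4) :=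
            Real.rpow_le_rpow_of_exponent_le (by linarith) (by linarith [S.ν_δ])
        _ ≤ r ^ (6 * ν - 4) := Real.rpow_le_rpow_of_nonpos hr (by linarith) (by linarith)
    rw [pow_one] at h2
    have h3 : v ^ 2 ≤ C₁ ^ 2 * r ^ (6 * ν - 4) := by
      have h4 : v ^ 2 ≤ (C₁ * (r + 1) ^ (-δ)) ^ 2 := by
        rw [← sq_abs]
        gcongr
      have h5 : (C₁ * (r + 1) ^ (-δ)) ^ 2 = C₁ ^ 2 * ((r + 1) ^ (-δ) * (r + 1) ^ (-δ)) := by ring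
      rw [h5] at h4
      refine h4.trans ?_
      gcongr
    have h4 : (C / 110) ^ 3 * r ^ (6 * ν - 4) ≤ r ^ 2 / h ^ 2 * g ^ 3 := by
      calc (C / 110) ^ 3 * r ^ (6 * ν - 4) = r ^ 2 / h ^ 2 * (C / 110 * y) ^ 3 := by
            rw [← h1]; ring
        _ ≤ r ^ 2 / h ^ 2 * g ^ 3 := by gcongr
    have h5 : 2 * C₁ ^ 2 ≤ 0.07 * (C / 110) ^ 3 := by
      have h6 : (9 * (1 + C₁)) ^ 3 ≤ (C / 110) ^ 3 := by gcongr
      have h7 : (9 * (1 + C₁)) ^ 3 = 729 * (1 + 3 * C₁ + 3 * C₁ ^ 2 + C₁ ^ 3) := by ring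
      rw [h7] at h6
      have h8 := sq_nonneg C₁
      have h9 := pow_pos hC₁ 3
      linarith
    have h6 : 0 ≤ r ^ (6 * ν - 4) := by positivity
    have h7 := mul_le_mul_of_nonneg_right h5 h6
    linarith

/-- The lower bound for `β²` carries the factor `Q = P^(-η)`, so both perturbations must be shown to
decay like `Q`. The phase inherits it from `σ⁴`, the potential from its own decay. -/
theorem potential_far (S : Scales C₁ δ E h e a b ν η C) {r v β : ℝ} (hr : 0 < r)
    (hrb : b ≤ r ^ 2) (hv : |v| ≤ C₁ * (r + 1) ^ (-δ)) (hβ1 : β ≤ 1)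
    (hβ : η / 2 * (1 + r ^ 2 / a) ^ (-(η / 2)) ≤ β) {σ ρ g : ℝ}
    (hσ0 : 0 < σ) (hσ1 : σ ≤ 1) (hσ : σ ^ 4 ≤ (1 + r ^ 2 / a) ^ (-η))
    (hρ : ρ = 2 * (r ^ 2 / e / (1 + r ^ 2 / e)) * (2 * ν * σ - (ν + 1)))
    (hg : g = C * σ ^ 2 * (1 + r ^ 2 / e) ^ (ν - 1)) :
    (v + g * (1 + ρ)) ^ 2 ≤ 9 / 16 * ((β / (r ^ 2 / h ^ 2) + 4 * g) *
        (E * β + r ^ 2 / h ^ 2 * g ^ 2 * (β + 2 + 2 * ρ))) ∧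
      1 / 2 * (E * β) ≤ E * β + r ^ 2 / h ^ 2 * g ^ 2 * (β + 2 + 2 * ρ) := by
  have he := S.e_pos
  have hh := S.h_pos
  have hC := S.C_pos
  have ha := S.a_pos
  have hb := S.b_pos
  have hν := S.ν_ge
  have hν' := S.ν_le
  have hC₁ := S.C₁_pos
  have hη := S.η_pos
  have hE := S.E_pos
  have hx0 : 0 < r ^ 2 / e := by positivity
  have hξ0 : 0 ≤ r ^ 2 / e / (1 + r ^ 2 / e) := by positivity
  have hξ1 : r ^ 2 / e / (1 + r ^ 2 / e) ≤ 1 := by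
    rw [div_le_one (by positivity)]; linarith
  have hb1 : 2 * ν * σ - (ν + 1) ≤ 0 := by nlinarith
  have hρ2 : 2 * (2 * ν * σ - (ν + 1)) ≤ ρ := by rw [hρ]; nlinarith
  have hνσ : 0 < ν * σ := by positivity
  have hg0 : 0 < g := by rw [hg]; positivity
  have hP : 0 < 1 + r ^ 2 / a := by positivity
  set Q := (1 + r ^ 2 / a) ^ (-η) with hQ
  have hQ0 : 0 < Q := by positivity
  have hβ2 : η ^ 2 / 4 * Q ≤ β ^ 2 := by
    have e1 : η ^ 2 / 4 * Q = (η / 2 * (1 + r ^ 2 / a) ^ (-(η / 2))) ^ 2 := by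
      rw [mul_pow, ← Real.rpow_natCast ((1 + r ^ 2 / a) ^ (-(η / 2))), ← Real.rpow_mul hP.le, hQ]
      have : -(η / 2) * ((2 : ℕ) : ℝ) = -η := by push_cast; ring
      rw [this]
      ring
    rw [e1]
    gcongr
  have hβ0 : 0 < β := lt_of_lt_of_le (by positivity) hβ
  have hlow : E * η ^ 2 / 400 * Q ≤ E * β ^ 2 / 100 := by
    have := mul_le_mul_of_nonneg_left hβ2 (show 0 ≤ E / 100 by positivity)
    linarith
  refine numeric_far hg0 (by positivity) hE hβ0 hβ1 (by linarith) ?_ ?_ ?_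
  · rw [hρ]; exact mul_nonpos_of_nonneg_of_nonpos (by positivity) hb1
  · refine le_trans ?_ hlow
    have h1 : ((1 + r ^ 2 / e) ^ (ν - 1)) ^ 2 ≤ (r ^ 2) ^ (2 * ν - 2) * e ^ (2 - 2 * ν) := by
      calc ((1 + r ^ 2 / e) ^ (ν - 1)) ^ 2 ≤ ((r ^ 2 / e) ^ (ν - 1)) ^ 2 := by
            have : (1 + r ^ 2 / e) ^ (ν - 1) ≤ (r ^ 2 / e) ^ (ν - 1) :=
              Real.rpow_le_rpow_of_nonpos hx0 (by linarith) (by linarith)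
            gcongr
        _ = (r ^ 2 / e) ^ (2 * ν - 2) := by
            rw [← Real.rpow_natCast, ← Real.rpow_mul hx0.le]
            congr 1
            push_cast
            ring
        _ = (r ^ 2) ^ (2 * ν - 2) * e ^ (2 - 2 * ν) := by
            rw [Real.div_rpow (by positivity) he.le, div_eq_mul_inv, ← Real.rpow_neg he.le]
            congr 2
            ring
    have h2 : r ^ 2 * (r ^ 2) ^ (2 * ν - 2) ≤ b ^ (2 * ν - 1) := by
      have e1 : r ^ 2 * (r ^ 2) ^ (2 * ν - 2) = (r ^ 2) ^ (2 * ν - 1) := by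
        nth_rewrite 1 [← Real.rpow_one (r ^ 2)]
        rw [← Real.rpow_add (by positivity)]
        congr 1
        ring
      rw [e1]
      exact Real.rpow_le_rpow_of_nonpos hb hrb (by linarith)
    have h3 : g ^ 2 ≤ C ^ 2 * Q * ((r ^ 2) ^ (2 * ν - 2) * e ^ (2 - 2 * ν)) := by
      have e1 : g ^ 2 = C ^ 2 * σ ^ 4 * ((1 + r ^ 2 / e) ^ (ν - 1)) ^ 2 := by rw [hg]; ring
      rw [e1]
      gcongr
    calc r ^ 2 / h ^ 2 * g ^ 2 ≤
        r ^ 2 / h ^ 2 * (C ^ 2 * Q * ((r ^ 2) ^ (2 * ν - 2) * e ^ (2 - 2 * ν))) := by gcongr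
      _ = C ^ 2 * e ^ (2 - 2 * ν) * (r ^ 2 * (r ^ 2) ^ (2 * ν - 2)) / h ^ 2 * Q := by ring
      _ ≤ C ^ 2 * e ^ (2 - 2 * ν) * b ^ (2 * ν - 1) / h ^ 2 * Q := by gcongr
      _ ≤ E * η ^ 2 / 400 * Q := mul_le_mul_of_nonneg_right S.far_phase hQ0.le
  · refine le_trans ?_ hlow
    have h1 : v ^ 2 ≤ C₁ ^ 2 * (r ^ 2) ^ (-δ) := by
      have h2 : (r + 1) ^ (-δ) ≤ r ^ (-δ) :=
        Real.rpow_le_rpow_of_nonpos hr (by linarith) (by linarith [S.η_δ])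
      have h3 : v ^ 2 ≤ (C₁ * r ^ (-δ)) ^ 2 := by
        rw [← sq_abs]
        gcongr
        exact hv.trans (by gcongr)
      refine h3.trans_eq ?_
      rw [mul_pow, ← Real.rpow_natCast (r ^ (-δ)), ← Real.rpow_mul hr.le,
        ← Real.rpow_natCast r 2, ← Real.rpow_mul hr.le, mul_comm (-δ)]
    have hPr : 1 + r ^ 2 / a ≤ 2 / b * r ^ 2 := by
      have h2 : r ^ 2 / a ≤ r ^ 2 / b := by
        have := S.b_le_a
        gcongr
      have h3 : 1 ≤ r ^ 2 / b := (one_le_div hb).mpr hrb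
      have : 2 / b * r ^ 2 = r ^ 2 / b + r ^ 2 / b := by ring
      linarith
    -- Since `η ≤ δ - 1`, a factor `(r²)^(-η)` can be split off to produce `Q`; the remaining
    -- nonpositive power is largest at `r² = b`.
    have h4 : r ^ 2 * (r ^ 2) ^ (-δ) ≤ 2 * b ^ (1 - δ) * Q := by
      have h5 : (2 / b * r ^ 2) ^ (-η) ≤ Q :=
        Real.rpow_le_rpow_of_nonpos hP hPr (by linarith)
      have h6 : r ^ 2 * (r ^ 2) ^ (-δ) = (r ^ 2) ^ (1 - δ + η) * (r ^ 2) ^ (-η) := by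
        rw [← Real.rpow_add (by positivity)]
        nth_rewrite 1 [← Real.rpow_one (r ^ 2)]
        rw [← Real.rpow_add (by positivity)]
        congr 1
        ring
      have h7 : (r ^ 2) ^ (-η) = (2 / b) ^ η * (2 / b * r ^ 2) ^ (-η) := by
        rw [Real.mul_rpow (by positivity) (by positivity), ← mul_assoc,
          ← Real.rpow_add (by positivity)]
        simp
      have h8 : (r ^ 2) ^ (1 - δ + η) ≤ b ^ (1 - δ + η) :=
        Real.rpow_le_rpow_of_nonpos hb hrb (by linarith [S.η_δ])
      have h9 : b ^ (1 - δ + η) * (2 / b) ^ η ≤ 2 * b ^ (1 - δ) := by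
        rw [Real.div_rpow (by norm_num) hb.le, Real.rpow_add hb]
        have h10 : (2 : ℝ) ^ η ≤ 2 ^ (1 : ℝ) :=
          Real.rpow_le_rpow_of_exponent_le (by norm_num) S.η_le
        rw [Real.rpow_one] at h10
        have : b ^ (1 - δ) * b ^ η * (2 ^ η / b ^ η) = 2 ^ η * b ^ (1 - δ) := by
          field_simp
        rw [this]
        gcongr
      rw [h6, h7]
      calc (r ^ 2) ^ (1 - δ + η) * ((2 / b) ^ η * (2 / b * r ^ 2) ^ (-η)) ≤
          b ^ (1 - δ + η) * ((2 / b) ^ η * Q) := by gcongr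
        _ = b ^ (1 - δ + η) * (2 / b) ^ η * Q := by ring
        _ ≤ 2 * b ^ (1 - δ) * Q := by gcongr
    calc r ^ 2 / h ^ 2 * v ^ 2 ≤ r ^ 2 / h ^ 2 * (C₁ ^ 2 * (r ^ 2) ^ (-δ)) := by gcongr
      _ = C₁ ^ 2 * (r ^ 2 * (r ^ 2) ^ (-δ)) / h ^ 2 := by ring
      _ ≤ C₁ ^ 2 * (2 * b ^ (1 - δ) * Q) / h ^ 2 := by gcongr
      _ = 2 * C₁ ^ 2 * b ^ (1 - δ) / h ^ 2 * Q := by ring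
      _ ≤ E * η ^ 2 / 400 * Q := mul_le_mul_of_nonneg_right S.far_potential hQ0.le

/-- The pointwise conditions on the weights in the Carleman estimate. -/
theorem pointwise (S : Scales C₁ δ E h e a b ν η C) {r v : ℝ} (hr : 0 < r)
    (hv : |v| ≤ C₁ * (r + 1) ^ (-δ)) {m μ ψ ψ₁ : ℝ} (hm : m = mul₀ a η (r ^ 2))
    (hμ : μ = m + r ^ 2 * (2 * mul₁ a η (r ^ 2))) (hψ : ψ = phase₁ (C / h) e a ν (r ^ 2))
    (hψ₁ : ψ₁ = 2 * phase₂ (C / h) e a ν (r ^ 2)) :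
    (m * (v + h * (ψ + r ^ 2 * ψ₁))) ^ 2 ≤
      9 / 16 * ((h ^ 2 * (μ / r ^ 2) + 4 * h * ψ * m) *
        ((E + r ^ 2 * ψ ^ 2) * μ + m * r ^ 2 * (2 * ψ ^ 2 + 2 * r ^ 2 * ψ * ψ₁))) ∧
    1 / 2 * E * μ ≤ (E + r ^ 2 * ψ ^ 2) * μ + m * r ^ 2 * (2 * ψ ^ 2 + 2 * r ^ 2 * ψ * ψ₁) := by
  have ha := S.a_pos
  have he := S.e_pos
  have hh := S.h_pos
  have hη := S.η_pos
  have ht : 0 < r ^ 2 := by positivity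
  have hP : 0 < 1 + r ^ 2 / a := by positivity
  have hm0 : 0 < m := by
    rw [hm]
    exact lt_of_lt_of_le (by positivity) (mul₀_bounds ha hη ht.le).1
  have hβm : μ = μ / m * m := by field_simp
  have hσ0 := satFactor_pos (ν := ν) he ha ht.le
  have hσ1 := satFactor_le_one (ν := ν) he ha ht.le
  have hg : h * ψ = C * satFactor e a ν (r ^ 2) ^ 2 * (1 + r ^ 2 / e) ^ (ν - 1) := by
    rw [hψ, phase₁_eq he ht.le]
    field_simp
  refine coefficients_of_log_derivatives
    (ρ := 2 * (r ^ 2 / e / (1 + r ^ 2 / e)) * (2 * ν * satFactor e a ν (r ^ 2) - (ν + 1)))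
    hm0 ht hh hβm (by rw [hψ₁, hψ, phase₂_eq he ht.le]) ?_
  -- Up to `b`, `P ≤ 1.005` gives `β ≥ 1/P ≥ 0.99`, and the cut at `e/100` separates near from
  -- middle.
  rcases le_total (r ^ 2) b with hb | hb
  · have hβ : 0.99 ≤ μ / m := by
      have h1 := radial_ge_div ha hη ht.le
      rw [← hm, ← hμ] at h1
      have h2 : r ^ 2 / a ≤ 1 / 200 := le_trans (by gcongr) S.div_le
      have h3 : 1 + r ^ 2 / a ≤ 1.005 := by norm_num at h2 ⊢; linarith
      rw [le_div_iff₀ hm0]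
      have h4 : 0 ≤ μ := by
        by_contra hneg
        push Not at hneg
        nlinarith
      nlinarith
    have hσ := S.satFactor_ge ht.le hb
    rcases le_total (r ^ 2) (e / 100) with h1 | h1
    · exact S.potential_near hr h1 hv hβ hσ hσ1 rfl hg
    · exact S.potential_middle hr h1 hv hβ hσ hσ1 rfl hg
  · refine S.potential_far hr hb hv ?_ ?_ hσ0 hσ1 (S.satFactor_pow_le ht.le) rfl hg
    · rw [div_le_one hm0, hμ]
      have := mul₁_nonpos ha hη S.η_le ht.le
      nlinarith
    · have h1 := radial_ge_mul ha hη S.η_le ht.le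
      rw [← hm, ← hμ] at h1
      rwa [le_div_iff₀ hm0]

end Scales

end Semiclassical
end

/-! ### The Carleman estimate for the explicit weights. -/

noncomputable section
namespace Semiclassical
namespace Scales

variable {C₁ δ E h e a b ν η C : ℝ}

/-- The radial weights of the Carleman estimate at given length scales. -/
def weights (S : Scales C₁ δ E h e a b ν η C) (n : ℕ) : RadialWeights n where
  m := fun x => mul₀ a η (‖x‖ ^ 2)
  m₁ := fun x => 2 * mul₁ a η (‖x‖ ^ 2)
  φ := fun x => phase₀ (C / h) e a ν (‖x‖ ^ 2)
  ψ := fun x => phase₁ (C / h) e a ν (‖x‖ ^ 2)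
  ψ₁ := fun x => 2 * phase₂ (C / h) e a ν (‖x‖ ^ 2)
  hm := hasRadialDeriv_comp fun t ht => hasDerivAt_mul₀ S.a_pos ht
  hφ := by
    have h1 := hasRadialDeriv_comp (n := n) (g := phase₀ (C / h) e a ν)
      (g' := fun t => phase₁ (C / h) e a ν t / 2) fun t ht =>
        hasDerivAt_phase₀ S.e_pos ht S.a_pos (by linarith [S.ν_ge])
    intro x
    convert! h1 x using 2
    ring
  hψ := hasRadialDeriv_comp fun t ht => hasDerivAt_phase₁ S.e_pos ht S.a_pos
  continuous_m₁ := by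
    have ha := S.a_pos
    have hP : ∀ x : Rn n, 1 + ‖x‖ ^ 2 / a ≠ 0 := fun x => by positivity
    have hc : Continuous fun x : Rn n => 1 + ‖x‖ ^ 2 / a := by fun_prop
    have h1 := fun b : ℝ => hc.rpow_const (p := b) fun x => Or.inl (hP x)
    unfold mul₁
    exact continuous_const.mul (continuous_const.mul ((continuous_const.mul (h1 _)).add
      (continuous_const.mul (h1 _))))
  continuous_ψ₁ := by
    have ha := S.a_pos
    have he := S.e_pos
    have hP : ∀ x : Rn n, 1 + ‖x‖ ^ 2 / e ≠ 0 := fun x => by positivity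
    have hc : Continuous fun x : Rn n => 1 + ‖x‖ ^ 2 / e := by fun_prop
    have h1 := fun b : ℝ => hc.rpow_const (p := b) fun x => Or.inl (hP x)
    have h2 : Continuous fun x : Rn n => sat e a ν (‖x‖ ^ 2) :=
      ((h1 _).add continuous_const).inv₀ fun x => (sat_den_pos he (sq_nonneg _) ha).ne'
    unfold phase₂
    exact continuous_const.mul (((continuous_const.mul (h2.pow 2)).mul (h1 _)).mul
      (((continuous_const.mul h2).mul (h1 _)).sub continuous_const))
  m_nonneg := fun x => by
    have ha := S.a_pos
    exact le_trans (by positivity) (mul₀_bounds ha S.η_pos (sq_nonneg ‖x‖)).1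
  m₁_nonpos := fun x => by
    have := mul₁_nonpos S.a_pos S.η_pos S.η_le (sq_nonneg ‖x‖)
    linarith
  radial_nonneg := fun x => by
    have ha := S.a_pos
    have hη := S.η_pos
    exact le_trans (by positivity) (radial_ge ha hη S.η_le (sq_nonneg ‖x‖))
  φ_nonneg := fun x => by
    have he := S.e_pos
    have hh := S.h_pos
    have hC := S.C_pos
    have hν : 0 < ν := by linarith [S.ν_ge]
    have := sat_pos (ν := ν) he (sq_nonneg ‖x‖) S.a_pos
    unfold phase₀
    positivity
  ψ_nonneg := fun x => by
    have he := S.e_pos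
    have hh := S.h_pos
    have hC := S.C_pos
    unfold phase₁
    positivity

/-- The maximum of the phase, divided by `h`. -/
def maxPhase (C h e a ν : ℝ) : ℝ := C * e ^ (1 - ν) * a ^ ν / (2 * ν * h ^ 2)

theorem phase_le (S : Scales C₁ δ E h e a b ν η C) {n : ℕ} (x : Rn n) :
    (S.weights n).φ x / h ≤ maxPhase C h e a ν := by
  have he := S.e_pos
  have hh := S.h_pos
  have hC := S.C_pos
  have ha := S.a_pos
  have hν : 0 < ν := by linarith [S.ν_ge]
  have h1 : sat e a ν (‖x‖ ^ 2) ≤ (a / e) ^ ν := by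
    have h2 : (a / e) ^ ν = ((a / e) ^ (-ν))⁻¹ := by rw [Real.rpow_neg (by positivity), inv_inv]
    rw [sat, h2]
    refine inv_anti₀ (by positivity) ?_
    have : 0 ≤ (1 + ‖x‖ ^ 2 / e) ^ (-ν) := by positivity
    linarith
  have h3 : maxPhase C h e a ν = C / h * e / (2 * ν) * (a / e) ^ ν / h := by
    rw [maxPhase, Real.rpow_sub he, Real.rpow_one, Real.div_rpow ha.le he.le]
    field_simp
  rw [h3]
  change C / h * e / (2 * ν) * sat e a ν (‖x‖ ^ 2) / h ≤ _
  gcongr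

theorem expw_le (S : Scales C₁ δ E h e a b ν η C) {n : ℕ} (x : Rn n) :
    (S.weights n).expw h x ≤ Real.exp (maxPhase C h e a ν) :=
  Real.exp_le_exp.mpr (S.phase_le x)

theorem expw_pos (S : Scales C₁ δ E h e a b ν η C) {n : ℕ} (x : Rn n) :
    0 < (S.weights n).expw h x := Real.exp_pos _

theorem weight_sq_le (S : Scales C₁ δ E h e a b ν η C) {n : ℕ} {s : ℝ} (hs : (1 + η) / 2 ≤ s)
    (x : Rn n) : weight n s x ^ 2 ≤ (1 + ‖x‖ ^ 2 / a) ^ (-((1 + η) / 2)) := by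
  have ha := S.one_le_a
  have hη := S.η_pos
  have hr := norm_nonneg x
  have h1 : weight n s x ^ 2 = ((‖x‖ + 1) ^ 2) ^ (-s) := by
    rw [weight, ← Real.rpow_natCast, ← Real.rpow_natCast, ← Real.rpow_mul (by linarith),
      ← Real.rpow_mul (by linarith), mul_comm]
  have h2 : 1 + ‖x‖ ^ 2 / a ≤ (‖x‖ + 1) ^ 2 := by
    have : ‖x‖ ^ 2 / a ≤ ‖x‖ ^ 2 := div_le_self (by positivity) ha
    nlinarith
  rw [h1]
  calc ((‖x‖ + 1) ^ 2) ^ (-s) ≤ ((‖x‖ + 1) ^ 2) ^ (-((1 + η) / 2)) :=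
        Real.rpow_le_rpow_of_exponent_le (by nlinarith) (by linarith)
    _ ≤ _ := Real.rpow_le_rpow_of_nonpos (by positivity) h2 (by linarith)

/-- `M` does not involve the potential, so `pointwise` may be used with `v = 0`; the origin, which
it excludes, is checked directly. -/
theorem half_le_M (S : Scales C₁ δ E h e a b ν η C) {n : ℕ} (x : Rn n) :
    1 / 2 * E * ((S.weights n).m x + ‖x‖ ^ 2 * (S.weights n).m₁ x) ≤ (S.weights n).M E x := by
  rcases eq_or_ne x 0 with rfl | hx
  · have h1 := (S.weights n).m_nonneg 0
    have hE := S.E_pos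
    simp only [RadialWeights.M, norm_zero]
    have := mul_nonneg hE.le h1
    nlinarith
  · have := (S.pointwise (v := 0) (norm_pos_iff.mpr hx) (by
      have := S.C₁_pos
      rw [abs_zero]
      positivity) rfl rfl rfl rfl).2
    exact this

/-- The constant in the Carleman estimate at given length scales. -/
def bound (n : ℕ) (C₁ E h e a ν η C : ℝ) : ℝ :=
  4 * (8 * (2 * a / (η * h ^ 2) * Real.exp (maxPhase C h e a ν) ^ 2) + 1 +
    Real.exp (maxPhase C h e a ν) ^ 4 * (2 * a + 4 * n ^ 2 + 4 * (C ^ 2 * a ^ 2 / h ^ 4)) *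
      (1 + (C₁ + E + 3) / h ^ 2))

/-- A deliberately crude bound: it enters only through the residual, and powers of `a`, `1/h` and
`exp(maxPhase)` are affordable losses. -/
theorem gen_sq_le (S : Scales C₁ δ E h e a b ν η C) {n : ℕ} (hn : 3 ≤ n) {u : Rn n → ℝ}
    (hu : ContDiff ℝ 2 u) (x : Rn n) :
    ((S.weights n).m x * (S.weights n).expw h x *
      gen (fun y => (S.weights n).expw h y * u y) x) ^ 2 ≤
    Real.exp (maxPhase C h e a ν) ^ 4 * (2 * a + 4 * n ^ 2 + 4 * (C ^ 2 * a ^ 2 / h ^ 4)) *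
      (gradSq u x + u x ^ 2) := by
  have ha := S.a_pos
  have he := S.e_pos
  have hh := S.h_pos
  have hC := S.C_pos
  have hη := S.η_pos
  have hν' := S.ν_le
  set Φ := Real.exp (maxPhase C h e a ν) with hΦ
  have hΦ0 : 0 < Φ := Real.exp_pos _
  have h3 : ‖x‖ ^ 2 * (S.weights n).m x ^ 2 ≤ a := sq_mul_mul₀_le ha hη (sq_nonneg ‖x‖)
  have h4 := S.expw_le x
  have h5 := (S.expw_pos x).le
  have hm0 := (S.weights n).m_nonneg x
  have hm1 : (S.weights n).m x ≤ 1 := by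
    refine (mul₀_bounds ha hη (sq_nonneg ‖x‖)).2.trans ?_
    refine Real.rpow_le_one_of_one_le_of_nonpos ?_ (by norm_num)
    have : 0 ≤ ‖x‖ ^ 2 / a := by positivity
    linarith
  have hψ : ‖x‖ ^ 2 * (S.weights n).ψ x ^ 2 ≤ C ^ 2 * a / h ^ 2 := by
    have hp : 0 < 1 + ‖x‖ ^ 2 / e := by positivity
    have e1 : (S.weights n).ψ x = C / h * satFactor e a ν (‖x‖ ^ 2) ^ 2 *
        (1 + ‖x‖ ^ 2 / e) ^ (ν - 1) := phase₁_eq he (sq_nonneg _)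
    have hσ0 := (satFactor_pos (ν := ν) he ha (sq_nonneg ‖x‖)).le
    have hσ1 : satFactor e a ν (‖x‖ ^ 2) ^ 4 ≤ 1 :=
      pow_le_one₀ hσ0 (satFactor_le_one he ha (sq_nonneg ‖x‖))
    have e2 : ((1 + ‖x‖ ^ 2 / e) ^ (ν - 1)) ^ 2 ≤ (1 + ‖x‖ ^ 2 / e)⁻¹ := by
      rw [← Real.rpow_natCast, ← Real.rpow_mul hp.le, ← Real.rpow_neg_one]
      refine Real.rpow_le_rpow_of_exponent_le ?_ (by push_cast; linarith)
      have : 0 ≤ ‖x‖ ^ 2 / e := by positivity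
      linarith
    have e3 : ‖x‖ ^ 2 * (1 + ‖x‖ ^ 2 / e)⁻¹ ≤ a := by
      have : e ≤ a := S.e_le_b.trans S.b_le_a
      refine le_trans ?_ this
      rw [← div_eq_mul_inv, div_le_iff₀ hp]
      have : e * (1 + ‖x‖ ^ 2 / e) = e + ‖x‖ ^ 2 := by field_simp
      linarith
    calc ‖x‖ ^ 2 * (S.weights n).ψ x ^ 2 = (C / h) ^ 2 * satFactor e a ν (‖x‖ ^ 2) ^ 4 *
          (‖x‖ ^ 2 * ((1 + ‖x‖ ^ 2 / e) ^ (ν - 1)) ^ 2) := by rw [e1]; ring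
      _ ≤ (C / h) ^ 2 * 1 * (‖x‖ ^ 2 * (1 + ‖x‖ ^ 2 / e)⁻¹) := by gcongr
      _ ≤ (C / h) ^ 2 * 1 * a := by gcongr
      _ = _ := by ring
  have hgen : gen (fun y => (S.weights n).expw h y * u y) x = (S.weights n).expw h x *
      (euler u x + (((n : ℝ) - 1) / 2 + ‖x‖ ^ 2 * ((S.weights n).ψ x / h)) * u x) := by
    rw [gen, euler_radial_mul (hu.of_le (by norm_num)) ((S.weights n).hasRadialDeriv_expw h)]
    ring
  have he2 : (S.weights n).m x ^ 2 * euler u x ^ 2 ≤ a * gradSq u x := by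
    calc (S.weights n).m x ^ 2 * euler u x ^ 2 ≤
        (S.weights n).m x ^ 2 * (‖x‖ ^ 2 * gradSq u x) := by
          gcongr
          exact euler_sq_le u x
      _ = ‖x‖ ^ 2 * (S.weights n).m x ^ 2 * gradSq u x := by ring
      _ ≤ a * gradSq u x := mul_le_mul_of_nonneg_right h3 (gradSq_nonneg u x)
  have he3 : (S.weights n).m x ^ 2 *
      (((n : ℝ) - 1) / 2 + ‖x‖ ^ 2 * ((S.weights n).ψ x / h)) ^ 2 ≤
      2 * n ^ 2 + 2 * (C ^ 2 * a ^ 2 / h ^ 4) := by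
    have f1 : (S.weights n).m x ^ 2 * (((n : ℝ) - 1) / 2) ^ 2 ≤ 1 * n ^ 2 := by
      have h6 : (S.weights n).m x ^ 2 ≤ 1 := pow_le_one₀ hm0 hm1
      have h7 : (3 : ℝ) ≤ n := by exact_mod_cast hn
      have h8 : (((n : ℝ) - 1) / 2) ^ 2 ≤ (n : ℝ) ^ 2 := by
        have : 0 ≤ ((n : ℝ) - 1) / 2 := by linarith
        gcongr
        linarith
      gcongr
    have f2 : (S.weights n).m x ^ 2 * (‖x‖ ^ 2 * ((S.weights n).ψ x / h)) ^ 2 ≤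
        C ^ 2 * a ^ 2 / h ^ 4 := by
      calc (S.weights n).m x ^ 2 * (‖x‖ ^ 2 * ((S.weights n).ψ x / h)) ^ 2 =
          (‖x‖ ^ 2 * (S.weights n).m x ^ 2) * (‖x‖ ^ 2 * (S.weights n).ψ x ^ 2) / h ^ 2 := by
            field_simp
        _ ≤ a * (C ^ 2 * a / h ^ 2) / h ^ 2 := by gcongr
        _ = _ := by field_simp
    have f3 : (((n : ℝ) - 1) / 2 + ‖x‖ ^ 2 * ((S.weights n).ψ x / h)) ^ 2 ≤
        2 * (((n : ℝ) - 1) / 2) ^ 2 + 2 * (‖x‖ ^ 2 * ((S.weights n).ψ x / h)) ^ 2 := by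
      nlinarith [sq_nonneg (((n : ℝ) - 1) / 2 - ‖x‖ ^ 2 * ((S.weights n).ψ x / h))]
    have f4 := mul_le_mul_of_nonneg_left f3 (sq_nonneg ((S.weights n).m x))
    linarith
  rw [hgen]
  set q := ((n : ℝ) - 1) / 2 + ‖x‖ ^ 2 * ((S.weights n).ψ x / h)
  have hexp : (S.weights n).expw h x ^ 4 ≤ Φ ^ 4 := by gcongr
  have hsum : (S.weights n).m x ^ 2 * (euler u x + q * u x) ^ 2 ≤
      (2 * a + 4 * n ^ 2 + 4 * (C ^ 2 * a ^ 2 / h ^ 4)) * (gradSq u x + u x ^ 2) := by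
    have g1 : (euler u x + q * u x) ^ 2 ≤ 2 * euler u x ^ 2 + 2 * (q * u x) ^ 2 := by
      nlinarith [sq_nonneg (euler u x - q * u x)]
    have g2 := mul_le_mul_of_nonneg_left g1 (sq_nonneg ((S.weights n).m x))
    have g3 := mul_le_mul_of_nonneg_right he3 (sq_nonneg (u x))
    have g4 := gradSq_nonneg u x
    have g5 : 0 ≤ (4 * n ^ 2 + 4 * (C ^ 2 * a ^ 2 / h ^ 4)) * gradSq u x := by positivity
    have g6 : 0 ≤ 2 * a * u x ^ 2 := by positivity
    linarith
  calc ((S.weights n).m x * (S.weights n).expw h x *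
        ((S.weights n).expw h x * (euler u x + q * u x))) ^ 2 =
      (S.weights n).expw h x ^ 4 * ((S.weights n).m x ^ 2 * (euler u x + q * u x) ^ 2) := by ring
    _ ≤ Φ ^ 4 * ((2 * a + 4 * n ^ 2 + 4 * (C ^ 2 * a ^ 2 / h ^ 4)) *
        (gradSq u x + u x ^ 2)) := by gcongr
    _ = _ := by ring

theorem carleman (S : Scales C₁ δ E h e a b ν η C) {n : ℕ} (hn : 3 ≤ n) {s κ : ℝ}
    (hs : (1 + η) / 2 ≤ s) (hκ : 0 < κ) (hκ1 : κ ≤ 1) {u V g r : Rn n → ℝ}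
    (hV : ∀ᵐ x, |V x| ≤ C₁ * (‖x‖ + 1) ^ (-δ))
    (hu : ContDiff ℝ 2 u) (hsupp : HasCompactSupport u) (hg : MemLp g 2 volume)
    (hr : MemLp r 2 volume)
    (heq : ∀ᵐ x, -h ^ 2 * lap u x + (V x - E) * u x = weight n s x * g x + r x) :
    E * η / 4 * ∫ x, (weight n s x * u x) ^ 2 ≤ bound n C₁ E h e a ν η C *
      ((∫ x, g x ^ 2) + κ * (∫ x, u x ^ 2) + κ⁻¹ * ∫ x, r x ^ 2) := by
  have ha := S.a_pos
  have ha1 := S.one_le_a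
  have he := S.e_pos
  have hh := S.h_pos
  have hC := S.C_pos
  have hE := S.E_pos
  have hη := S.η_pos
  have hν := S.ν_ge
  have hν' := S.ν_le
  have hC₁ := S.C₁_pos
  have hs0 : 0 ≤ s := by linarith
  -- The origin is discarded as a null set, since `D` contains `|x|⁻²`.
  have hne : ∀ᵐ x : Rn n, x ≠ 0 := by
    have : Nontrivial (Rn n) := by
      have : Nonempty (Fin n) := ⟨⟨0, by omega⟩⟩
      infer_instance
    exact compl_mem_ae_iff.mpr (measure_singleton (0 : Rn n))
  set Φ := Real.exp (maxPhase C h e a ν) with hΦ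
  have hΦ0 : 0 < Φ := Real.exp_pos _
  refine (S.weights n).carleman hn (V := V) (V₀ := C₁) hh hE.le hC₁.le (by positivity)
    (K := 2 * a / (η * h ^ 2) * Φ ^ 2) (by positivity) hκ hκ1
    (L := Φ ^ 4 * (2 * a + 4 * n ^ 2 + 4 * (C ^ 2 * a ^ 2 / h ^ 4))) (by positivity)
    ?_ ?_ ?_ ?_ ?_ ?_ ?_ ?_ hu hsupp hg hr heq
  · filter_upwards [hV] with x hx
    refine hx.trans (mul_le_of_le_one_right hC₁.le ?_)
    refine Real.rpow_le_one_of_one_le_of_nonpos (by linarith [norm_nonneg x]) ?_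
    linarith [S.η_δ]
  · filter_upwards [hV, hne] with x hx hx0
    exact (S.pointwise (norm_pos_iff.mpr hx0) hx rfl rfl rfl rfl).1
  · intro x
    unfold weight
    positivity
  · intro x
    exact Real.rpow_le_one_of_one_le_of_nonpos (by linarith [norm_nonneg x]) (by linarith)
  · refine Continuous.rpow_const (by fun_prop) fun x => Or.inl ?_
    positivity
  · intro x
    have h1 := radial_ge ha hη S.η_le (sq_nonneg ‖x‖)
    have h2 := S.weight_sq_le hs x
    have h3 : E * η / 4 * weight n s x ^ 2 ≤
        1 / 2 * E * (η / 2 * (1 + ‖x‖ ^ 2 / a) ^ (-((1 + η) / 2))) := by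
      have := mul_le_mul_of_nonneg_left h2 (show 0 ≤ E * η / 4 by positivity)
      linarith
    refine h3.trans (le_trans ?_ (S.half_le_M x))
    exact mul_le_mul_of_nonneg_left h1 (by positivity)
  · filter_upwards [hne] with x hx0
    have ht : 0 < ‖x‖ ^ 2 := by have := norm_pos_iff.mpr hx0; positivity
    have h1 : η / 2 * (1 + ‖x‖ ^ 2 / a) ^ (-((1 + η) / 2)) ≤
      (S.weights n).m x + ‖x‖ ^ 2 * (S.weights n).m₁ x :=
      radial_ge ha hη S.η_le (sq_nonneg ‖x‖)
    have h2 := S.weight_sq_le hs x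
    have h3 : ‖x‖ ^ 2 * (S.weights n).m x ^ 2 ≤ a := sq_mul_mul₀_le ha hη (sq_nonneg ‖x‖)
    have h4 := S.expw_le x
    have h5 := (S.expw_pos x).le
    set μ := (S.weights n).m x + ‖x‖ ^ 2 * (S.weights n).m₁ x with hμ
    have h6 : h ^ 2 * (μ / ‖x‖ ^ 2) ≤ (S.weights n).D h x := by
      have := (S.weights n).m_nonneg x
      have := (S.weights n).ψ_nonneg x
      have h7 : 0 ≤ 4 * h * (S.weights n).ψ x * (S.weights n).m x := by positivity
      rw [RadialWeights.D]
      linarith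
    have h7 : weight n s x ^ 2 ≤ 2 / η * μ := by
      have : 2 / η * (η / 2 * (1 + ‖x‖ ^ 2 / a) ^ (-((1 + η) / 2))) =
        (1 + ‖x‖ ^ 2 / a) ^ (-((1 + η) / 2)) := by field_simp
      refine h2.trans (le_of_eq_of_le this.symm ?_)
      gcongr
    have hμ0 : 0 ≤ μ := le_trans (by positivity) h1
    calc ((S.weights n).m x * (S.weights n).expw h x * weight n s x) ^ 2 =
        (‖x‖ ^ 2 * (S.weights n).m x ^ 2) * (S.weights n).expw h x ^ 2 * weight n s x ^ 2 /
          ‖x‖ ^ 2 := by field_simp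
      _ ≤ a * Φ ^ 2 * (2 / η * μ) / ‖x‖ ^ 2 := by gcongr
      _ = 2 * a / (η * h ^ 2) * Φ ^ 2 * (h ^ 2 * (μ / ‖x‖ ^ 2)) := by field_simp
      _ ≤ _ := by gcongr
  · exact S.gen_sq_le hn hu

end Scales
end Semiclassical
end

/-! ### Choice of the scales as powers of `h`, and the resulting exponent. -/

noncomputable section
namespace Semiclassical

theorem eventually_mul_rpow_le (K : ℝ) {p c : ℝ} (hp : 0 < p) (hc : 0 < c) :
    ∀ᶠ h : ℝ in nhdsWithin 0 (Set.Ioi 0), K * h ^ p ≤ c := by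
  have h1 : Filter.Tendsto (fun h : ℝ => K * h ^ p) (nhds 0) (nhds (K * 0 ^ p)) :=
    ((Real.continuousAt_rpow_const 0 p (Or.inr hp.le)).tendsto).const_mul K
  rw [Real.zero_rpow hp.ne', mul_zero] at h1
  exact (h1.mono_left nhdsWithin_le_nhds).eventually_le_const hc

/-- From `log y ≤ y` with `y = h^(-m)`; polynomial losses in `1/h` disappear into the exponential.
-/
theorem rpow_neg_le_exp {h q m : ℝ} (hh : 0 < h) (hq : 0 ≤ q) (hm : 0 < m) :
    h ^ (-q) ≤ Real.exp (q / m * h ^ (-m)) := by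
  have h1 : h ^ (-q) = Real.exp (q / m * Real.log (h ^ (-m))) := by
    rw [Real.log_rpow hh, Real.rpow_def_of_pos hh]
    congr 1
    field_simp
  rw [h1]
  have h2 : Real.log (h ^ (-m)) ≤ h ^ (-m) :=
    (Real.log_le_sub_one_of_pos (by positivity)).trans (by linarith)
  gcongr

/-- For small `h` there are compatible length scales, given by explicit powers of `h`. -/
theorem eventually_scales {C₁ δ E η : ℝ} (hC₁ : 0 < C₁) (hδ : 1 < δ) (hδ' : δ ≤ 3) (hE : 0 < E)
    (hη : 0 < η) (hη1 : η ≤ 1) (hηδ : η ≤ δ - 1) :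
    ∀ᶠ h : ℝ in nhdsWithin 0 (Set.Ioi 0), Scales C₁ δ E h (h ^ (2 / (3 * (1 - (13 - δ) / 36))))
      (h ^ (-(18 / (5 * (δ - 1))))) (h ^ (-(16 / (5 * (δ - 1))))) ((13 - δ) / 36) η
      (1000 * (1 + C₁)) := by
  -- Affine in `δ`, from 1/3 at `δ = 1` to 5/18 at `δ = 3`.
  set ν := (13 - δ) / 36 with hν
  set C := 1000 * (1 + C₁)
  have hd : 0 < δ - 1 := by linarith
  have hν1 : 5 / 18 ≤ ν := by rw [hν]; linarith
  have hν2 : ν ≤ 1 / 3 := by rw [hν]; linarith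
  have hpe : 2 / (3 * (1 - ν)) < 2 := by rw [div_lt_iff₀ (by linarith)]; linarith
  have hpe0 : 0 < 2 / (3 * (1 - ν)) := div_pos (by norm_num) (by linarith)
  have hphase : 0 < 4 / 3 + (1 - 2 * ν) * (16 / (5 * (δ - 1))) - 2 := by
    have : (1 - 2 * ν) * (16 / (5 * (δ - 1))) = (1 - 2 * ν) * 16 / (5 * (δ - 1)) := by ring
    rw [this]
    have : 2 / 3 < (1 - 2 * ν) * 16 / (5 * (δ - 1)) := by
      rw [lt_div_iff₀ (by linarith), hν]
      linarith
    linarith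
  have hEη : 0 < E * η ^ 2 / 400 := by positivity
  filter_upwards [self_mem_nhdsWithin, eventually_mul_rpow_le 1 zero_lt_one zero_lt_one,
    eventually_mul_rpow_le 2 (show 0 < 2 / (5 * (δ - 1)) * ν by positivity)
      (show (0 : ℝ) < 1 / 100 by norm_num),
    eventually_mul_rpow_le 2000 (show 0 < 2 - 2 / (3 * (1 - ν)) by linarith) zero_lt_one,
    eventually_mul_rpow_le (2 * C₁ ^ 2) (show (0 : ℝ) < 6 / 5 by norm_num) hEη,
    eventually_mul_rpow_le (C ^ 2) hphase hEη] with h hh h1 h2 h3 h4 h5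
  have hh0 : (0 : ℝ) < h := hh
  rw [Real.rpow_one, one_mul] at h1
  have hpa : 0 < 16 / (5 * (δ - 1)) := by positivity
  have hpa' : 16 / (5 * (δ - 1)) ≤ 18 / (5 * (δ - 1)) := by gcongr; norm_num
  have hb1 : 1 ≤ h ^ (-(16 / (5 * (δ - 1)))) :=
    Real.one_le_rpow_of_pos_of_le_one_of_nonpos hh0 h1 (by linarith)
  refine ⟨hh0, by positivity, ?_, ?_, ?_, hC₁, hE, hν1, hν2, ?_, hη, hη1, hηδ, le_rfl, ?_, ?_, ?_,
    ?_, ?_⟩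
  · exact (Real.rpow_le_one hh0.le h1 hpe0.le).trans hb1
  · exact Real.rpow_le_rpow_of_exponent_ge hh0 h1 (by linarith)
  · exact Real.one_le_rpow_of_pos_of_le_one_of_nonpos hh0 h1 (by linarith)
  · rw [hν]; linarith
  · rw [← Real.rpow_sub hh0, ← Real.rpow_mul hh0.le]
    have : (-(16 / (5 * (δ - 1))) - -(18 / (5 * (δ - 1)))) * ν = 2 / (5 * (δ - 1)) * ν := by ring
    rw [this]
    exact h2
  · have e1 : h ^ 2 = h ^ (2 - 2 / (3 * (1 - ν))) * h ^ (2 / (3 * (1 - ν))) := by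
      rw [← Real.rpow_add hh0, ← Real.rpow_natCast]
      congr 1
      push_cast
      ring
    rw [e1, ← mul_assoc]
    exact mul_le_of_le_one_left (by positivity) h3
  · rw [← Real.rpow_mul hh0.le, ← Real.rpow_natCast]
    congr 1
    have : 1 - ν ≠ 0 := by linarith
    push_cast
    field_simp
  -- The exponent of `b` is chosen so that `b^(1-δ) = h^(16/5)`, which beats `h²`. The slightly
  -- larger exponent of `a` makes `b/a` tend to 0.
  · have e1 : 2 * C₁ ^ 2 * (h ^ (-(16 / (5 * (δ - 1))))) ^ (1 - δ) / h ^ 2 =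
        2 * C₁ ^ 2 * h ^ (6 / 5 : ℝ) := by
      rw [← Real.rpow_mul hh0.le, mul_div_assoc, ← Real.rpow_natCast h 2, ← Real.rpow_sub hh0]
      congr 2
      push_cast
      field_simp
      ring
    rw [e1]
    exact h4
  · have e1 : C ^ 2 * (h ^ (2 / (3 * (1 - ν)))) ^ (2 - 2 * ν) *
        (h ^ (-(16 / (5 * (δ - 1))))) ^ (2 * ν - 1) / h ^ 2 =
        C ^ 2 * h ^ (4 / 3 + (1 - 2 * ν) * (16 / (5 * (δ - 1))) - 2) := by
      rw [← Real.rpow_mul hh0.le, ← Real.rpow_mul hh0.le, mul_assoc, mul_div_assoc,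
        ← Real.rpow_natCast h 2, ← Real.rpow_add hh0, ← Real.rpow_sub hh0]
      congr 2
      have : 1 - ν ≠ 0 := by linarith
      push_cast
      field_simp
      ring
    rw [e1]
    exact h5

theorem scale_bound_le (n : ℕ) {C₁ E h e a ν η B : ℝ} (hC₁ : 0 < C₁) (hE : 0 < E) (hη : 0 < η)
    (hh : 0 < h) (h1 : h ≤ 1) (ha1 : 1 ≤ a) (hΛ : 0 ≤ Scales.maxPhase B h e a ν) :
    4 / (E * η) * Scales.bound n C₁ E h e a ν η B ≤
      4 / (E * η) * (4 * (16 / η + 1 + (2 + 4 * (n : ℝ) ^ 2 + 4 * B ^ 2) * (C₁ + E + 4))) *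
        (a ^ 2 * h⁻¹ ^ 6 * Real.exp (Scales.maxPhase B h e a ν) ^ 4) := by
  rw [Scales.bound]
  generalize Scales.maxPhase B h e a ν = Λ at *
  have hΦ1 : 1 ≤ Real.exp Λ := Real.one_le_exp hΛ
  generalize Real.exp Λ = Φ at *
  obtain ⟨y, hy⟩ : ∃ y, y = h⁻¹ := ⟨_, rfl⟩
  have hy1 : 1 ≤ y := hy ▸ (one_le_inv₀ hh).mpr h1
  rw [← hy]
  obtain ⟨Y, hY⟩ : ∃ Y, Y = a ^ 2 * y ^ 6 * Φ ^ 4 := ⟨_, rfl⟩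
  rw [← hY, mul_assoc (4 / (E * η))]
  refine mul_le_mul_of_nonneg_left ?_ (by positivity)
  rw [mul_assoc (4 : ℝ) _ Y]
  refine mul_le_mul_of_nonneg_left ?_ (by norm_num)
  have f0 : 1 ≤ Y := by
    rw [hY]
    exact one_le_mul_of_one_le_of_one_le (one_le_mul_of_one_le_of_one_le (one_le_pow₀ ha1)
      (one_le_pow₀ hy1)) (one_le_pow₀ hΦ1)
  have f1 : a * y ^ 2 * Φ ^ 2 ≤ Y := by
    rw [hY]
    have g1 : a ≤ a ^ 2 := le_self_pow₀ ha1 (by norm_num)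
    have g2 : y ^ 2 ≤ y ^ 6 := pow_le_pow_right₀ hy1 (by norm_num)
    have g3 : Φ ^ 2 ≤ Φ ^ 4 := pow_le_pow_right₀ hΦ1 (by norm_num)
    gcongr
  have f2 : 8 * (2 * a / (η * h ^ 2) * Φ ^ 2) = 16 / η * (a * y ^ 2 * Φ ^ 2) := by
    rw [hy]; field_simp; norm_num
  have f3 : 2 * a + 4 * (n : ℝ) ^ 2 + 4 * (B ^ 2 * a ^ 2 / h ^ 4) ≤
      (2 + 4 * (n : ℝ) ^ 2 + 4 * B ^ 2) * (a ^ 2 * y ^ 4) := by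
    have g1 : a ≤ a ^ 2 := le_self_pow₀ ha1 (by norm_num)
    have g2 : 1 ≤ y ^ 4 := one_le_pow₀ hy1
    have g3 : 1 ≤ a ^ 2 := one_le_pow₀ ha1
    have g4 : a ^ 2 ≤ a ^ 2 * y ^ 4 := le_mul_of_one_le_right (by positivity) g2
    have g5 : B ^ 2 * a ^ 2 / h ^ 4 = B ^ 2 * (a ^ 2 * y ^ 4) := by rw [hy]; field_simp
    have g6 : (n : ℝ) ^ 2 * 1 ≤ (n : ℝ) ^ 2 * (a ^ 2 * y ^ 4) := by
      gcongr
      linarith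
    rw [g5]
    linarith
  have f4 : 1 + (C₁ + E + 3) / h ^ 2 ≤ (C₁ + E + 4) * y ^ 2 := by
    have g1 : (C₁ + E + 3) / h ^ 2 = (C₁ + E + 3) * y ^ 2 := by rw [hy]; field_simp
    have g2 : 1 ≤ y ^ 2 := one_le_pow₀ hy1
    rw [g1]
    linarith
  calc 8 * (2 * a / (η * h ^ 2) * Φ ^ 2) + 1 +
      Φ ^ 4 * (2 * a + 4 * (n : ℝ) ^ 2 + 4 * (B ^ 2 * a ^ 2 / h ^ 4)) *
        (1 + (C₁ + E + 3) / h ^ 2) ≤ 16 / η * Y + Y +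
      Φ ^ 4 * ((2 + 4 * (n : ℝ) ^ 2 + 4 * B ^ 2) * (a ^ 2 * y ^ 4)) *
        ((C₁ + E + 4) * y ^ 2) := by
          rw [f2]
          gcongr
    _ = _ := by rw [hY]; ring

/-- The semiclassical Carleman estimate, with an exponential loss governed by a power of `h`. -/
theorem semiclassical_carleman {n : ℕ} (hn : 3 ≤ n) {C₁ δ E s : ℝ} (hC₁ : 0 < C₁) (hδ : 1 < δ)
    (hδ' : δ ≤ 3) (hE : 0 < E) (hs : 1 / 2 < s) :
    ∃ C h₀ : ℝ, 0 < C ∧ 0 < h₀ ∧ ∀ h : ℝ, 0 < h → h ≤ h₀ → h ≤ 1 ∧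
      ∀ {u V g r : Rn n → ℝ} {κ : ℝ}, 0 < κ → κ ≤ 1 →
      (∀ᵐ x, |V x| ≤ C₁ * (‖x‖ + 1) ^ (-δ)) → ContDiff ℝ 2 u → HasCompactSupport u →
      MemLp g 2 volume → MemLp r 2 volume →
      (∀ᵐ x, -h ^ 2 * lap u x + (V x - E) * u x = weight n s x * g x + r x) →
      ∫ x, (weight n s x * u x) ^ 2 ≤
        Real.exp (C * h ^ (-((2 * δ + 5) / (3 * (δ - 1))))) *
        ((∫ x, g x ^ 2) + κ * (∫ x, u x ^ 2) + κ⁻¹ * ∫ x, r x ^ 2) := by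
  -- This is where `s > 1/2` and `δ > 1` make `η` positive.
  set η := min (2 * s - 1) (min 1 (δ - 1)) with hηdef
  have hη : 0 < η := lt_min (by linarith) (lt_min one_pos (by linarith))
  have hη1 : η ≤ 1 := (min_le_right _ _).trans (min_le_left _ _)
  have hηδ : η ≤ δ - 1 := (min_le_right _ _).trans (min_le_right _ _)
  have hηs : (1 + η) / 2 ≤ s := by
    have : η ≤ 2 * s - 1 := min_le_left _ _
    linarith
  have hd : 0 < δ - 1 := by linarith
  have hev := (eventually_scales hC₁ hδ hδ' hE hη hη1 hηδ).and
    (eventually_mul_rpow_le 1 zero_lt_one zero_lt_one)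
  obtain ⟨h₀, hh₀, hsub⟩ := mem_nhdsGT_iff_exists_Ioc_subset.mp hev
  set ν := (13 - δ) / 36 with hν
  set B := 1000 * (1 + C₁) with hB
  set q := (2 * δ + 5) / (3 * (δ - 1)) with hq
  set pa := 18 / (5 * (δ - 1)) with hpa
  have hν1 : 5 / 18 ≤ ν := by rw [hν]; linarith
  have hν2 : ν ≤ 1 / 3 := by rw [hν]; linarith
  have hq0 : 0 < q := by positivity
  have hpa0 : 0 < pa := by positivity
  have hB0 : 0 < B := by positivity
  set K₀ := 4 / (E * η) * (4 * (16 / η + 1 + (2 + 4 * (n : ℝ) ^ 2 + 4 * B ^ 2) * (C₁ + E + 4)))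
    with hK₀
  have hK₀0 : 0 < K₀ := by positivity
  refine ⟨K₀ + (4 * (B / (2 * ν)) + (2 * pa + 6) / q), h₀, by positivity, hh₀, ?_⟩
  intro h hh hle
  obtain ⟨S, h1⟩ := hsub ⟨hh, hle⟩
  rw [Real.rpow_one, one_mul] at h1
  refine ⟨h1, ?_⟩
  intro u V g r κ hκ hκ1 hV hu hsupp hg hr heq
  set e := h ^ (2 / (3 * (1 - ν)))
  set a := h ^ (-pa) with ha
  set Z := h ^ (-q) with hZ
  have hZ1 : 1 ≤ Z := Real.one_le_rpow_of_pos_of_le_one_of_nonpos hh h1 (by linarith)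
  have hmain := S.carleman hn hηs hκ hκ1 hV hu hsupp hg hr heq
  set Λ := Scales.maxPhase B h e a ν with hΛ
  have hΛZ : Λ ≤ B / (2 * ν) * Z := by
    have e1 : Λ = B / (2 * ν) * h ^ (2 / 3 - pa * ν - 2) := by
      have : 1 - ν ≠ 0 := by linarith
      rw [hΛ, Scales.maxPhase, ← Real.rpow_mul hh.le, ha, ← Real.rpow_mul hh.le, mul_assoc,
        ← Real.rpow_add hh, mul_div_mul_comm, ← Real.rpow_natCast h 2, ← Real.rpow_sub hh]
      congr 2
      push_cast
      field_simp
      ring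
    rw [e1]
    refine mul_le_mul_of_nonneg_left ?_ (by positivity)
    refine Real.rpow_le_rpow_of_exponent_ge hh h1 ?_
    have e2 : pa * ν = (13 - δ) / 10 / (δ - 1) := by rw [hpa, hν]; field_simp; ring
    have e3 : q = (9 - 2 * δ) / 3 / (δ - 1) + 4 / 3 := by rw [hq]; field_simp; ring
    -- Equivalent to `δ ≤ 3`, with equality at 3: the exponent of the maximal phase does not exceed
    -- `q`.
    have e4 : (13 - δ) / 10 / (δ - 1) ≤ (9 - 2 * δ) / 3 / (δ - 1) :=
      div_le_div_of_nonneg_right (by linarith) hd.le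
    rw [e2, e3]
    linarith
  have hΛ0 : 0 ≤ Λ := by
    rw [hΛ, Scales.maxPhase]
    positivity
  set Φ := Real.exp Λ with hΦ
  have hΦ1 : 1 ≤ Φ := Real.one_le_exp hΛ0
  have ha1 : 1 ≤ a := S.one_le_a
  set y := h⁻¹ with hy
  have hy1 : 1 ≤ y := (one_le_inv₀ hh).mpr h1
  set Y := a ^ 2 * y ^ 6 * Φ ^ 4 with hY
  have hYexp : Y ≤ Real.exp ((4 * (B / (2 * ν)) + (2 * pa + 6) / q) * Z) := by
    have e1 : a ^ 2 * y ^ 6 = h ^ (-(2 * pa + 6)) := by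
      rw [ha, hy, ← Real.rpow_natCast, ← Real.rpow_mul hh.le, ← Real.rpow_neg_one,
        ← Real.rpow_natCast, ← Real.rpow_mul hh.le, ← Real.rpow_add hh]
      congr 1
      push_cast
      ring
    have e2 : Φ ^ 4 = Real.exp (4 * Λ) := by rw [hΦ, ← Real.exp_nat_mul]; norm_num
    have e3 := rpow_neg_le_exp hh (show 0 ≤ 2 * pa + 6 by positivity) hq0
    have e4 : Real.exp (4 * Λ) ≤ Real.exp (4 * (B / (2 * ν)) * Z) :=
      Real.exp_le_exp.mpr (by linarith)
    rw [hY, e1, e2, add_comm (4 * (B / (2 * ν))), add_mul, Real.exp_add]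
    exact mul_le_mul e3 e4 (by positivity) (by positivity)
  have hbound := scale_bound_le n hC₁ hE hη hh h1 ha1 (ν := ν) (B := B) hΛ0
  have hfin : 4 / (E * η) * Scales.bound n C₁ E h e a ν η B ≤
      Real.exp ((K₀ + (4 * (B / (2 * ν)) + (2 * pa + 6) / q)) * Z) := by
    refine hbound.trans ?_
    rw [add_mul K₀, Real.exp_add]
    refine mul_le_mul ?_ hYexp (by positivity) (by positivity)
    calc K₀ ≤ K₀ * Z := le_mul_of_one_le_right hK₀0.le hZ1
      _ ≤ Real.exp (K₀ * Z) := by linarith [Real.add_one_le_exp (K₀ * Z)]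
  set T := (∫ x, g x ^ 2) + κ * (∫ x, u x ^ 2) + κ⁻¹ * ∫ x, r x ^ 2 with hT
  have hT0 : 0 ≤ T := by
    have i1 : 0 ≤ ∫ x, g x ^ 2 := integral_nonneg fun x => sq_nonneg _
    have i2 : 0 ≤ ∫ x, u x ^ 2 := integral_nonneg fun x => sq_nonneg _
    have i3 : 0 ≤ ∫ x, r x ^ 2 := integral_nonneg fun x => sq_nonneg _
    positivity
  refine le_trans ?_ (mul_le_mul_of_nonneg_right hfin hT0)
  have h5 := mul_le_mul_of_nonneg_left hmain (show 0 ≤ 4 / (E * η) by positivity)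
  have h6 : 4 / (E * η) * (E * η / 4 * ∫ x, (weight n s x * u x) ^ 2) =
      ∫ x, (weight n s x * u x) ^ 2 := by field_simp
  rw [h6] at h5
  linarith

end Semiclassical
end

/-! ### Resolvents of self-adjoint operators, and the Laplacian through the Bessel operator. -/

noncomputable section
namespace Semiclassical

open scoped InnerProductSpace

section Abstract

variable {H : Type*} [NormedAddCommGroup H] [InnerProductSpace ℂ H]

/-- A symmetric surjective operator is self-adjoint: a weak solution lies in the domain. -/
theorem mem_domain_of_weak {D : Submodule ℂ H} {A : D →ₗ[ℂ] H}
    (hsymm : ∀ u v : D, ⟪A u, (v : H)⟫_ℂ = ⟪(u : H), A v⟫_ℂ)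
    (hsurj : ∀ g, ∃ u : D, A u = g) {w g : H}
    (h : ∀ v : D, ⟪w, A v⟫_ℂ = ⟪g, (v : H)⟫_ℂ) : ∃ hw : w ∈ D, A ⟨w, hw⟩ = g := by
  obtain ⟨u, hu⟩ := hsurj g
  have h1 : w = u := by
    refine ext_inner_right ℂ fun f => ?_
    obtain ⟨v, hv⟩ := hsurj f
    rw [← hv, h, ← hu, hsymm]
  subst h1
  exact ⟨u.2, hu⟩

theorem im_inner_self_of_symmetric {A : H →ₗ.[ℂ] H}
    (hsymm : ∀ u v : A.domain, ⟪A u, (v : H)⟫_ℂ = ⟪(u : H), A v⟫_ℂ) (z : ℂ) (u : A.domain) :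
    (⟪(u : H), A u - z • (u : H)⟫_ℂ).im = -z.im * ‖(u : H)‖ ^ 2 := by
  have h1 : (⟪(u : H), A u⟫_ℂ).im = 0 := by
    have h2 := congrArg Complex.im (inner_conj_symm (𝕜 := ℂ) (u : H) (A u))
    rw [hsymm, Complex.conj_im] at h2
    linarith
  rw [inner_sub_right, inner_smul_right, Complex.sub_im, h1, inner_self_eq_norm_sq_to_K]
  simp [← Complex.ofReal_pow]

theorem norm_le_of_symmetric {A : H →ₗ.[ℂ] H}
    (hsymm : ∀ u v : A.domain, ⟪A u, (v : H)⟫_ℂ = ⟪(u : H), A v⟫_ℂ) (z : ℂ) (u : A.domain) :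
    |z.im| * ‖(u : H)‖ ≤ ‖A u - z • (u : H)‖ := by
  rcases (norm_nonneg (u : H)).eq_or_lt' with h0 | h0
  · rw [h0, mul_zero]; positivity
  have h1 := im_inner_self_of_symmetric hsymm z u
  have h2 : |(⟪(u : H), A u - z • (u : H)⟫_ℂ).im| ≤ ‖(u : H)‖ * ‖A u - z • (u : H)‖ :=
    (Complex.abs_im_le_norm _).trans (norm_inner_le_norm _ _)
  rw [h1, abs_mul, abs_neg, abs_of_nonneg (sq_nonneg ‖(u : H)‖)] at h2
  nlinarith

variable [CompleteSpace H]

/-- The resolvent of an operator whose weak solutions are solutions exists off the real axis. -/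
theorem exists_isResolvent {A : H →ₗ.[ℂ] H}
    (hsymm : ∀ u v : A.domain, ⟪A u, (v : H)⟫_ℂ = ⟪(u : H), A v⟫_ℂ)
    (hself : ∀ w g : H, (∀ v : A.domain, ⟪w, A v⟫_ℂ = ⟪g, (v : H)⟫_ℂ) →
      ∃ hw : w ∈ A.domain, A ⟨w, hw⟩ = g) {z : ℂ} (hz : z.im ≠ 0) :
    ∃ R : H →L[ℂ] H, IsResolvent A z R := by
  have hz' : 0 < |z.im| := abs_pos.mpr hz
  set T : A.domain →ₗ[ℂ] H := A.toFun - z • A.domain.subtype with hT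
  have hTa : ∀ u, T u = A u - z • (u : H) := fun u => rfl
  have hbd : ∀ u : A.domain, |z.im| * ‖(u : H)‖ ≤ ‖T u‖ := fun u => norm_le_of_symmetric hsymm z u
  have hinj : Function.Injective T := by
    rw [← LinearMap.ker_eq_bot, LinearMap.ker_eq_bot']
    intro u hu
    have h1 := hbd u
    rw [hu, norm_zero] at h1
    have h2 : ‖(u : H)‖ = 0 := by nlinarith [norm_nonneg (u : H)]
    exact Subtype.ext (norm_eq_zero.mp h2)
  -- The lower bound makes preimages of a convergent sequence Cauchy; their limit is a weak
  -- solution, hence a solution.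
  have hclosed : IsClosed (LinearMap.range T : Set H) := by
    rw [← isSeqClosed_iff_isClosed]
    intro f g hf hfg
    choose u hu using hf
    have hc : CauchySeq fun k => (u k : H) := by
      rw [Metric.cauchySeq_iff']
      intro ε hε
      obtain ⟨N, hN⟩ := Metric.cauchySeq_iff'.mp hfg.cauchySeq (|z.im| * ε) (by positivity)
      refine ⟨N, fun k hk => ?_⟩
      have h1 := hN k hk
      have h2 := hbd (u k - u N)
      rw [map_sub, hu, hu, ← dist_eq_norm, Submodule.coe_sub, ← dist_eq_norm] at h2
      nlinarith
    obtain ⟨w, hw⟩ := cauchySeq_tendsto_of_complete hc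
    have hAu : ∀ k, A (u k) = f k + z • (u k : H) := fun k => by
      rw [← hu k, hTa, sub_add_cancel]
    obtain ⟨hw', hA⟩ := hself w (g + z • w) fun v => by
      have t1 : Filter.Tendsto (fun k => ⟪(u k : H), A v⟫_ℂ) Filter.atTop (nhds ⟪w, A v⟫_ℂ) :=
        hw.inner tendsto_const_nhds
      have t2 : Filter.Tendsto (fun k => ⟪f k + z • (u k : H), (v : H)⟫_ℂ) Filter.atTop
          (nhds ⟪g + z • w, (v : H)⟫_ℂ) := (hfg.add (hw.const_smul z)).inner tendsto_const_nhds
      refine tendsto_nhds_unique t1 (t2.congr fun k => ?_)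
      rw [← hAu, hsymm]
    exact ⟨⟨w, hw'⟩, by rw [hTa, hA, add_sub_cancel_right]⟩
  -- A vector orthogonal to the range is a weak eigenvector for the conjugate of `z`, and the lower
  -- bound forces it to vanish.
  have hsurj : LinearMap.range T = ⊤ := by
    have : (LinearMap.range T).topologicalClosure = LinearMap.range T :=
      hclosed.submodule_topologicalClosure_eq
    rw [← this, Submodule.topologicalClosure_eq_top_iff, Submodule.eq_bot_iff]
    intro w hw
    have hw1 : ∀ v : A.domain, ⟪w, T v⟫_ℂ = 0 := fun v =>
      (Submodule.mem_orthogonal' _ _).mp hw _ ⟨v, rfl⟩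
    obtain ⟨hw', hA⟩ := hself w ((starRingEnd ℂ) z • w) fun v => by
      have := hw1 v
      rw [hTa, inner_sub_right, inner_smul_right, sub_eq_zero] at this
      rw [this, inner_smul_left, Complex.conj_conj]
    have h1 := norm_le_of_symmetric hsymm ((starRingEnd ℂ) z) ⟨w, hw'⟩
    rw [hA, sub_self, norm_zero, Complex.conj_im, abs_neg] at h1
    have h2 : ‖w‖ = 0 := by nlinarith [norm_nonneg w]
    exact norm_eq_zero.mp h2
  set e := LinearEquiv.ofBijective T ⟨hinj, LinearMap.range_eq_top.mp hsurj⟩ with he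
  have hTe : ∀ g, T (e.symm g) = g := fun g => e.apply_symm_apply g
  refine ⟨(A.domain.subtype ∘ₗ (e.symm : H →ₗ[ℂ] A.domain)).mkContinuous |z.im|⁻¹ fun g => ?_,
    fun g => ⟨(e.symm g).2, hTe g⟩, fun f => ?_⟩
  · have := hbd (e.symm g)
    rw [hTe] at this
    rw [inv_mul_eq_div, le_div_iff₀ hz', mul_comm]
    exact this
  · change ((e.symm (T f) : A.domain) : H) = f
    rw [show T f = e f from rfl, e.symm_apply_apply]

end Abstract

section Bessel

variable {n : ℕ}

open scoped FourierTransform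

/-- The Fourier transform has kernel `exp(-2πi x·ξ)`, so `|ξ|²` corresponds to `-(2π)⁻²Δ`. -/
theorem besselPotential_two_eq (f : TemperedDistribution (Rn n) ℂ) :
    besselPotential (Rn n) ℂ 2 f = f - (((2 * Real.pi) ^ 2)⁻¹ : ℝ) • Δ f := by
  have h1 : (fun x : Rn n => (((1 + ‖x‖ ^ 2) ^ (2 / 2 : ℝ) : ℝ) : ℂ)) =
      fun x => ∑ i : Bool, (bif i then (fun _ => (1 : ℂ)) else
        fun x : Rn n => Complex.ofReal (‖x‖ ^ 2)) x := by
    ext x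
    simp
  rw [besselPotential, h1, fourierMultiplierCLM_sum ℂ, Fintype.sum_bool,
    laplacian_eq_fourierMultiplierCLM, smul_smul]
  · have : (((2 * Real.pi) ^ 2)⁻¹ * -(2 * Real.pi) ^ 2 : ℝ) = -1 := by
      field_simp
    rw [this]
    simp
  · intro i _
    cases i
    · change Function.HasTemperateGrowth fun x : Rn n => Complex.ofReal (‖x‖ ^ 2)
      fun_prop
    · change Function.HasTemperateGrowth fun x : Rn n => (1 : ℂ)
      fun_prop

theorem exists_besselPotential_neg_two (g : L2 n) : ∃ u : (laplacian n).domain,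
    Lp.toTemperedDistribution (u : L2 n) =
      besselPotential (Rn n) ℂ (-2) (Lp.toTemperedDistribution g) := by
  have h1 : MemSobolev 2 2 (besselPotential (Rn n) ℂ (-2) (Lp.toTemperedDistribution g)) :=
    ⟨g, by rw [besselPotential_besselPotential_apply]; simp⟩
  obtain ⟨u, hu⟩ := memSobolev_zero_iff.mp (h1.mono (s' := 0) (by norm_num))
  exact ⟨⟨u, mem_H2_iff.mpr (hu ▸ h1)⟩, hu.symm⟩

/-- The operator `1 - (2π)⁻² Δ` on `L²` with domain `H²`. -/
def bessel (n : ℕ) : (laplacian n).domain →ₗ[ℂ] L2 n :=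
  (laplacian n).domain.subtype - (((2 * Real.pi) ^ 2)⁻¹ : ℝ) • (laplacian n).toFun

theorem bessel_apply (u : (laplacian n).domain) :
    bessel n u = (u : L2 n) - (((2 * Real.pi) ^ 2)⁻¹ : ℝ) • laplacian n u := rfl

theorem bessel_spec (u : (laplacian n).domain) : Lp.toTemperedDistribution (bessel n u) =
    besselPotential (Rn n) ℂ 2 (Lp.toTemperedDistribution (u : L2 n)) := by
  rw [bessel_apply, besselPotential_two_eq, ← laplacian_spec]
  simp only [← Lp.toTemperedDistributionCLM_apply, map_sub]
  congr 1
  exact ContinuousLinearMap.map_smul_of_tower _ _ _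

theorem bessel_eq_of_eq {u : (laplacian n).domain} {g : L2 n}
    (h : Lp.toTemperedDistribution (u : L2 n) =
    besselPotential (Rn n) ℂ (-2) (Lp.toTemperedDistribution g)) : bessel n u = g := by
  apply toTemperedDistribution_inj
  rw [bessel_spec, h, besselPotential_besselPotential_apply]
  simp

theorem bessel_surjective (g : L2 n) : ∃ u : (laplacian n).domain, bessel n u = g := by
  obtain ⟨u, hu⟩ := exists_besselPotential_neg_two g
  exact ⟨u, bessel_eq_of_eq hu⟩

theorem eq_besselPotential_neg_two (u : (laplacian n).domain) :
    Lp.toTemperedDistribution (u : L2 n) = besselPotential (Rn n) ℂ (-2) (Lp.toTemperedDistribution (bessel n u)) := by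
  rw [bessel_spec, besselPotential_besselPotential_apply]
  simp

/-- Stated with the bounded inverse symbol, so that it is an identity in `L²`; symmetry of `bessel`
and `‖u‖ ≤ ‖bessel u‖` then follow from Plancherel. -/
theorem fourier_ae_eq (u : (laplacian n).domain) : (𝓕 (u : L2 n) : L2 n) =ᵐ[volume]
    fun ξ => (((1 + ‖ξ‖ ^ 2)⁻¹ : ℝ) : ℂ) * (𝓕 (bessel n u) : L2 n) ξ := by
  have hb : ∀ ξ : Rn n, (1 + ‖ξ‖ ^ 2)⁻¹ ≤ 1 := fun ξ =>
    inv_le_one_of_one_le₀ (by nlinarith [sq_nonneg ‖ξ‖])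
  have hm : MemLp (fun ξ : Rn n => (((1 + ‖ξ‖ ^ 2) ^ (-2 / 2 : ℝ) : ℝ) : ℂ)) ∞ volume := by
    refine memLp_top_of_bound (C := 1) ?_ (Filter.Eventually.of_forall fun ξ => ?_)
    · have : Function.HasTemperateGrowth
        (fun ξ : Rn n => (((1 + ‖ξ‖ ^ 2) ^ (-2 / 2 : ℝ) : ℝ) : ℂ)) := by fun_prop
      exact this.1.continuous.aestronglyMeasurable
    · rw [Complex.norm_real, Real.norm_of_nonneg (by positivity)]
      norm_num
      rw [Real.rpow_neg_one]
      exact hb ξ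
  have h1 : 𝓕 (u : L2 n) = (hm.toLp _ • 𝓕 (bessel n u) : L2 n) := by
    apply toTemperedDistribution_inj
    rw [Lp.toTemperedDistribution_smul_eq (by fun_prop), ← Lp.fourier_toTemperedDistribution_eq,
      ← Lp.fourier_toTemperedDistribution_eq, eq_besselPotential_neg_two u,
      fourier_besselPotential_eq_smulLeftCLM_fourier_apply]
  rw [h1]
  filter_upwards [Lp.coeFn_lpSMul (r := 2) (hm.toLp _) (𝓕 (bessel n u)), hm.coeFn_toLp] with ξ h2 h3
  rw [h2, Pi.smul_apply', h3, smul_eq_mul, show (-2 / 2 : ℝ) = -1 by norm_num,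
    Real.rpow_neg_one]

theorem bessel_symmetric (u v : (laplacian n).domain) :
    ⟪bessel n u, (v : L2 n)⟫_ℂ = ⟪(u : L2 n), bessel n v⟫_ℂ := by
  rw [← Lp.inner_fourier_eq, ← Lp.inner_fourier_eq (u : L2 n), L2.inner_def, L2.inner_def]
  refine integral_congr_ae ?_
  filter_upwards [fourier_ae_eq u, fourier_ae_eq v] with ξ hu hv
  rw [hu, hv]
  simp
  ring

theorem norm_le_norm_bessel (u : (laplacian n).domain) : ‖(u : L2 n)‖ ≤ ‖bessel n u‖ := by
  rw [← Lp.norm_fourier_eq, ← Lp.norm_fourier_eq (bessel n u)]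
  refine Lp.norm_le_norm_of_ae_le ?_
  filter_upwards [fourier_ae_eq u] with ξ hu
  rw [hu, norm_mul, Complex.norm_real, Real.norm_of_nonneg (by positivity)]
  refine mul_le_of_le_one_left (norm_nonneg _) ?_
  exact inv_le_one_of_one_le₀ (by nlinarith [sq_nonneg ‖ξ‖])

end Bessel

end Semiclassical
end

/-! ### Self-adjointness of the Schrödinger operator, and cutoff functions. -/

noncomputable section
namespace Semiclassical

open scoped InnerProductSpace

variable {n : ℕ}

theorem mulOp_symmetric {w : Rn n → ℝ} (hw : MemLp w ∞ volume) (f g : L2 n) :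
    ⟪mulOp hw f, g⟫_ℂ = ⟪f, mulOp hw g⟫_ℂ := by
  rw [L2.inner_def, L2.inner_def]
  refine integral_congr_ae ?_
  filter_upwards [mulOp_ae hw f, mulOp_ae hw g] with x h1 h2
  rw [h1, h2]
  simp
  ring

theorem laplacian_eq_bessel (u : (laplacian n).domain) :
    laplacian n u = (((2 * Real.pi) ^ 2 : ℝ) : ℂ) • ((u : L2 n) - bessel n u) := by
  rw [bessel_apply, sub_sub_cancel, Complex.coe_smul]
  exact (smul_inv_smul₀ (by positivity) (laplacian n u)).symm

theorem schrodinger_eq_bessel (h : ℝ) {V : Rn n → ℝ} (hV : MemLp V ∞ volume)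
    (u : (laplacian n).domain) : schrodinger h hV u =
      ((h ^ 2 * (2 * Real.pi) ^ 2 : ℝ) : ℂ) • (bessel n u - u) + mulOp hV (u : L2 n) := by
  rw [schrodinger_apply, laplacian_eq_bessel, ← smul_neg, ← smul_neg, neg_sub, smul_smul]
  push_cast
  rfl

theorem schrodinger_symmetric (h : ℝ) {V : Rn n → ℝ} (hV : MemLp V ∞ volume)
    (u v : (laplacian n).domain) :
    ⟪schrodinger h hV u, (v : L2 n)⟫_ℂ = ⟪(u : L2 n), schrodinger h hV v⟫_ℂ := by
  rw [schrodinger_eq_bessel, schrodinger_eq_bessel, inner_add_left, inner_add_right,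
    mulOp_symmetric, inner_smul_left, inner_smul_right, inner_sub_left, inner_sub_right,
    bessel_symmetric, Complex.conj_ofReal]

/-- The operator is a nonzero real multiple of `bessel` plus a bounded symmetric operator. Moving
the bounded part to the right-hand side reduces the claim to `mem_domain_of_weak`. -/
theorem schrodinger_mem_domain_of_weak {h : ℝ} (hh : 0 < h) {V : Rn n → ℝ} (hV : MemLp V ∞ volume)
    (w g : L2 n) (hw : ∀ v : (laplacian n).domain,
      ⟪w, schrodinger h hV v⟫_ℂ = ⟪g, (v : L2 n)⟫_ℂ) :
    ∃ hw : w ∈ (laplacian n).domain,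
      schrodinger h hV (⟨w, hw⟩ : (laplacian n).domain) = g := by
  set c : ℝ := h ^ 2 * (2 * Real.pi) ^ 2 with hc
  have hc0 : (c : ℂ) ≠ 0 := by
    rw [Complex.ofReal_ne_zero, hc]
    positivity
  obtain ⟨hw', hJ⟩ := mem_domain_of_weak bessel_symmetric bessel_surjective
      (w := w) (g := ((c : ℂ)⁻¹) • (g - mulOp hV w) + w) fun v => by
    have h1 := hw v
    rw [schrodinger_eq_bessel, ← hc, inner_add_right, inner_smul_right, inner_sub_right,
      ← mulOp_symmetric] at h1
    rw [inner_add_left, inner_smul_left, inner_sub_left, ← h1, ← Complex.ofReal_inv,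
      Complex.conj_ofReal, Complex.ofReal_inv]
    field_simp
    ring
  refine ⟨hw', ?_⟩
  rw [schrodinger_eq_bessel, ← hc, hJ, add_sub_cancel_right, smul_inv_smul₀ hc0,
    sub_add_cancel]

theorem exists_resolvent_schrodinger {h : ℝ} (hh : 0 < h) {V : Rn n → ℝ} (hV : MemLp V ∞ volume)
    {z : ℂ} (hz : z.im ≠ 0) : ∃ R : L2 n →L[ℂ] L2 n, IsResolvent (schrodinger h hV) z R :=
  exists_isResolvent (schrodinger_symmetric h hV) (schrodinger_mem_domain_of_weak hh hV) hz

section Cutoff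

theorem hasDerivAt_max_zero_pow (k : ℕ) (t : ℝ) :
    HasDerivAt (fun s : ℝ => max s 0 ^ (k + 2)) ((k + 2) * max t 0 ^ (k + 1)) t := by
  have hp : ∀ t : ℝ, HasDerivAt (fun s : ℝ => s ^ (k + 2)) ((k + 2) * t ^ (k + 1)) t := fun t => by
    simpa using hasDerivAt_pow (k + 2) t
  rcases lt_trichotomy t 0 with h | h | h
  · rw [max_eq_right h.le, zero_pow (by omega), mul_zero]
    refine (hasDerivAt_const t (0 : ℝ)).congr_of_eventuallyEq ?_
    filter_upwards [Iio_mem_nhds h] with s hs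
    rw [max_eq_right (le_of_lt hs), zero_pow (by omega)]
  · subst h
    have h1 : HasDerivWithinAt (fun s : ℝ => max s 0 ^ (k + 2)) 0 (Set.Iic 0) 0 :=
      (hasDerivWithinAt_const (0 : ℝ) (Set.Iic 0) (0 : ℝ)).congr
        (fun s hs => by rw [max_eq_right hs, zero_pow (by omega)]) (by simp)
    have h2 : HasDerivWithinAt (fun s : ℝ => max s 0 ^ (k + 2)) 0 (Set.Ici 0) 0 := by
      have := (hp 0).hasDerivWithinAt (s := Set.Ici 0)
      rw [zero_pow (by omega), mul_zero] at this
      exact this.congr (fun s hs => by rw [max_eq_left hs]) (by simp)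
    have h3 := h1.union h2
    rw [Set.Iic_union_Ici, hasDerivWithinAt_univ] at h3
    simpa using h3
  · rw [max_eq_left h.le]
    refine (hp t).congr_of_eventuallyEq ?_
    filter_upwards [Ioi_mem_nhds h] with s hs
    rw [max_eq_left (le_of_lt hs)]

theorem hasRadialDeriv_max_zero_pow (n k : ℕ) (c : ℝ) :
    HasRadialDeriv (fun x : Rn n => max (1 - c * ‖x‖ ^ 2) 0 ^ (k + 2))
      (fun x => -(2 * (k + 2) * c) * max (1 - c * ‖x‖ ^ 2) 0 ^ (k + 1)) := by
  intro x
  have h1 : HasFDerivAt (fun x : Rn n => 1 - c * ‖x‖ ^ 2) (-(c • (2 • innerSL ℝ x))) x :=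
    ((hasStrictFDerivAt_norm_sq x).hasFDerivAt.const_mul c).const_sub 1
  refine ((hasDerivAt_max_zero_pow k _).comp_hasFDerivAt x h1).congr_fderiv ?_
  ext y
  simp
  ring

/-- A `C²` function with compact support that tends to `1` as `c → 0`. -/
def cutoff (n : ℕ) (c : ℝ) : Rn n → ℝ := fun x => max (1 - c * ‖x‖ ^ 2) 0 ^ 3

/-- The radial derivative coefficient of `cutoff`. -/
def cutoff₁ (n : ℕ) (c : ℝ) : Rn n → ℝ := fun x => -(6 * c) * max (1 - c * ‖x‖ ^ 2) 0 ^ 2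

/-- The radial derivative coefficient of `cutoff₁`. -/
def cutoff₂ (n : ℕ) (c : ℝ) : Rn n → ℝ := fun x => 24 * c ^ 2 * max (1 - c * ‖x‖ ^ 2) 0

theorem cutoff_radial (n : ℕ) (c : ℝ) : HasRadialDeriv (cutoff n c) (cutoff₁ n c) := by
  intro x
  refine (hasRadialDeriv_max_zero_pow n 1 c x).congr_fderiv ?_
  ext y
  simp [cutoff₁]
  ring_nf
  simp

theorem cutoff₁_radial (n : ℕ) (c : ℝ) : HasRadialDeriv (cutoff₁ n c) (cutoff₂ n c) := by
  intro x
  refine ((hasRadialDeriv_max_zero_pow n 0 c x).const_mul (-(6 * c))).congr_fderiv ?_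
  ext y
  simp [cutoff₂]
  ring

/-- The cube is the lowest natural power of the positive part that is `C²`. -/
theorem contDiff_cutoff (n : ℕ) (c : ℝ) : ContDiff ℝ 2 (cutoff n c) :=
  (cutoff_radial n c).contDiff_two (cutoff₁_radial n c) (by unfold cutoff₂; fun_prop)

theorem cutoff_eq_zero {c : ℝ} (hc : 0 < c) {x : Rn n} (hx : c⁻¹ ≤ ‖x‖ ^ 2) :
    max (1 - c * ‖x‖ ^ 2) 0 = 0 := by
  refine max_eq_right ?_
  rw [inv_le_iff_one_le_mul₀ hc] at hx
  linarith

theorem hasCompactSupport_cutoff {c : ℝ} (hc : 0 < c) : HasCompactSupport (cutoff n c) := by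
  refine HasCompactSupport.intro (isCompact_closedBall (0 : Rn n) (Real.sqrt c⁻¹)) fun x hx => ?_
  rw [mem_closedBall_zero_iff, not_le] at hx
  rw [cutoff, cutoff_eq_zero hc ((Real.sqrt_le_left (norm_nonneg x)).mp hx.le)]
  norm_num

/-- All cutoff errors are `O(c)` at the cost of at most `|x|²`, which Schwartz decay absorbs. -/
theorem abs_cutoff_sub_one_le {c : ℝ} (hc : 0 < c) (x : Rn n) :
    |cutoff n c x - 1| ≤ 3 * c * ‖x‖ ^ 2 := by
  have h0 : 0 ≤ c * ‖x‖ ^ 2 := by positivity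
  rw [cutoff, abs_le]
  rcases le_total 0 (1 - c * ‖x‖ ^ 2) with h | h
  · rw [max_eq_left h]
    constructor <;> nlinarith [mul_nonneg h0 h0, mul_nonneg (mul_nonneg h0 h0) h]
  · rw [max_eq_right h]
    constructor <;> linarith

theorem abs_cutoff₁_le {c : ℝ} (hc : 0 < c) (x : Rn n) : |cutoff₁ n c x| ≤ 6 * c := by
  have h0 : max (1 - c * ‖x‖ ^ 2) 0 ≤ 1 :=
    max_le (by linarith [show 0 ≤ c * ‖x‖ ^ 2 by positivity]) zero_le_one
  rw [cutoff₁, abs_mul, abs_neg, abs_of_pos (by positivity), abs_of_nonneg (by positivity)]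
  exact mul_le_of_le_one_right (by positivity) (pow_le_one₀ (le_max_right _ _) h0)

theorem abs_sq_mul_cutoff₂_le {c : ℝ} (hc : 0 < c) (x : Rn n) :
    |‖x‖ ^ 2 * cutoff₂ n c x| ≤ 24 * c := by
  have h0 : 0 ≤ c * ‖x‖ ^ 2 := by positivity
  rw [cutoff₂, abs_of_nonneg (by positivity)]
  rcases le_total 0 (1 - c * ‖x‖ ^ 2) with h | h
  · rw [max_eq_left h]
    nlinarith [mul_nonneg (mul_nonneg h0 h0) hc.le, mul_nonneg h hc.le]
  · rw [max_eq_right h]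
    linarith

end Cutoff

end Semiclassical
end

/-! ### Density of compactly supported `C²` functions in the graph norm. -/

noncomputable section
namespace Semiclassical

open scoped SchwartzMap LineDeriv

variable {n : ℕ}

theorem toLp_mem_domain (φ : 𝓢(Rn n, ℂ)) : φ.toLp 2 volume ∈ (laplacian n).domain := by
  refine mem_H2_iff.mpr ?_
  rw [Lp.toTemperedDistribution_toLp_eq]
  exact φ.memSobolev

theorem laplacian_toLp (φ : 𝓢(Rn n, ℂ)) :
    laplacian n ⟨φ.toLp 2 volume, toLp_mem_domain φ⟩ = (Δ φ : 𝓢(Rn n, ℂ)).toLp 2 volume := by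
  apply toTemperedDistribution_inj
  rw [laplacian_spec, Lp.toTemperedDistribution_toLp_eq, Lp.toTemperedDistribution_toLp_eq,
    laplacian_toTemperedDistributionCLM_eq]

/-- The inverse symbol has temperate growth, so the inverse of `bessel` preserves Schwartz
functions. Density of these in `L²` thus lifts to the graph norm. -/
theorem exists_bessel_toLp_eq (ψ : 𝓢(Rn n, ℂ)) :
    ∃ φ : 𝓢(Rn n, ℂ), bessel n ⟨φ.toLp 2 volume, toLp_mem_domain φ⟩ = ψ.toLp 2 volume := by
  refine ⟨SchwartzMap.fourierMultiplierCLM ℂ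
    (fun x : Rn n => (((1 + ‖x‖ ^ 2) ^ (-2 / 2 : ℝ) : ℝ) : ℂ)) ψ, bessel_eq_of_eq ?_⟩
  rw [Lp.toTemperedDistribution_toLp_eq, Lp.toTemperedDistribution_toLp_eq, besselPotential,
    fourierMultiplierCLM_toTemperedDistributionCLM_eq (by fun_prop)]

/-- Schwartz functions are dense in `H²` for the graph norm of the Laplacian. -/
theorem exists_schwartz_approx (u : (laplacian n).domain) {ε : ℝ} (hε : 0 < ε) :
    ∃ φ : 𝓢(Rn n, ℂ), ‖φ.toLp 2 volume - (u : L2 n)‖ < ε ∧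
      ‖(Δ φ : 𝓢(Rn n, ℂ)).toLp 2 volume - laplacian n u‖ < ε := by
  set K : ℝ := (2 * Real.pi) ^ 2 with hK
  have hK0 : 0 < K := by positivity
  set ε' := ε / (1 + 2 * K) with hε'
  have hε'0 : 0 < ε' := by positivity
  have hεε : ε' * (1 + 2 * K) = ε := by rw [hε']; field_simp
  obtain ⟨_, ⟨ψ, rfl⟩, hψ⟩ := Metric.mem_closure_iff.mp
    (SchwartzMap.denseRange_toLpCLM (F := ℂ) (μ := (volume : Measure (Rn n)))
      ENNReal.ofNat_ne_top (bessel n u)) ε' hε'0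
  obtain ⟨φ, hφ⟩ := exists_bessel_toLp_eq ψ
  set v : (laplacian n).domain := ⟨φ.toLp 2 volume, toLp_mem_domain φ⟩ with hv
  have h1 : ‖bessel n (v - u)‖ < ε' := by
    rw [map_sub, hφ, ← dist_eq_norm, dist_comm]
    exact hψ
  have h2 : ‖((v - u : (laplacian n).domain) : L2 n)‖ < ε' := (norm_le_norm_bessel _).trans_lt h1
  refine ⟨φ, ?_, ?_⟩
  · change ‖((v - u : (laplacian n).domain) : L2 n)‖ < ε
    nlinarith
  · rw [← laplacian_toLp, ← LinearPMap.map_sub, ← hv, laplacian_eq_bessel, norm_smul,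
      Complex.norm_real, Real.norm_of_nonneg hK0.le]
    have h3 := norm_sub_le ((v - u : (laplacian n).domain) : L2 n) (bessel n (v - u))
    nlinarith

theorem pd_clm_comp (L : ℂ →L[ℝ] ℝ) (φ : 𝓢(Rn n, ℂ)) (i : Fin n) :
    pd i (fun x => L (φ x)) =
      fun x => L ((∂_{EuclideanSpace.single i (1 : ℝ)} φ : 𝓢(Rn n, ℂ)) x) := by
  ext x
  rw [pd, SchwartzMap.lineDerivOp_apply_eq_fderiv]
  exact congrArg (fun T => T (EuclideanSpace.single i (1 : ℝ)))
    (L.hasFDerivAt.comp x (φ.hasFDerivAt x)).fderiv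

theorem lap_clm_comp (L : ℂ →L[ℝ] ℝ) (φ : 𝓢(Rn n, ℂ)) (x : Rn n) :
    lap (fun x => L (φ x)) x = L ((Δ φ : 𝓢(Rn n, ℂ)) x) := by
  rw [lap, SchwartzMap.laplacian_eq_sum (EuclideanSpace.basisFun (Fin n) ℝ), sum_apply,
    map_sum]
  refine Finset.sum_congr rfl fun i _ => ?_
  rw [pd_clm_comp, pd_clm_comp, EuclideanSpace.basisFun_apply]

/-- The Euler field applied to a Schwartz function. -/
def schwartzEuler (φ : 𝓢(Rn n, ℂ)) : 𝓢(Rn n, ℂ) :=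
  ∑ i : Fin n, SchwartzMap.smulLeftCLM ℂ
    (fun x : Rn n => inner ℝ x (EuclideanSpace.single i (1 : ℝ)))
    (∂_{EuclideanSpace.single i (1 : ℝ)} φ)

theorem euler_clm_comp (L : ℂ →L[ℝ] ℝ) (φ : 𝓢(Rn n, ℂ)) (x : Rn n) :
    euler (fun x => L (φ x)) x = L (schwartzEuler φ x) := by
  rw [euler, schwartzEuler, sum_apply, map_sum]
  refine Finset.sum_congr rfl fun i _ => ?_
  rw [pd_clm_comp, SchwartzMap.smulLeftCLM_apply_apply (by fun_prop), map_smul, smul_eq_mul,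
    EuclideanSpace.inner_single_right]
  simp

theorem contDiff_clm_comp (L : ℂ →L[ℝ] ℝ) (φ : 𝓢(Rn n, ℂ)) : ContDiff ℝ 2 fun x => L (φ x) :=
  L.contDiff.comp (φ.smooth 2)

theorem lap_cutoff_mul (L : ℂ →L[ℝ] ℝ) (φ : 𝓢(Rn n, ℂ)) (c : ℝ) (x : Rn n) :
    lap (fun x => cutoff n c x * L (φ x)) x =
      L ((cutoff n c x : ℂ) * (Δ φ : 𝓢(Rn n, ℂ)) x +
        ((2 * cutoff₁ n c x : ℝ) : ℂ) * schwartzEuler φ x +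
        ((n * cutoff₁ n c x + ‖x‖ ^ 2 * cutoff₂ n c x : ℝ) : ℂ) * φ x) := by
  rw [lap_radial_mul (contDiff_clm_comp L φ) (cutoff_radial n c) (cutoff₁_radial n c),
    lap_clm_comp, euler_clm_comp]
  simp only [← smul_eq_mul (a := ((_ : ℝ) : ℂ)), Complex.coe_smul, map_add, map_smul]
  simp only [smul_eq_mul]

/-- The function `‖x‖² φ(x)`. -/
def normSqMul (φ : 𝓢(Rn n, ℂ)) : 𝓢(Rn n, ℂ) :=
  SchwartzMap.smulLeftCLM ℂ (fun x : Rn n => ‖x‖ ^ 2) φ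

theorem norm_normSqMul (φ : 𝓢(Rn n, ℂ)) (x : Rn n) : ‖normSqMul φ x‖ = ‖x‖ ^ 2 * ‖φ x‖ := by
  rw [normSqMul, SchwartzMap.smulLeftCLM_apply_apply (by fun_prop), norm_smul,
    Real.norm_of_nonneg (by positivity)]

theorem contDiff_cutoff_mul (L : ℂ →L[ℝ] ℝ) (φ : 𝓢(Rn n, ℂ)) (c : ℝ) :
    ContDiff ℝ 2 fun x => cutoff n c x * L (φ x) :=
  (contDiff_cutoff n c).mul (contDiff_clm_comp L φ)

theorem hasCompactSupport_cutoff_mul (L : ℂ →L[ℝ] ℝ) (φ : 𝓢(Rn n, ℂ)) {c : ℝ} (hc : 0 < c) :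
    HasCompactSupport fun x => cutoff n c x * L (φ x) :=
  (hasCompactSupport_cutoff hc).mul_right

/-- A function in `L²` that controls the errors caused by a cutoff. -/
def cutoffMajorant (φ : 𝓢(Rn n, ℂ)) (x : Rn n) : ℝ :=
  3 * ‖normSqMul φ x‖ + 3 * ‖normSqMul (Δ φ) x‖ + 12 * ‖schwartzEuler φ x‖ +
    (6 * n + 24) * ‖φ x‖

theorem memLp_cutoffMajorant (φ : 𝓢(Rn n, ℂ)) : MemLp (cutoffMajorant φ) 2 volume :=
  (((((normSqMul φ).memLp 2 volume).norm.const_mul 3).add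
    (((normSqMul (Δ φ)).memLp 2 volume).norm.const_mul 3)).add
    (((schwartzEuler φ).memLp 2 volume).norm.const_mul 12)).add
    ((φ.memLp 2 volume).norm.const_mul (6 * n + 24))

theorem norm_toLp_sub_le {f : Rn n → ℂ} (hf : MemLp f 2 volume) (φ : 𝓢(Rn n, ℂ)) {G : Rn n → ℝ}
    (hG : MemLp G 2 volume) {c : ℝ} (hc : 0 ≤ c) (h : ∀ x, ‖f x - φ x‖ ≤ c * G x) :
    ‖hf.toLp f - φ.toLp 2 volume‖ ≤ c * ‖hG.toLp G‖ := by
  refine Lp.norm_le_mul_norm_of_ae_le_mul ?_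
  filter_upwards [Lp.coeFn_sub (hf.toLp f) (φ.toLp 2 volume), hf.coeFn_toLp, hG.coeFn_toLp,
    φ.coeFn_toLp 2 volume] with x h1 h2 h3 h4
  rw [h1, Pi.sub_apply, h2, h3, h4]
  exact (h x).trans (mul_le_mul_of_nonneg_left (le_abs_self _) hc)

theorem norm_cutoff_mul_sub_le (φ : 𝓢(Rn n, ℂ)) {c : ℝ} (hc : 0 < c) (x : Rn n) :
    ‖(cutoff n c x : ℂ) * φ x - φ x‖ ≤ c * cutoffMajorant φ x := by
  have h1 := mul_le_mul_of_nonneg_right (abs_cutoff_sub_one_le hc x) (norm_nonneg (φ x))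
  have h2 : (cutoff n c x : ℂ) * φ x - φ x = ((cutoff n c x - 1 : ℝ) : ℂ) * φ x := by
    push_cast
    ring
  rw [h2, norm_mul, Complex.norm_real, Real.norm_eq_abs, cutoffMajorant, norm_normSqMul]
  refine h1.trans ?_
  have h3 : 0 ≤ c * (3 * ‖normSqMul (Δ φ) x‖ + 12 * ‖schwartzEuler φ x‖ +
    (6 * n + 24) * ‖φ x‖) := by positivity
  linarith

theorem norm_lap_cutoff_sub_le (φ : 𝓢(Rn n, ℂ)) {c : ℝ} (hc : 0 < c) (x : Rn n) :
    ‖(cutoff n c x : ℂ) * (Δ φ : 𝓢(Rn n, ℂ)) x +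
        ((2 * cutoff₁ n c x : ℝ) : ℂ) * schwartzEuler φ x +
        ((n * cutoff₁ n c x + ‖x‖ ^ 2 * cutoff₂ n c x : ℝ) : ℂ) * φ x - (Δ φ : 𝓢(Rn n, ℂ)) x‖ ≤
      c * cutoffMajorant φ x := by
  set D := (Δ φ : 𝓢(Rn n, ℂ)) x with hD
  have e1 : ‖((cutoff n c x - 1 : ℝ) : ℂ) * D‖ ≤ 3 * c * ‖x‖ ^ 2 * ‖D‖ := by
    rw [norm_mul, Complex.norm_real, Real.norm_eq_abs]
    exact mul_le_mul_of_nonneg_right (abs_cutoff_sub_one_le hc x) (norm_nonneg _)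
  have e2 : ‖((2 * cutoff₁ n c x : ℝ) : ℂ) * schwartzEuler φ x‖ ≤
      12 * c * ‖schwartzEuler φ x‖ := by
    rw [norm_mul, Complex.norm_real, Real.norm_eq_abs, abs_mul, abs_two]
    refine mul_le_mul_of_nonneg_right ?_ (norm_nonneg _)
    linarith [abs_cutoff₁_le hc x]
  have e3 : ‖((n * cutoff₁ n c x + ‖x‖ ^ 2 * cutoff₂ n c x : ℝ) : ℂ) * φ x‖ ≤
      (n * (6 * c) + 24 * c) * ‖φ x‖ := by
    rw [norm_mul, Complex.norm_real, Real.norm_eq_abs]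
    refine mul_le_mul_of_nonneg_right ((abs_add_le _ _).trans (add_le_add ?_ ?_)) (norm_nonneg _)
    · rw [abs_mul, Nat.abs_cast]
      exact mul_le_mul_of_nonneg_left (abs_cutoff₁_le hc x) (by positivity)
    · exact abs_sq_mul_cutoff₂_le hc x
  have e4 : (cutoff n c x : ℂ) * D + ((2 * cutoff₁ n c x : ℝ) : ℂ) * schwartzEuler φ x +
      ((n * cutoff₁ n c x + ‖x‖ ^ 2 * cutoff₂ n c x : ℝ) : ℂ) * φ x - D =
      ((cutoff n c x - 1 : ℝ) : ℂ) * D + ((2 * cutoff₁ n c x : ℝ) : ℂ) * schwartzEuler φ x +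
      ((n * cutoff₁ n c x + ‖x‖ ^ 2 * cutoff₂ n c x : ℝ) : ℂ) * φ x := by
    push_cast
    ring
  rw [e4]
  refine (norm_add₃_le).trans ((add_le_add (add_le_add e1 e2) e3).trans ?_)
  rw [cutoffMajorant, norm_normSqMul, norm_normSqMul, ← hD]
  have h3 : 0 ≤ c * (3 * (‖x‖ ^ 2 * ‖φ x‖)) := by positivity
  linarith

theorem memLp_add_mul_I {a b : Rn n → ℝ} (ha : MemLp a 2 volume) (hb : MemLp b 2 volume) :
    MemLp (fun x => (a x : ℂ) + b x * Complex.I) 2 volume := by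
  have h1 : MemLp (fun x => (a x : ℂ)) 2 volume := ha.ofReal (K := ℂ)
  have h2 : MemLp (fun x => (b x : ℂ)) 2 volume := hb.ofReal (K := ℂ)
  exact h1.add (h2.mul_const Complex.I)

theorem hasCompactSupport_lap {a : Rn n → ℝ} (ha : HasCompactSupport a) :
    HasCompactSupport (lap a) :=
  HasCompactSupport.intro ha.isCompact fun _ hx => lap_eq_zero hx

/-- Compactly supported functions of class `C²` are dense in `H²` for the graph norm of the
Laplacian. -/
theorem exists_compactSupport_approx (u : (laplacian n).domain) {ε : ℝ} (hε : 0 < ε) :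
    ∃ a b : Rn n → ℝ, ContDiff ℝ 2 a ∧ HasCompactSupport a ∧ ContDiff ℝ 2 b ∧
      HasCompactSupport b ∧ ∃ w l : L2 n, (w =ᵐ[volume] fun x => (a x : ℂ) + b x * Complex.I) ∧
        (l =ᵐ[volume] fun x => (lap a x : ℂ) + lap b x * Complex.I) ∧
        ‖w - u‖ < ε ∧ ‖l - laplacian n u‖ < ε := by
  obtain ⟨φ, h1, h2⟩ := exists_schwartz_approx u (half_pos hε)
  have hG := memLp_cutoffMajorant φ
  set K := ‖hG.toLp _‖ with hK
  have hK0 : 0 ≤ K := norm_nonneg _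
  set c := ε / (2 * (K + 1)) with hc
  have hc0 : 0 < c := by positivity
  have hcK : c * K ≤ ε / 2 := by
    have : c * (K + 1) = ε / 2 := by rw [hc]; field_simp
    linarith
  set a : Rn n → ℝ := fun x => cutoff n c x * Complex.reCLM (φ x) with ha
  set b : Rn n → ℝ := fun x => cutoff n c x * Complex.imCLM (φ x) with hb
  have a1 : ContDiff ℝ 2 a := contDiff_cutoff_mul _ φ c
  have b1 : ContDiff ℝ 2 b := contDiff_cutoff_mul _ φ c
  have a2 : HasCompactSupport a := hasCompactSupport_cutoff_mul _ φ hc0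
  have b2 : HasCompactSupport b := hasCompactSupport_cutoff_mul _ φ hc0
  have m1 := memLp_add_mul_I (a1.continuous.memLp_of_hasCompactSupport a2 (p := 2) (μ := volume))
    (b1.continuous.memLp_of_hasCompactSupport b2 (p := 2) (μ := volume))
  have m2 := memLp_add_mul_I
    ((continuous_lap a1).memLp_of_hasCompactSupport (hasCompactSupport_lap a2) (p := 2)
      (μ := volume))
    ((continuous_lap b1).memLp_of_hasCompactSupport (hasCompactSupport_lap b2) (p := 2)
      (μ := volume))
  refine ⟨a, b, a1, a2, b1, b2, m1.toLp _, m2.toLp _, m1.coeFn_toLp, m2.coeFn_toLp, ?_, ?_⟩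
  · have h3 : ‖m1.toLp _ - φ.toLp 2 volume‖ ≤ c * K :=
      norm_toLp_sub_le m1 φ hG hc0.le fun x => by
        refine le_of_eq_of_le (congrArg norm ?_) (norm_cutoff_mul_sub_le φ hc0 x)
        apply Complex.ext <;> simp [ha, hb]
    have h4 := norm_sub_le_norm_sub_add_norm_sub (m1.toLp _) (φ.toLp 2 volume) (u : L2 n)
    linarith
  · have h3 : ‖m2.toLp _ - (Δ φ : 𝓢(Rn n, ℂ)).toLp 2 volume‖ ≤ c * K :=
      norm_toLp_sub_le m2 _ hG hc0.le fun x => by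
        refine le_of_eq_of_le (congrArg norm ?_) (norm_lap_cutoff_sub_le φ hc0 x)
        rw [ha, hb, lap_cutoff_mul, lap_cutoff_mul]
        simp only [Complex.reCLM_apply, Complex.imCLM_apply, Complex.re_add_im]
    have h4 := norm_sub_le_norm_sub_add_norm_sub (m2.toLp _) ((Δ φ : 𝓢(Rn n, ℂ)).toLp 2 volume)
      (laplacian n u)
    linarith

end Semiclassical
end

/-! ### From the real Carleman estimate to the weighted resolvent bound. -/

noncomputable section
namespace Semiclassical

open scoped InnerProductSpace

variable {n : ℕ}

theorem norm_sq_eq_integral (f : L2 n) :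
    ‖f‖ ^ 2 = (∫ x, (f x).re ^ 2) + ∫ x, (f x).im ^ 2 := by
  have h1 : (⟪f, f⟫_ℂ).re = ∫ x, ((f x).re ^ 2 + (f x).im ^ 2) := by
    have h2 : (fun x => ⟪f x, f x⟫_ℂ) = fun x => (((f x).re ^ 2 + (f x).im ^ 2 : ℝ) : ℂ) := by
      ext x
      have h3 : ‖f x‖ ^ 2 = (f x).re ^ 2 + (f x).im ^ 2 := by
        rw [Complex.sq_norm, Complex.normSq_apply]
        ring
      rw [inner_self_eq_norm_sq_to_K, ← h3]
      push_cast
      rfl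
    rw [L2.inner_def, h2, integral_complex_ofReal, Complex.ofReal_re]
  rw [← @inner_self_eq_norm_sq ℂ, ← integral_add]
  · exact h1
  · exact (Lp.memLp f).re.integrable_sq
  · exact (Lp.memLp f).im.integrable_sq

theorem norm_sq_eq_of_ae {f : L2 n} {a b : Rn n → ℝ}
    (h : f =ᵐ[volume] fun x => (a x : ℂ) + b x * Complex.I) :
    ‖f‖ ^ 2 = (∫ x, a x ^ 2) + ∫ x, b x ^ 2 := by
  rw [norm_sq_eq_integral]
  congr 1 <;> refine integral_congr_ae ?_ <;> filter_upwards [h] with x hx <;> simp [hx]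

/-- The real Carleman estimate, with a loss `K`, for the operator `-h² Δ + V - E`. -/
def CarlemanBound (V : Rn n → ℝ) (E h s K : ℝ) : Prop :=
  ∀ {u g r : Rn n → ℝ} {κ : ℝ}, 0 < κ → κ ≤ 1 → ContDiff ℝ 2 u → HasCompactSupport u →
    MemLp g 2 volume → MemLp r 2 volume →
    (∀ᵐ x, -h ^ 2 * lap u x + (V x - E) * u x = weight n s x * g x + r x) →
    ∫ x, (weight n s x * u x) ^ 2 ≤
      K * ((∫ x, g x ^ 2) + κ * (∫ x, u x ^ 2) + κ⁻¹ * ∫ x, r x ^ 2)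

/-- Real and imaginary parts solve real equations coupled only by `±θ` times the other part, which
is put in the residual. With `κ = θ` the coupling costs `2θ` times the squared norm of the other
part, which together with the `κ` term gives 3. -/
theorem CarlemanBound.complex {V : Rn n → ℝ} {E h s K θ σ : ℝ} (hC : CarlemanBound V E h s K)
    (hV : MemLp V ∞ volume) (hs : 0 ≤ s) (hK : 0 ≤ K) (hθ : 0 < θ) (hθ1 : θ < 1)
    (hσ : σ = 1 ∨ σ = -1) {a b : Rn n → ℝ} (ha : ContDiff ℝ 2 a) (ha' : HasCompactSupport a)
    (hb : ContDiff ℝ 2 b) (hb' : HasCompactSupport b) {w l g e : L2 n}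
    (hw : w =ᵐ[volume] fun x => (a x : ℂ) + b x * Complex.I)
    (hl : l =ᵐ[volume] fun x => (lap a x : ℂ) + lap b x * Complex.I)
    (he : -((h : ℂ) ^ 2 • l) + mulOp hV w - ((E : ℂ) - (σ : ℂ) * Complex.I * (θ : ℂ)) • w =
      mulOp (weight_memLp n hs) g + e) :
    ‖mulOp (weight_memLp n hs) w‖ ^ 2 ≤
      K * (‖g‖ ^ 2 + 3 * θ * ‖w‖ ^ 2 + 2 * θ⁻¹ * ‖e‖ ^ 2) := by
  have hσ2 : σ ^ 2 = 1 := by rcases hσ with h | h <;> rw [h] <;> norm_num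
  have aL : MemLp a 2 volume := ha.continuous.memLp_of_hasCompactSupport ha'
  have bL : MemLp b 2 volume := hb.continuous.memLp_of_hasCompactSupport hb'
  have gre : MemLp (fun x => (g x).re) 2 volume := (Lp.memLp g).re
  have gim : MemLp (fun x => (g x).im) 2 volume := (Lp.memLp g).im
  have ere : MemLp (fun x => (e x).re) 2 volume := (Lp.memLp e).re
  have eim : MemLp (fun x => (e x).im) 2 volume := (Lp.memLp e).im
  have r1L : MemLp (fun x => (e x).re + σ * θ * b x) 2 volume := ere.add (bL.const_mul (σ * θ))
  have r2L : MemLp (fun x => (e x).im + -(σ * θ) * a x) 2 volume :=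
    eim.add (aL.const_mul (-(σ * θ)))
  have key : ∀ᵐ x, -(h : ℂ) ^ 2 * ((lap a x : ℂ) + lap b x * Complex.I) +
      (V x : ℂ) * ((a x : ℂ) + b x * Complex.I) -
      ((E : ℂ) - (σ : ℂ) * Complex.I * (θ : ℂ)) * ((a x : ℂ) + b x * Complex.I) =
      (weight n s x : ℂ) * g x + e x := by
    have he' := congrArg (fun f : L2 n => (f : Rn n → ℂ)) he
    have he'' : (↑(-((h : ℂ) ^ 2 • l) + mulOp hV w -
        ((E : ℂ) - (σ : ℂ) * Complex.I * (θ : ℂ)) • w) : Rn n → ℂ) =ᵐ[volume]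
        ↑(mulOp (weight_memLp n hs) g + e) := Filter.EventuallyEq.of_eq he'
    filter_upwards [he'', hw, hl, mulOp_ae hV w, mulOp_ae (weight_memLp n hs) g,
      Lp.coeFn_sub (-((h : ℂ) ^ 2 • l) + mulOp hV w)
        (((E : ℂ) - (σ : ℂ) * Complex.I * (θ : ℂ)) • w),
      Lp.coeFn_add (-((h : ℂ) ^ 2 • l)) (mulOp hV w), Lp.coeFn_neg ((h : ℂ) ^ 2 • l),
      Lp.coeFn_smul ((h : ℂ) ^ 2) l,
      Lp.coeFn_smul ((E : ℂ) - (σ : ℂ) * Complex.I * (θ : ℂ)) w,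
      Lp.coeFn_add (mulOp (weight_memLp n hs) g) e] with x k0 k1 k2 k3 k4 k5 k6 k7 k8 k9 k10
    rw [k5, k10, Pi.sub_apply, k6, Pi.add_apply, Pi.add_apply, k7, Pi.neg_apply, k8, k9,
      Pi.smul_apply, Pi.smul_apply, k3, k4, k1, k2, smul_eq_mul, smul_eq_mul] at k0
    rw [← k0]
    ring
  have keyre : ∀ᵐ x, -h ^ 2 * lap a x + (V x - E) * a x =
      weight n s x * (g x).re + ((e x).re + σ * θ * b x) := by
    filter_upwards [key] with x hx
    have := congrArg Complex.re hx
    simp [← Complex.ofReal_pow] at this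
    linarith
  have keyim : ∀ᵐ x, -h ^ 2 * lap b x + (V x - E) * b x =
      weight n s x * (g x).im + ((e x).im + -(σ * θ) * a x) := by
    filter_upwards [key] with x hx
    have := congrArg Complex.im hx
    simp [← Complex.ofReal_pow] at this
    linarith
  have c1 := hC hθ hθ1.le ha ha' gre r1L keyre
  have c2 := hC hθ hθ1.le hb hb' gim r2L keyim
  have hr : ∀ {p q : Rn n → ℝ} {t : ℝ}, t ^ 2 = θ ^ 2 → MemLp p 2 volume → MemLp q 2 volume →
      MemLp (fun x => p x + t * q x) 2 volume →
      θ⁻¹ * ∫ x, (p x + t * q x) ^ 2 ≤ 2 * θ⁻¹ * (∫ x, p x ^ 2) + 2 * θ * ∫ x, q x ^ 2 := by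
    intro p q t ht hp hq hpq
    have h1 : ∫ x, (p x + t * q x) ^ 2 ≤ 2 * (∫ x, p x ^ 2) + 2 * θ ^ 2 * ∫ x, q x ^ 2 := by
      rw [← integral_const_mul, ← integral_const_mul,
        ← integral_add (hp.integrable_sq.const_mul _) (hq.integrable_sq.const_mul _)]
      refine integral_mono hpq.integrable_sq
        ((hp.integrable_sq.const_mul _).add (hq.integrable_sq.const_mul _)) fun x => ?_
      change _ ≤ 2 * p x ^ 2 + 2 * θ ^ 2 * q x ^ 2
      rw [← ht]
      nlinarith [sq_nonneg (p x - t * q x)]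
    have h2 := mul_le_mul_of_nonneg_left h1 (inv_nonneg.mpr hθ.le)
    refine h2.trans (le_of_eq ?_)
    field_simp
  have r1 := hr (by rw [mul_pow, hσ2, one_mul]) ere bL r1L
  have r2 := hr (by rw [neg_sq, mul_pow, hσ2, one_mul]) eim aL r2L
  have hww : mulOp (weight_memLp n hs) w =ᵐ[volume] fun x =>
      ((weight n s x * a x : ℝ) : ℂ) + (weight n s x * b x : ℝ) * Complex.I := by
    filter_upwards [mulOp_ae (weight_memLp n hs) w, hw] with x h1 h2
    rw [h1, h2]
    push_cast
    ring
  rw [norm_sq_eq_of_ae hww, norm_sq_eq_of_ae hw, norm_sq_eq_integral g, norm_sq_eq_integral e]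
  refine (add_le_add c1 c2).trans ?_
  rw [← mul_add]
  refine mul_le_mul_of_nonneg_left ?_ hK
  linarith

/-- The weighted estimate on `H²`, by density. -/
theorem CarlemanBound.norm_sq_le {V : Rn n → ℝ} {E h s K θ σ : ℝ} (hC : CarlemanBound V E h s K)
    (hV : MemLp V ∞ volume) (hs : 0 ≤ s) (hK : 0 ≤ K) (hθ : 0 < θ) (hθ1 : θ < 1)
    (hσ : σ = 1 ∨ σ = -1) (u : (laplacian n).domain) {g : L2 n}
    (hu : schrodinger h hV u - ((E : ℂ) - (σ : ℂ) * Complex.I * (θ : ℂ)) • (u : L2 n) =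
      mulOp (weight_memLp n hs) g) :
    ‖mulOp (weight_memLp n hs) (u : L2 n)‖ ^ 2 ≤
      K * (‖g‖ ^ 2 + 3 * θ * ‖(u : L2 n)‖ ^ 2) := by
  choose a b ha ha' hb hb' w l hw hl hwu hlu using fun k : ℕ =>
    exists_compactSupport_approx u (Nat.one_div_pos_of_nat (α := ℝ) (n := k))
  set z : ℂ := (E : ℂ) - (σ : ℂ) * Complex.I * (θ : ℂ)
  have tw : Filter.Tendsto w Filter.atTop (nhds (u : L2 n)) := by
    rw [tendsto_iff_norm_sub_tendsto_zero]
    exact squeeze_zero (fun _ => norm_nonneg _) (fun k => (hwu k).le)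
      tendsto_one_div_add_atTop_nhds_zero_nat
  have tl : Filter.Tendsto l Filter.atTop (nhds (laplacian n u)) := by
    rw [tendsto_iff_norm_sub_tendsto_zero]
    exact squeeze_zero (fun _ => norm_nonneg _) (fun k => (hlu k).le)
      tendsto_one_div_add_atTop_nhds_zero_nat
  set e : ℕ → L2 n := fun k =>
    -((h : ℂ) ^ 2 • l k) + mulOp hV (w k) - z • w k - mulOp (weight_memLp n hs) g with he
  -- For fixed `θ` the residuals vanish in the limit, so the factor `θ⁻¹` in front of them does no
  -- harm.
  have te : Filter.Tendsto e Filter.atTop (nhds 0) := by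
    have : Filter.Tendsto e Filter.atTop (nhds (-((h : ℂ) ^ 2 • laplacian n u) +
        mulOp hV (u : L2 n) - z • (u : L2 n) - mulOp (weight_memLp n hs) g)) :=
      ((((tl.const_smul _).neg).add (((mulOp hV).continuous.tendsto _).comp tw)).sub
        (tw.const_smul z)).sub_const _
    rwa [← schrodinger_apply, hu, sub_self] at this
  have hk : ∀ k, ‖mulOp (weight_memLp n hs) (w k)‖ ^ 2 ≤
      K * (‖g‖ ^ 2 + 3 * θ * ‖w k‖ ^ 2 + 2 * θ⁻¹ * ‖e k‖ ^ 2) := fun k =>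
    hC.complex hV hs hK hθ hθ1 hσ (ha k) (ha' k) (hb k) (hb' k) (hw k) (hl k)
      (by rw [he]; exact (add_sub_cancel _ _).symm)
  have t1 : Filter.Tendsto (fun k => ‖mulOp (weight_memLp n hs) (w k)‖ ^ 2) Filter.atTop
      (nhds (‖mulOp (weight_memLp n hs) (u : L2 n)‖ ^ 2)) :=
    ((((mulOp (weight_memLp n hs)).continuous.tendsto _).comp tw).norm).pow 2
  have t2 : Filter.Tendsto (fun k => K * (‖g‖ ^ 2 + 3 * θ * ‖w k‖ ^ 2 + 2 * θ⁻¹ * ‖e k‖ ^ 2))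
      Filter.atTop (nhds (K * (‖g‖ ^ 2 + 3 * θ * ‖(u : L2 n)‖ ^ 2 + 2 * θ⁻¹ * ‖(0 : L2 n)‖ ^ 2))) :=
    (((((tw.norm).pow 2).const_mul _).const_add _).add (((te.norm).pow 2).const_mul _)).const_mul _
  refine (le_of_tendsto_of_tendsto' t1 t2 hk).trans (le_of_eq ?_)
  rw [norm_zero]
  ring

/-- The imaginary part of the pairing of `u` with its equation gives `θ‖u‖² ≤ X G`, where `X` is the
norm of the weighted solution and `G = ‖g‖`; moving one weight onto `u` is what brings in `X`. Then
`X² ≤ K(G² + 3XG)`, which forces `X ≤ 4KG`. -/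
theorem CarlemanBound.norm_le {V : Rn n → ℝ} {E h s K θ σ : ℝ} (hC : CarlemanBound V E h s K)
    (hV : MemLp V ∞ volume) (hs : 0 ≤ s) (hK : 1 ≤ K) (hθ : 0 < θ) (hθ1 : θ < 1)
    (hσ : σ = 1 ∨ σ = -1) (u : (laplacian n).domain) {g : L2 n}
    (hu : schrodinger h hV u - ((E : ℂ) - (σ : ℂ) * Complex.I * (θ : ℂ)) • (u : L2 n) =
      mulOp (weight_memLp n hs) g) :
    ‖mulOp (weight_memLp n hs) (u : L2 n)‖ ≤ 4 * K * ‖g‖ := by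
  have h1 := hC.norm_sq_le hV hs (by linarith) hθ hθ1 hσ u hu
  have h2 : θ * ‖(u : L2 n)‖ ^ 2 ≤ ‖mulOp (weight_memLp n hs) (u : L2 n)‖ * ‖g‖ := by
    have h3 := im_inner_self_of_symmetric (A := schrodinger h hV) (schrodinger_symmetric h hV)
      ((E : ℂ) - (σ : ℂ) * Complex.I * (θ : ℂ)) u
    rw [hu, ← mulOp_symmetric] at h3
    have h4 : |(⟪mulOp (weight_memLp n hs) (u : L2 n), g⟫_ℂ).im| ≤
        ‖mulOp (weight_memLp n hs) (u : L2 n)‖ * ‖g‖ :=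
      (Complex.abs_im_le_norm _).trans (norm_inner_le_norm _ _)
    rw [h3] at h4
    refine le_of_eq_of_le ?_ h4
    have h5 : |-((E : ℂ) - (σ : ℂ) * Complex.I * (θ : ℂ)).im| = θ := by
      rcases hσ with h | h <;> simp [h, abs_of_pos hθ]
    rw [abs_mul, h5, abs_of_nonneg (sq_nonneg ‖(u : L2 n)‖)]
  set X := ‖mulOp (weight_memLp n hs) (u : L2 n)‖
  set G := ‖g‖ with hG
  have hG0 : 0 ≤ G := norm_nonneg _
  by_contra! hlt
  have hKG : 0 ≤ K * G := by positivity
  have hGK : G ≤ K * G := le_mul_of_one_le_left hG0 hK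
  have h3 : X ^ 2 ≤ K * (G ^ 2 + 3 * (X * G)) :=
    h1.trans (mul_le_mul_of_nonneg_left (by linarith) (by linarith))
  have hX : 0 < X := by linarith
  have h4 : K * G * G ≤ X / 4 * (X / 4) := by gcongr <;> linarith
  have h5 : K * G * X ≤ X / 4 * X := by gcongr; linarith
  nlinarith

end Semiclassical
end

theorem corollary1p3 (n : ℕ) (hn : 3 ≤ n)
    (C₁ δ : ℝ) (hC₁ : 0 < C₁) (hδ : 1 < δ) (hδ' : δ ≤ 3)
    (V : Semiclassical.Rn n → ℝ) (hV : MemLp V ∞ volume)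
    (hVS : ∀ᵐ x ∂(volume : Measure (Semiclassical.Rn n)), |V x| ≤ C₁ * (‖x‖ + 1) ^ (-δ))
    (E : ℝ) (hE : 0 < E) (s : ℝ) (hs : 1 / 2 < s) :
    ∃ C h₀ : ℝ, 0 < C ∧ 0 < h₀ ∧
      ∀ h : ℝ, 0 < h → h ≤ h₀ → ∀ θ : ℝ, 0 < θ → θ < 1 →
        ∀ σ : ℝ, σ = 1 ∨ σ = -1 →
          ∃ R : Semiclassical.L2 n →L[ℂ] Semiclassical.L2 n,
            Semiclassical.IsResolvent (Semiclassical.schrodinger h hV)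
              ((E : ℂ) - (σ : ℂ) * Complex.I * (θ : ℂ)) R ∧
            Real.log ‖Semiclassical.weighted (by linarith : (0 : ℝ) ≤ s) R‖ ≤
              C * h ^ (-((2 * δ + 5) / (3 * (δ - 1)))) := by
  obtain ⟨C, h₀, hC, hh₀, H⟩ := Semiclassical.semiclassical_carleman hn hC₁ hδ hδ' hE hs
  -- The 2 absorbs `log 4` from the factor 4, because the power of `h` is at least 1.
  refine ⟨C + 2, h₀, by positivity, hh₀, fun h hh hle θ hθ hθ1 σ hσ => ?_⟩
  obtain ⟨h1, Hh⟩ := H h hh hle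
  have hs0 : 0 ≤ s := by linarith
  have hz : ((E : ℂ) - (σ : ℂ) * Complex.I * (θ : ℂ)).im ≠ 0 := by
    rcases hσ with h | h <;> simp [h, hθ.ne']
  obtain ⟨R, hR⟩ := Semiclassical.exists_resolvent_schrodinger hh hV hz
  refine ⟨R, hR, ?_⟩
  set Z := h ^ (-((2 * δ + 5) / (3 * (δ - 1)))) with hZ
  have hZ1 : 1 ≤ Z := Real.one_le_rpow_of_pos_of_le_one_of_nonpos hh h1
    (neg_nonpos.mpr (div_nonneg (by linarith) (by linarith)))
  have hK : 1 ≤ Real.exp (C * Z) := Real.one_le_exp (by positivity)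
  have hbd : ‖Semiclassical.weighted hs0 R‖ ≤ 4 * Real.exp (C * Z) := by
    refine ContinuousLinearMap.opNorm_le_bound _ (by positivity) fun g => ?_
    obtain ⟨hg, hgR⟩ := hR.1 (Semiclassical.mulOp (Semiclassical.weight_memLp n hs0) g)
    have hcar : Semiclassical.CarlemanBound V E h s (Real.exp (C * Z)) :=
      fun hκ hκ1 hu hsu hg hr heq => Hh hκ hκ1 hVS hu hsu hg hr heq
    exact hcar.norm_le hV hs0 hK hθ hθ1 hσ ⟨_, hg⟩ hgR
  -- If the norm were zero, `Real.log 0 = 0` still satisfies the bound.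
  rcases (norm_nonneg (Semiclassical.weighted hs0 R)).eq_or_lt' with h0 | h0
  · rw [h0, Real.log_zero]
    positivity
  · refine (Real.log_le_log h0 hbd).trans ?_
    rw [Real.log_mul (by norm_num) (Real.exp_pos _).ne', Real.log_exp]
    have h4 : Real.log 4 ≤ 2 := by
      have h5 := Real.log_two_lt_d9
      rw [show (4 : ℝ) = 2 ^ 2 by norm_num, Real.log_pow]
      push_cast
      linarith
    nlinarith
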